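/- **Setting.** Let $d\ge 2$, $N\ge1$. Let $\Omega\subset\mathbb R^d$ be a bounded, connected, open Lipschitz set with $\partial\Omega=\overline{\Gamma_N}\cup\overline{\Gamma_D}$, where $\Gamma_N,\Gamma_D$ are disjoint and relatively open in $\partial\Omega$, and $\Gamma_D=\Gamma_D^1\cup\Gamma_D^2$ with $\Gamma_D^1,\Gamma_D^2$ connected, separated and of positive surface measure. Let $\Gamma\subset\Omega$ be connected and split $\Omega$: $\Omega\setminus\Gamma=\Omega_1\cup\Omega_2$ with $\Omega_1,\Omega_2$ disjoint, open, connected, Lipschitz, $\Gamma=\Omega\cap\partial\Omega_1=\Omega\cap\partial\Omega_2$, and $\Gamma_D^i\subset\partial\Omega_i$. The normal $\boldsymbol n$ on $\Gamma$ points out of $\Omega_1$. Integrals over $\Gamma$ are with respect to surface measure. An *$N$-function* is a Carathéodory function $\Upsilon(x,z)\ge0$ that for a.e. $x$ is even and convex in $z$ with $\Upsilon(x,z)/|z|\to0$ as $z\to0$ and $\to\infty$ as $|z|\to\infty$; $\Upsilon^*(x,z)=\sup_y(z\cdot y-\Upsilon(x,y))$. It satisfies $\Delta_2$ if for some $c,K>0$,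 $\Upsilon(x,2z)\le c\,\Upsilon(x,z)$ for a.e. $x$ and all $|z|>K$. $L^\Upsilon$ is the linear hull of the set of $v\in L^1$ with $\int\Upsilon(x,v(x))<\infty$, normed by the Luxemburg norm, and $E^\Upsilon$ is the closure of $L^\infty$ in it. Weak$^*$ convergence in $L^{\Upsilon^*}$ means convergence of the integrals against every element of $E^{\Upsilon}$. Let $\Phi$ on $\Omega\times\mathbb R^{d\times N}$ and $\Psi$ on $\Gamma\times\mathbb R^N$ be $N$-functions such that $\Phi(\cdot,v),\Phi^*(\cdot,v)\in L^1(\Omega)$ and $\Psi(\cdot,z),\Psi^*(\cdot,z)\in L^1(\Gamma)$ for all fixed $v,z$. Let $\boldsymbol f:\Omega\times\mathbb R^{d\times N}\to\mathbb R^{d\times N}$ and $g:\Gamma\times\mathbb R^N\to\mathbb R^N$ be Carathéodory, monotone in the second variable, zero at zero, and such that for constants $C\ge0$, $\alpha_{\boldsymbol f},\alpha_g\in(0,1]$ and a.e. $x$, $$\boldsymbol f(x,v):v\ge\alpha_{\boldsymbol f}\big(\Phi^*(x,v)+\Phi(x,\boldsymbol f(x,v))\big)-C,\qquad g(x,z)\cdot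 z\ge\alpha_g\big(\Psi^*(x,z)+\Psi(x,g(x,z))\big)-C$$ for all $v$, $z$. For $q\in L^1(\Omega;\mathbb R^N)$, $\nabla q\in L^1$ denotes the weak gradient in $\Omega\setminus\Gamma$, and $[q]=\mathrm{tr}_{\Omega_2}q-\mathrm{tr}_{\Omega_1}q$ on $\Gamma$. Let $EP$ be the set of $q\in L^1(\Omega;\mathbb R^N)$ with $\nabla q\in E^\Phi(\Omega)$, $[q]\in E^\Psi(\Gamma)$ and $\mathrm{tr}_{\Omega_i}q=0$ on $\Gamma_D\cap\partial\Omega_i$, $i=1,2$. For $\boldsymbol\tau\in L^1(\Omega;\mathbb R^{d\times N})$, a function $w\in L^1(\Gamma;\mathbb R^N)$ is the normal trace $\boldsymbol\tau\cdot\boldsymbol n$ if $\int_\Gamma w\cdot\varphi=\int_{\Omega_1}\nabla\varphi:\boldsymbol\tau$ for all compactly supported Lipschitz $\varphi:\Omega\to\mathbb R^N$. Let $$X=\Big\{\boldsymbol\tau\in L^{\Phi^*}(\Omega):\ \boldsymbol\tau\cdot\boldsymbol n\in L^{\Psi^*}(\Gamma),\ \int_\Gamma(\boldsymbol\tau\cdot\boldsymbol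 n)\cdot[q]+\int_\Omega\nabla q:\boldsymbol\tau=0\ \ \forall q\in EP\Big\},$$ $EX=\{\boldsymbol\tau\in X:\boldsymbol\tau\in E^{\Phi^*}(\Omega),\ \boldsymbol\tau\cdot\boldsymbol n\in E^{\Psi^*}(\Gamma)\}$, and let $BX$ be the set of $\boldsymbol\tau\in X$ for which there are $\boldsymbol\tau^n\in EX$ with $\boldsymbol\tau^n\rightharpoonup^*\boldsymbol\tau$ in $L^{\Phi^*}(\Omega)$ and $\boldsymbol\tau^n\cdot\boldsymbol n\rightharpoonup^*\boldsymbol\tau\cdot\boldsymbol n$ in $L^{\Psi^*}(\Gamma)$. Data: $\phi_0\in W^{1,1}(\Omega;\mathbb R^N)$ with $\nabla\phi_0\in E^\Phi(\Omega)$, and $\boldsymbol j_0\in E^{\Phi^*}(\Omega)$ with $\operatorname{div}\boldsymbol j_0=0$ in $\Omega$ and $\boldsymbol j_0\cdot\boldsymbol n=0$ on $\Gamma$. Consider $$\int_\Omega\boldsymbol f(\boldsymbol j):\boldsymbol\tau+\int_\Gamma g(\boldsymbol j\cdot\boldsymbol n)\cdot(\boldsymbol\tau\cdot\boldsymbol n)=\int_\Omega\nabla\phi_0:\boldsymbol\tau,\tag{1}$$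 $$\int_\Omega(\boldsymbol f(\boldsymbol j)-\nabla\phi_0):(\boldsymbol j-\boldsymbol j_0-\boldsymbol\tau)+\int_\Gamma g(\boldsymbol j\cdot\boldsymbol n)\cdot((\boldsymbol j-\boldsymbol\tau)\cdot\boldsymbol n)\le0.\tag{2}$$ A *weak solution* is a $\boldsymbol j$ with $\boldsymbol j-\boldsymbol j_0\in X$, $\boldsymbol f(\boldsymbol j)\in L^\Phi(\Omega)$, $g(\boldsymbol j\cdot\boldsymbol n)\in L^\Psi(\Gamma)$ and (1) for all $\boldsymbol\tau\in EX$. A *variational weak solution* is a $\boldsymbol j$ with $\boldsymbol j-\boldsymbol j_0\in X$ such that for all $\boldsymbol\tau\in EX$ the integrals in (2) converge and (2) holds. $(\Delta)$: $\Phi$ and $\Psi$ both satisfy $\Delta_2$, or $\Phi^*$ and $\Psi^*$ both do. $(\Pi)^*$: for a.e. $x$, $\boldsymbol f(x,\cdot)$ and $g(x,\cdot)$ are the Fréchet derivatives of real functions $F_{\boldsymbol f}(x,\cdot)$ and $F_g(x,\cdot)$. **Theorem.** (i) If $(\Delta)$ holds, there is a weak solution $\boldsymbol j\in\boldsymbol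 j_0+BX$ such that (1) and (2) hold, with convergent integrals, for all $\boldsymbol\tau\in BX$. (ii) If $(\Pi)^*$ holds, there is a variational weak solution $\boldsymbol j\in\boldsymbol j_0+X$, and it is also a weak solution. (iii) If $(\Delta)$ holds and $\boldsymbol f$ is strictly monotone in the second variable (for a.e. $x$), then any two weak solutions in $\boldsymbol j_0+BX$ coincide a.e. in $\Omega$. -/

import Mathlib

open MeasureTheory Filter Topology Set
open scoped RealInnerProductSpace ENNReal NNReal ContDiff

noncomputable section

namespace FluxInterface

/-- Points of `ℝ^d`. -/
abbrev Pt (d : ℕ) := EuclideanSpace ℝ (Fin d)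

/-- `ℝ^N`, the values of the unknown potentials and of normal fluxes. -/
abbrev Vc (N : ℕ) := EuclideanSpace ℝ (Fin N)

/-- `ℝ^{d × N}` with the Frobenius scalar product; the entry `(k, i)` of a gradient is `∂_k q_i`. -/
abbrev Mt (d N : ℕ) := EuclideanSpace ℝ (Fin d × Fin N)

/-! ### Musielak-Orlicz spaces over a measure space -/

section Orlicz

variable {α : Type*} [MeasurableSpace α] {W W' : Type*}
  [NormedAddCommGroup W] [InnerProductSpace ℝ W]
  [NormedAddCommGroup W'] [InnerProductSpace ℝ W']

/-- Carathéodory: continuous in the second variable for a.e. `x`, measurable in `x`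
(with respect to the completed measure) for every value of the second variable. -/
structure IsCaratheodory (μ : Measure α) (h : α → W → W') : Prop where
  continuous : ∀ᵐ x ∂μ, Continuous (h x)
  measurable : ∀ z, AEStronglyMeasurable (fun x => h x z) μ

/-- `N`-functions depending on `x`. -/
structure IsNFunction (μ : Measure α) (Y : α → W → ℝ) : Prop where
  caratheodory : IsCaratheodory μ Y
  nonneg : ∀ᵐ x ∂μ, ∀ z, 0 ≤ Y x z
  even : ∀ᵐ x ∂μ, ∀ z, Y x (-z) = Y x z
  convex : ∀ᵐ x ∂μ, ConvexOn ℝ univ (Y x)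
  limit_zero : ∀ᵐ x ∂μ, Tendsto (fun z => Y x z / ‖z‖) (𝓝[≠] 0) (𝓝 0)
  limit_infty : ∀ᵐ x ∂μ, Tendsto (fun z => Y x z / ‖z‖) (Bornology.cobounded W) atTop

/-- The complementary function `Y*(x, z) = sup_y (z · y - Y(x, y))`. For an `N`-function the
supremum is finite for a.e. `x`. -/
def conj (Y : α → W → ℝ) (x : α) (z : W) : ℝ := ⨆ y : W, (⟪z, y⟫ - Y x y)

/-- The modular `∫ Y(x, v(x)) dμ`, with values in `[0, ∞]`. -/
def modular (μ : Measure α) (Y : α → W → ℝ) (v : α → W) : ℝ≥0∞ :=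
  ∫⁻ x, ENNReal.ofReal (Y x (v x)) ∂μ

/-- Constant (equivalently: bounded measurable) functions have finite modular. -/
def FiniteOnConstants (μ : Measure α) (Y : α → W → ℝ) : Prop :=
  ∀ z : W, modular μ Y (fun _ => z) < ⊤

/-- The `Δ₂` condition. -/
def DeltaTwo (μ : Measure α) (Y : α → W → ℝ) : Prop :=
  ∃ c K : ℝ, 0 < c ∧ 0 < K ∧
    ∀ᵐ x ∂μ, ∀ z : W, K < ‖z‖ → Y x ((2 : ℝ) • z) ≤ c * Y x z

/-- The set `M^Y` of integrable functions with finite modular. -/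
def MemM (μ : Measure α) (Y : α → W → ℝ) (v : α → W) : Prop :=
  Integrable v μ ∧ modular μ Y v < ⊤

/-- The space `L^Y`, the linear hull of `M^Y`. As `M^Y` is convex and symmetric,
its linear hull is the union of its positive multiples. -/
def MemL (μ : Measure α) (Y : α → W → ℝ) (v : α → W) : Prop :=
  ∃ l : ℝ, 0 < l ∧ MemM μ Y (fun x => l⁻¹ • v x)

/-- The Luxemburg norm. -/
def luxNorm (μ : Measure α) (Y : α → W → ℝ) (v : α → W) : ℝ :=
  sInf {l : ℝ | 0 < l ∧ modular μ Y (fun x => l⁻¹ • v x) ≤ 1}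

/-- The space `E^Y`, the closure of `L^∞` in `L^Y` for the Luxemburg norm. -/
def MemE (μ : Measure α) (Y : α → W → ℝ) (v : α → W) : Prop :=
  MemL μ Y v ∧ ∀ ε : ℝ, 0 < ε → ∃ u : α → W, MemLp u ⊤ μ ∧
    MemL μ Y (fun x => v x - u x) ∧ luxNorm μ Y (fun x => v x - u x) < ε

/-- Weak-star convergence in `L^{Y*} = (E^Y)*`. -/
def WeakStarTendsto (μ : Measure α) (Y : α → W → ℝ) (v : ℕ → α → W) (v' : α → W) : Prop :=
  ∀ u : α → W, MemE μ Y u →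
    Tendsto (fun n => ∫ x, ⟪v n x, u x⟫ ∂μ) atTop (𝓝 (∫ x, ⟪v' x, u x⟫ ∂μ))

/-- Monotone in the second variable and zero at zero. -/
def MonotoneZero (μ : Measure α) (h : α → W → W) : Prop :=
  (∀ᵐ x ∂μ, ∀ v₁ v₂ : W, 0 ≤ ⟪h x v₁ - h x v₂, v₁ - v₂⟫) ∧ ∀ᵐ x ∂μ, h x 0 = 0

/-- Strictly monotone in the second variable. -/
def StrictlyMonotone (μ : Measure α) (h : α → W → W) : Prop :=
  ∀ᵐ x ∂μ, ∀ v₁ v₂ : W, v₁ ≠ v₂ → 0 < ⟪h x v₁ - h x v₂, v₁ - v₂⟫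

/-- The growth condition `h(x,v) · v ≥ a (Y*(x,v) + Y(x,h(x,v))) - C`. -/
def Coercive (μ : Measure α) (Y : α → W → ℝ) (a C : ℝ) (h : α → W → W) : Prop :=
  ∀ᵐ x ∂μ, ∀ v : W, a * (conj Y x v + Y x (h x v)) - C ≤ ⟪h x v, v⟫

/-- `h(x,·)` is the Fréchet derivative of a potential `F(x,·)` for a.e. `x`. -/
def HasPotential [CompleteSpace W] (μ : Measure α) (h : α → W → W) : Prop :=
  ∃ F : α → W → ℝ, ∀ᵐ x ∂μ, ∀ v : W, HasGradientAt (F x) (h x v) v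

end Orlicz

/-! ### The domain -/

/-- Surface measure: the `(d-1)`-dimensional Hausdorff measure in its usual normalization (it agrees
with Lebesgue measure on flat pieces). -/
def surf (d : ℕ) : Measure (Pt d) := Measure.euclideanHausdorffMeasure (d - 1)

/-- `U` has Lipschitz boundary: near every boundary point, and for a suitable unit vector `ν`, the set
is the part lying strictly above the graph, in direction `ν`, of a Lipschitz function of the
component orthogonal to `ν`. -/
def HasLipschitzBoundary {d : ℕ} (U : Set (Pt d)) : Prop :=
  ∀ x ∈ frontier U, ∃ ν : Pt d, ‖ν‖ = 1 ∧ ∃ (K : ℝ≥0) (γ : Pt d → ℝ), LipschitzWith K γ ∧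
    ∃ V ∈ 𝓝 x, ∀ y ∈ V, (y ∈ U ↔ γ (y - ⟪ν, y⟫ • ν) < ⟪ν, y⟫)

/-- The sets that make up the geometric setting: the domain, its two parts, the interface, the
Neumann part and the two components of the Dirichlet part of the boundary. -/
structure Geometry (d : ℕ) where
  Om : Set (Pt d)
  Om₁ : Set (Pt d)
  Om₂ : Set (Pt d)
  Gam : Set (Pt d)
  GamN : Set (Pt d)
  GamD₁ : Set (Pt d)
  GamD₂ : Set (Pt d)

namespace Geometry

variable {d : ℕ} (D : Geometry d)

/-- The Dirichlet part of the boundary. -/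
def GamD : Set (Pt d) := D.GamD₁ ∪ D.GamD₂

/-- Lebesgue measure on the domain. -/
def vol : Measure (Pt d) := volume.restrict D.Om

/-- Surface measure on the interface. -/
def sur : Measure (Pt d) := (surf d).restrict D.Gam

/-- The assumptions on the domain, its boundary and the interface. -/
structure Admissible : Prop where
  isOpen : IsOpen D.Om
  bounded : Bornology.IsBounded D.Om
  connected : IsConnected D.Om
  lipschitz : HasLipschitzBoundary D.Om
  boundary_eq : frontier D.Om = closure D.GamN ∪ closure D.GamD
  disjoint_ND : Disjoint D.GamN D.GamD
  relOpen_N : ∃ O : Set (Pt d), IsOpen O ∧ D.GamN = O ∩ frontier D.Om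
  relOpen_D : ∃ O : Set (Pt d), IsOpen O ∧ D.GamD = O ∩ frontier D.Om
  connected_D₁ : IsConnected D.GamD₁
  connected_D₂ : IsConnected D.GamD₂
  separated₁ : Disjoint (closure D.GamD₁) D.GamD₂
  separated₂ : Disjoint D.GamD₁ (closure D.GamD₂)
  pos_D₁ : 0 < surf d D.GamD₁
  pos_D₂ : 0 < surf d D.GamD₂
  interface_connected : IsConnected D.Gam
  isOpen₁ : IsOpen D.Om₁
  isOpen₂ : IsOpen D.Om₂
  connected₁ : IsConnected D.Om₁
  connected₂ : IsConnected D.Om₂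
  disjoint₁₂ : Disjoint D.Om₁ D.Om₂
  bisected : D.Om \ D.Gam = D.Om₁ ∪ D.Om₂
  interface₁ : D.Gam = D.Om ∩ frontier D.Om₁
  interface₂ : D.Gam = D.Om ∩ frontier D.Om₂
  lipschitz₁ : HasLipschitzBoundary D.Om₁
  lipschitz₂ : HasLipschitzBoundary D.Om₂
  sub_D₁ : D.GamD₁ ⊆ frontier D.Om₁
  sub_D₂ : D.GamD₂ ⊆ frontier D.Om₂

end Geometry

/-! ### Weak gradients, traces and normal traces -/

/-- The classical gradient, entry `(k, i)` being `∂_k φ_i`. -/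
def grad {d N : ℕ} (φ : Pt d → Vc N) (x : Pt d) : Mt d N :=
  WithLp.toLp 2 fun p : Fin d × Fin N => fderiv ℝ φ x (EuclideanSpace.single p.1 1) p.2

/-- `G ∈ L¹` is the weak gradient of `q ∈ L¹` in the open set `U`. -/
def IsWeakGrad {d N : ℕ} (U : Set (Pt d)) (q : Pt d → Vc N) (G : Pt d → Mt d N) : Prop :=
  IntegrableOn q U ∧ IntegrableOn G U ∧
    ∀ (k : Fin d) (i : Fin N) (η : Pt d → ℝ), ContDiff ℝ ∞ η → HasCompactSupport η →
      tsupport η ⊆ U →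
        ∫ x in U, G x (k, i) * η x = - ∫ x in U, q x i * fderiv ℝ η x (EuclideanSpace.single k 1)

/-- `T` is the boundary trace of the `W^{1,1}(U)` function `q` with weak gradient `G`: the trace
operator is the continuous extension, from `W^{1,1}(U)` to `L¹(∂U)`, of the restriction to `∂U` of
functions smooth up to the boundary. -/
def IsTrace {d N : ℕ} (U : Set (Pt d)) (q : Pt d → Vc N) (G : Pt d → Mt d N)
    (T : Pt d → Vc N) : Prop :=
  IntegrableOn T (frontier U) (surf d) ∧
  ∃ φ : ℕ → Pt d → Vc N, (∀ n, ContDiff ℝ ∞ (φ n)) ∧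
    Tendsto (fun n => ∫⁻ x in U, ‖φ n x - q x‖ₑ) atTop (𝓝 0) ∧
    Tendsto (fun n => ∫⁻ x in U, ‖grad (φ n) x - G x‖ₑ) atTop (𝓝 0) ∧
    Tendsto (fun n => ∫⁻ x in frontier U, ‖φ n x - T x‖ₑ ∂(surf d)) atTop (𝓝 0)

section Spaces

variable {d N : ℕ} (D : Geometry d) (Φ : Pt d → Mt d N → ℝ) (Ψ : Pt d → Vc N → ℝ)

/-- `q` belongs to the space `P`, has gradient `G` in `Ω ∖ Γ` and jump `J` across `Γ`. -/
structure MemP (q : Pt d → Vc N) (G : Pt d → Mt d N) (J : Pt d → Vc N) : Prop where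
  integrable : Integrable q D.vol
  weakGrad : IsWeakGrad (D.Om \ D.Gam) q G
  memL : MemL D.vol Φ G
  memL_jump : MemL D.sur Ψ J
  traces : ∃ T₁ T₂ : Pt d → Vc N, IsTrace D.Om₁ q G T₁ ∧ IsTrace D.Om₂ q G T₂ ∧
    (∀ᵐ x ∂D.sur, J x = T₂ x - T₁ x) ∧
    (∀ᵐ x ∂(surf d).restrict (D.GamD ∩ frontier D.Om₁), T₁ x = 0) ∧
    (∀ᵐ x ∂(surf d).restrict (D.GamD ∩ frontier D.Om₂), T₂ x = 0)

/-- `q` belongs to the space `EP`, has gradient `G` in `Ω ∖ Γ` and jump `J` across `Γ`. -/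
structure MemEP (q : Pt d → Vc N) (G : Pt d → Mt d N) (J : Pt d → Vc N) : Prop where
  memP : MemP D Φ Ψ q G J
  memE : MemE D.vol Φ G
  memE_jump : MemE D.sur Ψ J

/-- `t = τ · n` on `Γ`, the normal `n` pointing out of `Ω₁`:
`∫_Γ t · φ = ∫_{Ω₁} ∇φ : τ` for all compactly supported Lipschitz `φ` in `Ω`. -/
def IsNormalTrace (τ : Pt d → Mt d N) (t : Pt d → Vc N) : Prop :=
  Integrable t D.sur ∧
  ∀ φ : Pt d → Vc N, (∃ K : ℝ≥0, LipschitzWith K φ) → HasCompactSupport φ → tsupport φ ⊆ D.Om →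
    ∫ x, ⟪t x, φ x⟫ ∂D.sur = ∫ x in D.Om₁, ⟪grad φ x, τ x⟫

/-- `τ` belongs to the space `X` and `t` is its normal trace on `Γ`. -/
structure MemX (τ : Pt d → Mt d N) (t : Pt d → Vc N) : Prop where
  memL : MemL D.vol (conj Φ) τ
  normalTrace : IsNormalTrace D τ t
  memL_trace : MemL D.sur (conj Ψ) t
  orthogonal : ∀ q G J, MemEP D Φ Ψ q G J →
    ∫ x, ⟪t x, J x⟫ ∂D.sur + ∫ x, ⟪G x, τ x⟫ ∂D.vol = 0

/-- `τ` belongs to the space `EX` and `t` is its normal trace on `Γ`. -/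
structure MemEX (τ : Pt d → Mt d N) (t : Pt d → Vc N) : Prop where
  memX : MemX D Φ Ψ τ t
  memE : MemE D.vol (conj Φ) τ
  memE_trace : MemE D.sur (conj Ψ) t

/-- `τ` belongs to the space `BX` (weak-star limits of sequences in `EX`)
and `t` is its normal trace on `Γ`. -/
structure MemBX (τ : Pt d → Mt d N) (t : Pt d → Vc N) : Prop where
  memX : MemX D Φ Ψ τ t
  approx : ∃ (τs : ℕ → Pt d → Mt d N) (ts : ℕ → Pt d → Vc N),
    (∀ n, MemEX D Φ Ψ (τs n) (ts n)) ∧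
    WeakStarTendsto D.vol Φ τs τ ∧ WeakStarTendsto D.sur Ψ ts t

/-- The Dirichlet datum: `φ₀ ∈ W^{1,1}(Ω)` with weak gradient `G₀ ∈ E^Φ(Ω)`. -/
structure DirichletDatum (φ₀ : Pt d → Vc N) (G₀ : Pt d → Mt d N) : Prop where
  weakGrad : IsWeakGrad D.Om φ₀ G₀
  memE : MemE D.vol Φ G₀

/-- The flux datum: `j₀ ∈ E^{Φ*}(Ω)`, `div j₀ = 0` in `Ω` and `j₀ · n = 0` on `Γ`. -/
structure FluxDatum (j₀ : Pt d → Mt d N) : Prop where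
  memE : MemE D.vol (conj Φ) j₀
  div_zero : ∀ φ : Pt d → Vc N, ContDiff ℝ ∞ φ → HasCompactSupport φ → tsupport φ ⊆ D.Om →
    ∫ x, ⟪grad φ x, j₀ x⟫ ∂D.vol = 0
  normal_zero : IsNormalTrace D j₀ 0

variable (f : Pt d → Mt d N → Mt d N) (g : Pt d → Vc N → Vc N)
  (G₀ : Pt d → Mt d N) (j₀ : Pt d → Mt d N)

/-- The weak identity
`∫_Ω f(j) : τ + ∫_Γ g(j · n) · (τ · n) = ∫_Ω ∇φ₀ : τ`, where `w = j · n` and `t = τ · n`,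
all three integrals being convergent. -/
def WeakIdentity (j : Pt d → Mt d N) (w : Pt d → Vc N)
    (τ : Pt d → Mt d N) (t : Pt d → Vc N) : Prop :=
  Integrable (fun x => ⟪f x (j x), τ x⟫) D.vol ∧
  Integrable (fun x => ⟪g x (w x), t x⟫) D.sur ∧
  Integrable (fun x => ⟪G₀ x, τ x⟫) D.vol ∧
  ∫ x, ⟪f x (j x), τ x⟫ ∂D.vol + ∫ x, ⟪g x (w x), t x⟫ ∂D.sur = ∫ x, ⟪G₀ x, τ x⟫ ∂D.vol

/-- The variational inequality
`∫_Ω (f(j) - ∇φ₀) : (j - j₀ - τ) + ∫_Γ g(j · n) · ((j - τ) · n) ≤ 0`,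
where `w = j · n` and `t = τ · n`, both integrals being convergent. -/
def VariationalInequality (j : Pt d → Mt d N) (w : Pt d → Vc N)
    (τ : Pt d → Mt d N) (t : Pt d → Vc N) : Prop :=
  Integrable (fun x => ⟪f x (j x) - G₀ x, j x - j₀ x - τ x⟫) D.vol ∧
  Integrable (fun x => ⟪g x (w x), w x - t x⟫) D.sur ∧
  ∫ x, ⟪f x (j x) - G₀ x, j x - j₀ x - τ x⟫ ∂D.vol + ∫ x, ⟪g x (w x), w x - t x⟫ ∂D.sur ≤ 0

/-- `j` is a weak solution of the flux formulation, with `w = j · n` on `Γ`. -/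
structure IsWeakSolution (j : Pt d → Mt d N) (w : Pt d → Vc N) : Prop where
  normalTrace : IsNormalTrace D j w
  memX : MemX D Φ Ψ (fun x => j x - j₀ x) w
  memL_f : MemL D.vol Φ (fun x => f x (j x))
  memL_g : MemL D.sur Ψ (fun x => g x (w x))
  identity : ∀ τ t, MemEX D Φ Ψ τ t → WeakIdentity D f g G₀ j w τ t

/-- `j` is a variational weak solution of the flux formulation, with `w = j · n` on `Γ`. -/
structure IsVariationalWeakSolution (j : Pt d → Mt d N) (w : Pt d → Vc N) : Prop where
  normalTrace : IsNormalTrace D j w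
  memX : MemX D Φ Ψ (fun x => j x - j₀ x) w
  inequality : ∀ τ t, MemEX D Φ Ψ τ t → VariationalInequality D f g G₀ j₀ j w τ t

end Spaces

end FluxInterface

end

/-!
Let `X` be the space of pairs `(τ, t)` of a flux and its normal trace on the interface. The geometry
enters only in two ways. The two measures, volume on `Ω` and surface measure on `Γ`, are finite; for
the latter, the boundary of a bounded Lipschitz set is covered by finitely many Lipschitz images of
bounded sets of dimension `d - 1`. And `X` is the annihilator, in `L^{Φ*} × L^{Ψ*}`, of a set of pairs in
`E^Φ × E^Ψ` (`fluxSpace`): the pairs `(∇q, [q])` with `q ∈ EP`, and the pairs `(1_{Ω₁} ∇φ, -φ)` that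
express that `t` is the normal trace of `τ`. So `X` is weakly-star closed, and everything else takes
place over two abstract finite measure spaces with complementary pairs of Young functions
(`DualPair`).

Sets of bounded modular in `L^{Φ*}` are weakly-star relatively compact
(`DualPair.exists_weakStarLim`): along an ultrafilter the integrals over measurable sets converge to
a signed measure, countably additive and absolutely continuous by Young's inequality, and the modular
is lower semicontinuous. As `E^Φ` is separable for convergence in modular, limits along ultrafilters
are limits of sequences (`exists_seq_weakStarTendsto`).

*Existence under the `Δ₂` assumption.* The monotone operator `j ↦ (f(j) - ∇φ₀, g(j · n))` on `EX` has
approximate zeros on every finite-dimensional subspace, by a minimax argument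
(`exists_zero_of_monotone`, `exists_approx_zero`). The growth condition bounds these Galerkin
solutions and their images, and weak-star limits `j`, `w = j · n`, `χ`, `γ` of the fluxes, traces and
images satisfy `∫ (χ - ∇φ₀) : τ + ∫ γ · (τ · n) = 0` for `τ ∈ EX` (`exists_monotone_limit`). If
`Φ, Ψ` satisfy `Δ₂`, then `χ` and `γ` are in `E^Φ` and `E^Ψ` and the identity passes to `BX` by
weak-star convergence; if `Φ*, Ψ*` do, then `EX = BX = X`. In both cases `j - j₀` is an admissible test
function, and Minty's trick identifies `χ = f(j)`, `γ = g(w)` (`IsFlux.eq_comp_of_minty`). In that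
trick the comparison functions are `j` cut off where `j` or `f(j)` is large (`goodTrunc`), and
constants `z` on sets where `j`, `f(j)` and `f(·, z)` are bounded, so that they and their images
under `f` are all bounded.

*Potentials.* The convex energy `∫ F_f(j) + ∫ F_g(w) - ∫ ∇φ₀ : (j - j₀)` is minimized over `j₀ + X`
(`exists_minimizer`): compare with the same cut-off functions for its weak-star lower semicontinuity.
Difference quotients of convex functions along segments towards `j₀ + τ`, `τ ∈ EX`, decrease to the
derivative, which gives the variational inequality with integrable terms; with `τ = 0` and the growth
condition this yields `f(j) ∈ L^Φ` and `g(w) ∈ L^Ψ`. As `EX` is linear, the inequality is then the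
weak identity.

*Uniqueness.* The difference of two weak solutions in `j₀ + BX` is itself a test function in `BX`, and
`f` is strictly monotone.
-/

noncomputable section

namespace FluxInterface

set_option linter.unusedSectionVars false

/-! ### Even convex functions -/

section Convex

variable {W : Type*} [NormedAddCommGroup W] [InnerProductSpace ℝ W] {φ : W → ℝ}

lemma even_convex_smul_le (hc : ConvexOn ℝ univ φ) (h0 : φ 0 = 0) (he : ∀ z, φ (-z) = φ z)
    {t : ℝ} (ht : |t| ≤ 1) (z : W) : φ (t • z) ≤ |t| * φ z := by
  have key : ∀ s : ℝ, 0 ≤ s → s ≤ 1 → φ (s • z) ≤ s * φ z := by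
    intro s hs hs1
    have := hc.2 (mem_univ z) (mem_univ 0) hs (sub_nonneg.2 hs1) (by ring)
    simpa [h0] using this
  rcases le_total 0 t with h | h
  · rw [abs_of_nonneg h] at ht ⊢
    exact key t h ht
  · rw [abs_of_nonpos h] at ht ⊢
    have := key (-t) (by linarith) ht
    rwa [neg_smul, he] at this

lemma even_convex_smul_mono (hc : ConvexOn ℝ univ φ) (h0 : φ 0 = 0) (he : ∀ z, φ (-z) = φ z)
    (hn : ∀ z, 0 ≤ φ z) {s t : ℝ} (hst : |s| ≤ |t|) (z : W) : φ (s • z) ≤ φ (t • z) := by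
  rcases eq_or_ne t 0 with rfl | ht
  · have : s = 0 := by simpa using hst
    simp [this]
  · have h1 : |s / t| ≤ 1 := by
      rw [abs_div]; exact div_le_one_of_le₀ hst (abs_nonneg t)
    have h2 := even_convex_smul_le hc h0 he h1 (t • z)
    rw [smul_smul, div_mul_cancel₀ _ ht] at h2
    nlinarith [hn (t • z)]

lemma convex_add_le (hc : ConvexOn ℝ univ φ) (a b : W) :
    φ (a + b) ≤ (1 / 2) * φ ((2 : ℝ) • a) + (1 / 2) * φ ((2 : ℝ) • b) := by
  have := hc.2 (mem_univ ((2 : ℝ) • a)) (mem_univ ((2 : ℝ) • b))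
    (by norm_num : (0 : ℝ) ≤ 1 / 2) (by norm_num : (0 : ℝ) ≤ 1 / 2) (by norm_num)
  simpa [smul_smul] using this

lemma convex_sum_le (hc : ConvexOn ℝ univ φ) (hn : ∀ z, 0 ≤ φ z) {ι : Type*} (s : Finset ι)
    (y : ι → W) (hs : s.Nonempty) :
    φ (∑ k ∈ s, y k) ≤ ∑ k ∈ s, φ ((s.card : ℝ) • y k) := by
  have hc0 : (0 : ℝ) < s.card := by exact_mod_cast hs.card_pos
  have hc1 : (1 : ℝ) ≤ s.card := by exact_mod_cast hs.card_pos
  have := hc.map_sum_le (t := s) (w := fun _ => (s.card : ℝ)⁻¹)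
    (p := fun k => (s.card : ℝ) • y k) (fun _ _ => by positivity) (by simp [hc0.ne'])
    (fun _ _ => mem_univ _)
  simp only [smul_smul, inv_mul_cancel₀ hc0.ne', one_smul, smul_eq_mul] at this
  refine this.trans (Finset.sum_le_sum fun k _ => ?_)
  have : (s.card : ℝ)⁻¹ ≤ 1 := inv_le_one_of_one_le₀ hc1
  nlinarith [hn ((s.card : ℝ) • y k)]

/-- On a ball an even convex function is dominated by its values at finitely many points. -/
lemma even_convex_le_sum_basis [FiniteDimensional ℝ W] (hc : ConvexOn ℝ univ φ) (h0 : φ 0 = 0)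
    (he : ∀ z, φ (-z) = φ z) (hn : ∀ z, 0 ≤ φ z) {R : ℝ} {z : W} (hz : ‖z‖ ≤ R) :
    φ z ≤ ∑ k, φ ((Module.finrank ℝ W * R) • stdOrthonormalBasis ℝ W k) := by
  set b := stdOrthonormalBasis ℝ W
  rcases isEmpty_or_nonempty (Fin (Module.finrank ℝ W)) with h | h
  · have : z = 0 := by rw [← b.sum_repr z]; simp
    simp [this, h0]
  · have h1 := convex_sum_le hc hn Finset.univ (fun k => b.repr z k • b k) Finset.univ_nonempty
    rw [b.sum_repr] at h1
    refine h1.trans (Finset.sum_le_sum fun k _ => ?_)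
    rw [smul_smul, Finset.card_univ, Fintype.card_fin]
    refine even_convex_smul_mono hc h0 he hn ?_ _
    rw [abs_mul, abs_mul]
    refine mul_le_mul_of_nonneg_left ?_ (abs_nonneg _)
    have h2 : ‖b.repr z k‖ ≤ ‖b.repr z‖ := PiLp.norm_apply_le _ _
    rw [b.repr.norm_map] at h2
    exact h2.trans (hz.trans (le_abs_self R))

end Convex

/-! ### Carathéodory functions -/

section Orlicz

variable {α : Type*} [MeasurableSpace α] {W W' : Type*}
  [NormedAddCommGroup W] [InnerProductSpace ℝ W]
  [NormedAddCommGroup W'] [InnerProductSpace ℝ W'] {μ : Measure α}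

/-- Superposition with a Carathéodory function preserves measurability. -/
lemma IsCaratheodory.comp {h : α → W → W'} (hh : IsCaratheodory μ h) {v : α → W}
    (hv : AEStronglyMeasurable v μ) : AEStronglyMeasurable (fun x => h x (v x)) μ := by
  obtain ⟨w, hw, hvw⟩ := hv
  have hn : ∀ n, AEStronglyMeasurable (fun x => h x (hw.approx n x)) μ := by
    intro n
    set s := hw.approx n
    have : (fun x => h x (s x)) =
        fun x => ∑ c ∈ s.range, (s ⁻¹' {c}).indicator (fun x => h x c) x := by
      funext x
      rw [Finset.sum_eq_single (s x)]
      · simp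
      · intro c _ hc
        simp [indicator, hc.symm]
      · intro hx
        exact absurd (s.mem_range_self x) hx
    rw [this]
    refine Finset.aestronglyMeasurable_fun_sum _ fun c _ => ?_
    exact (hh.measurable c).indicator (s.measurableSet_fiber c)
  refine aestronglyMeasurable_of_tendsto_ae atTop hn ?_
  filter_upwards [hvw, hh.continuous] with x hx hc
  rw [hx]
  exact (hc.tendsto _).comp (hw.tendsto_approx x)

/-! ### Modulars, `L^Y` and `E^Y` -/

/-- The properties of an `N`-function, together with integrability on constants, that the
theory of the spaces `L^Y` and `E^Y` uses. -/
structure IsYoungFn (μ : Measure α) (Y : α → W → ℝ) : Prop where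
  car : IsCaratheodory μ Y
  nonneg : ∀ᵐ x ∂μ, ∀ z, 0 ≤ Y x z
  zero : ∀ᵐ x ∂μ, Y x 0 = 0
  even : ∀ᵐ x ∂μ, ∀ z, Y x (-z) = Y x z
  convex : ∀ᵐ x ∂μ, ConvexOn ℝ univ (Y x)
  fin : FiniteOnConstants μ Y

lemma exists_ae_norm_le {u : α → W} (hu : MemLp u ⊤ μ) : ∃ R : ℝ, ∀ᵐ x ∂μ, ‖u x‖ ≤ R := by
  refine ⟨(eLpNorm u ⊤ μ).toReal, ?_⟩
  filter_upwards [ae_le_eLpNormEssSup (f := u) (μ := μ)] with x hx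
  rw [eLpNorm_exponent_top, ← toReal_enorm]
  exact ENNReal.toReal_mono (by simpa using hu.2.ne) hx

/-- The truncation of `v` at height `k`: `v` where `‖v‖ ≤ k`, and zero elsewhere. -/
def trunc (k : ℕ) (v : α → W) : α → W := {x | ‖v x‖ ≤ k}.indicator v

lemma aestronglyMeasurable_trunc {v : α → W} (hv : AEStronglyMeasurable v μ) (k : ℕ) :
    AEStronglyMeasurable (trunc k v) μ :=
  hv.indicator₀ (nullMeasurableSet_le hv.norm.aemeasurable aemeasurable_const)

lemma trunc_of_le {k : ℕ} {v : α → W} {x : α} (hx : ‖v x‖ ≤ k) : trunc k v x = v x := by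
  simp [trunc, hx]

lemma norm_trunc_le (k : ℕ) (v : α → W) (x : α) : ‖trunc k v x‖ ≤ k := by
  by_cases hx : ‖v x‖ ≤ k <;> simp [trunc, hx]

lemma sub_trunc_eq (k : ℕ) (v : α → W) (x : α) :
    v x - trunc k v x = 0 ∨ v x - trunc k v x = v x := by
  by_cases hx : ‖v x‖ ≤ k <;> simp [trunc, hx]

lemma norm_sub_trunc_le (k : ℕ) (v : α → W) (x : α) : ‖v x - trunc k v x‖ ≤ ‖v x‖ := by
  rcases sub_trunc_eq k v x with h | h <;> simp [h]

namespace IsYoungFn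

variable {Y : α → W → ℝ}

lemma integrable_iff (hY : IsYoungFn μ Y) {v : α → W} (hv : AEStronglyMeasurable v μ) :
    Integrable (fun x => Y x (v x)) μ ↔ modular μ Y v < ⊤ := by
  have hm := hY.car.comp hv
  have h0 : 0 ≤ᵐ[μ] fun x => Y x (v x) := by
    filter_upwards [hY.nonneg] with x hx using hx _
  rw [Integrable, hasFiniteIntegral_iff_ofReal h0]
  exact ⟨fun h => h.2, fun h => ⟨hm, h⟩⟩

lemma modular_eq (hY : IsYoungFn μ Y) {v : α → W} (hi : Integrable (fun x => Y x (v x)) μ) :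
    modular μ Y v = ENNReal.ofReal (∫ x, Y x (v x) ∂μ) := by
  rw [ofReal_integral_eq_lintegral_ofReal hi]
  · rfl
  · filter_upwards [hY.nonneg] with x hx using hx _

lemma integrable_const (hY : IsYoungFn μ Y) (z : W) : Integrable (fun x => Y x z) μ :=
  (hY.integrable_iff (v := fun _ => z) aestronglyMeasurable_const).2 (hY.fin z)

lemma integral_nonneg (hY : IsYoungFn μ Y) (v : α → W) : 0 ≤ ∫ x, Y x (v x) ∂μ :=
  integral_nonneg_of_ae (by filter_upwards [hY.nonneg] with x hx using hx _)

/-- Domination of the values of `Y` by an integrable function. -/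
lemma integrable_of_le (hY : IsYoungFn μ Y) {v : α → W} (hv : AEStronglyMeasurable v μ)
    {b : α → ℝ} (hb : Integrable b μ) (h : ∀ᵐ x ∂μ, Y x (v x) ≤ b x) :
    Integrable (fun x => Y x (v x)) μ := by
  refine hb.mono' (hY.car.comp hv) ?_
  filter_upwards [h, hY.nonneg] with x hx h0
  rwa [Real.norm_of_nonneg (h0 _)]

lemma ae_smul_le (hY : IsYoungFn μ Y) :
    ∀ᵐ x ∂μ, ∀ t : ℝ, |t| ≤ 1 → ∀ z, Y x (t • z) ≤ |t| * Y x z := by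
  filter_upwards [hY.convex, hY.zero, hY.even] with x h1 h2 h3 t ht z
  exact even_convex_smul_le h1 h2 h3 ht z

lemma ae_smul_mono (hY : IsYoungFn μ Y) :
    ∀ᵐ x ∂μ, ∀ s t : ℝ, |s| ≤ |t| → ∀ z, Y x (s • z) ≤ Y x (t • z) := by
  filter_upwards [hY.convex, hY.zero, hY.even, hY.nonneg] with x h1 h2 h3 h4 s t hst z
  exact even_convex_smul_mono h1 h2 h3 h4 hst z

lemma ae_add_le (hY : IsYoungFn μ Y) :
    ∀ᵐ x ∂μ, ∀ a b, Y x (a + b) ≤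
      (1 / 2) * Y x ((2 : ℝ) • a) + (1 / 2) * Y x ((2 : ℝ) • b) := by
  filter_upwards [hY.convex] with x h a b using convex_add_le h a b

lemma integrable_smul_mono (hY : IsYoungFn μ Y) {v : α → W} (hv : AEStronglyMeasurable v μ)
    {s t : ℝ} (hst : |s| ≤ |t|) (h : Integrable (fun x => Y x (t • v x)) μ) :
    Integrable (fun x => Y x (s • v x)) μ := by
  refine hY.integrable_of_le (hv.const_smul s) h ?_
  filter_upwards [hY.ae_smul_mono] with x hx using hx _ _ hst _

lemma integrable_add (hY : IsYoungFn μ Y) {u v : α → W}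
    (hu : AEStronglyMeasurable u μ) (hv : AEStronglyMeasurable v μ)
    (h1 : Integrable (fun x => Y x ((2 : ℝ) • u x)) μ)
    (h2 : Integrable (fun x => Y x ((2 : ℝ) • v x)) μ) :
    Integrable (fun x => Y x (u x + v x)) μ := by
  refine hY.integrable_of_le (hu.add hv) ((h1.const_mul (1 / 2)).add (h2.const_mul (1 / 2))) ?_
  filter_upwards [hY.ae_add_le] with x hx using hx _ _

/-- The values of `Y` on a ball have an integrable common bound. -/
lemma exists_bound [FiniteDimensional ℝ W] (hY : IsYoungFn μ Y) (R : ℝ) :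
    ∃ b : α → ℝ, Integrable b μ ∧ ∀ᵐ x ∂μ, ∀ z, ‖z‖ ≤ R → Y x z ≤ b x := by
  refine ⟨fun x => ∑ k, Y x ((Module.finrank ℝ W * R) • stdOrthonormalBasis ℝ W k),
    integrable_finsetSum _ fun k _ => hY.integrable_const _, ?_⟩
  filter_upwards [hY.convex, hY.zero, hY.even, hY.nonneg] with x h1 h2 h3 h4 z hz
  exact even_convex_le_sum_basis h1 h2 h3 h4 hz

lemma memL_iff (hY : IsYoungFn μ Y) {v : α → W} :
    MemL μ Y v ↔ Integrable v μ ∧ ∃ l : ℝ, 0 < l ∧ Integrable (fun x => Y x (l • v x)) μ := by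
  constructor
  · rintro ⟨l, hl, h1, h2⟩
    have hv : Integrable v μ := by
      have := h1.smul l
      simpa [smul_smul, hl.ne', Pi.smul_def] using this
    exact ⟨hv, l⁻¹, inv_pos.2 hl,
      (hY.integrable_iff (hv.1.const_smul l⁻¹)).2 h2⟩
  · rintro ⟨hv, l, hl, h⟩
    refine ⟨l⁻¹, inv_pos.2 hl, ?_, ?_⟩
    · rw [inv_inv]; exact hv.smul l
    · rw [inv_inv]; exact (hY.integrable_iff (hv.1.const_smul l)).1 h

lemma memL_of_integrable (hY : IsYoungFn μ Y) {v : α → W} (hv : Integrable v μ)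
    (h : Integrable (fun x => Y x (v x)) μ) : MemL μ Y v :=
  hY.memL_iff.2 ⟨hv, 1, one_pos, by simpa using h⟩

lemma ae_sub_trunc_le (hY : IsYoungFn μ Y) (v : α → W) :
    ∀ᵐ x ∂μ, ∀ (k : ℕ) (l : ℝ), Y x (l • (v x - trunc k v x)) ≤ Y x (l • v x) := by
  filter_upwards [hY.zero, hY.nonneg] with x h1 h2 k l
  rcases sub_trunc_eq k v x with h | h <;> simp [h, h1, h2]

lemma integrable_sub_trunc (hY : IsYoungFn μ Y) {v : α → W} (hv : AEStronglyMeasurable v μ)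
    (k : ℕ) {l : ℝ} (h : Integrable (fun x => Y x (l • v x)) μ) :
    Integrable (fun x => Y x (l • (v x - trunc k v x))) μ := by
  refine hY.integrable_of_le ((hv.sub (aestronglyMeasurable_trunc hv k)).const_smul l) h ?_
  filter_upwards [hY.ae_sub_trunc_le v] with x hx using hx k l

lemma tendsto_trunc (hY : IsYoungFn μ Y) {v : α → W} (hv : AEStronglyMeasurable v μ) {l : ℝ}
    (h : Integrable (fun x => Y x (l • v x)) μ) :
    Tendsto (fun k => ∫ x, Y x (l • (v x - trunc k v x)) ∂μ) atTop (𝓝 0) := by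
  have := tendsto_integral_of_dominated_convergence (μ := μ)
    (F := fun (k : ℕ) x => Y x (l • (v x - trunc k v x))) (f := fun _ => (0 : ℝ))
    (fun x => Y x (l • v x)) (fun k => (hY.integrable_sub_trunc hv k h).1) h ?_ ?_
  · simpa using this
  · intro k
    filter_upwards [hY.ae_sub_trunc_le v, hY.nonneg] with x h1 h2
    rw [Real.norm_of_nonneg (h2 _)]
    exact h1 _ _
  · filter_upwards [hY.zero] with x hx
    refine Tendsto.congr' ?_ tendsto_const_nhds
    obtain ⟨K, hK⟩ := exists_nat_ge ‖v x‖
    filter_upwards [eventually_ge_atTop K] with k hk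
    have : ‖v x‖ ≤ k := hK.trans (by exact_mod_cast hk)
    simp [trunc_of_le this, hx]

/-- A function belongs to `E^Y` if and only if all its multiples have finite modular. -/
lemma memE_iff [FiniteDimensional ℝ W] [IsFiniteMeasure μ] (hY : IsYoungFn μ Y) {v : α → W} :
    MemE μ Y v ↔ Integrable v μ ∧ ∀ l : ℝ, Integrable (fun x => Y x (l • v x)) μ := by
  constructor
  · rintro ⟨hL, hE⟩
    obtain ⟨hv, -⟩ := hY.memL_iff.1 hL
    refine ⟨hv, fun l => ?_⟩
    obtain ⟨u, hu, hvu, hlt⟩ := hE (1 / (2 * |l| + 1)) (by positivity)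
    obtain ⟨hvu1, m, hm, hvu2⟩ := hY.memL_iff.1 hvu
    -- the Luxemburg norm is an infimum over a nonempty set, so that it is not a junk value
    have hne : {r : ℝ | 0 < r ∧ modular μ Y (fun x => r⁻¹ • (v x - u x)) ≤ 1}.Nonempty := by
      set I := ∫ x, Y x (m • (v x - u x)) ∂μ
      have hI : 0 ≤ I := hY.integral_nonneg _
      refine ⟨(I + 1) / m, by positivity, ?_⟩
      have hi : Integrable (fun x => Y x (((I + 1) / m)⁻¹ • (v x - u x))) μ := by
        refine hY.integrable_smul_mono hvu1.1 ?_ hvu2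
        rw [inv_div, abs_div, abs_of_pos (by positivity : 0 < I + 1)]
        exact div_le_self (abs_nonneg _) (by linarith)
      rw [hY.modular_eq hi]
      refine ENNReal.ofReal_le_one.2 ?_
      calc ∫ x, Y x (((I + 1) / m)⁻¹ • (v x - u x)) ∂μ
          ≤ ∫ x, (I + 1)⁻¹ * Y x (m • (v x - u x)) ∂μ := by
            refine integral_mono_ae hi (hvu2.const_mul _) ?_
            filter_upwards [hY.ae_smul_le] with x hx
            have h1 : |(I + 1)⁻¹| ≤ 1 := by
              rw [abs_of_pos (by positivity)]
              exact inv_le_one_of_one_le₀ (by linarith)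
            have := hx (I + 1)⁻¹ h1 (m • (v x - u x))
            rw [smul_smul, abs_of_pos (by positivity)] at this
            rwa [inv_div, div_eq_inv_mul]
        _ = (I + 1)⁻¹ * I := by rw [integral_const_mul]
        _ ≤ 1 := by rw [inv_mul_le_one₀ (by positivity)]; linarith
    obtain ⟨r, ⟨hr0, hr1⟩, hr2⟩ := exists_lt_of_csInf_lt hne hlt
    have hi1 : Integrable (fun x => Y x ((2 : ℝ) • l • (v x - u x))) μ := by
      have h1 : Integrable (fun x => Y x (r⁻¹ • (v x - u x))) μ :=
        (hY.integrable_iff (hvu1.1.const_smul _)).2 (hr1.trans_lt ENNReal.one_lt_top)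
      have := hY.integrable_smul_mono (s := 2 * l) hvu1.1 ?_ h1
      · simpa [smul_smul] using this
      · rw [abs_mul, abs_two, abs_of_pos (inv_pos.2 hr0)]
        rw [lt_div_iff₀ (by positivity)] at hr2
        rw [← mul_le_mul_iff_of_pos_left hr0, mul_inv_cancel₀ hr0.ne']
        nlinarith
    obtain ⟨R, hR⟩ : ∃ R : ℝ, ∀ᵐ x ∂μ, ‖u x‖ ≤ R :=
      exists_ae_norm_le hu
    obtain ⟨b, hb, hbY⟩ := hY.exists_bound (2 * |l| * R)
    have hi2 : Integrable (fun x => Y x ((2 : ℝ) • l • u x)) μ := by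
      refine hY.integrable_of_le ((hu.1.const_smul l).const_smul (2 : ℝ)) hb ?_
      filter_upwards [hR, hbY] with x h1 h2
      refine h2 _ ?_
      rw [norm_smul, norm_smul, Real.norm_eq_abs, Real.norm_eq_abs, abs_two, ← mul_assoc]
      gcongr
    have := hY.integrable_add (hvu1.1.const_smul l) (hu.1.const_smul l) hi1 hi2
    simpa [← smul_add] using this
  · rintro ⟨hv, h⟩
    have hvm := hv.1
    refine ⟨hY.memL_of_integrable hv (by simpa using h 1), fun ε hε => ?_⟩
    have hYi := fun k l => hY.integrable_sub_trunc hvm k (h l)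
    obtain ⟨k, hk⟩ :=
      ((hY.tendsto_trunc hvm (h (ε / 2)⁻¹)).eventually (gt_mem_nhds one_pos)).exists
    have hum := aestronglyMeasurable_trunc hvm k
    refine ⟨trunc k v, ?_, ?_, ?_⟩
    · exact memLp_top_of_bound hum k (ae_of_all _ fun x => norm_trunc_le k v x)
    · refine hY.memL_of_integrable
        (hv.mono (hvm.sub hum) (ae_of_all _ (norm_sub_trunc_le k v))) ?_
      simpa using hYi k 1
    · have hbdd : BddBelow {r : ℝ | 0 < r ∧ modular μ Y (fun x => r⁻¹ • (v x - trunc k v x)) ≤ 1} :=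
        ⟨0, fun r hr => hr.1.le⟩
      refine (csInf_le hbdd ⟨half_pos hε, ?_⟩).trans_lt (half_lt_self hε)
      rw [hY.modular_eq (hYi k _)]
      exact ENNReal.ofReal_le_one.2 hk.le

section Closure

variable {u v : α → W}

lemma memL_smul (hY : IsYoungFn μ Y) (hv : MemL μ Y v) (c : ℝ) :
    MemL μ Y (fun x => c • v x) := by
  obtain ⟨h1, l, hl, h2⟩ := hY.memL_iff.1 hv
  refine hY.memL_iff.2 ⟨h1.smul c, l / (|c| + 1), by positivity, ?_⟩
  simp only [smul_smul]
  refine hY.integrable_smul_mono h1.1 ?_ h2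
  rw [abs_mul, abs_div, abs_of_pos (by positivity : 0 < |c| + 1), div_mul_eq_mul_div]
  refine div_le_of_le_mul₀ (by positivity) (abs_nonneg _) ?_
  nlinarith [abs_nonneg l]

lemma memL_add (hY : IsYoungFn μ Y) (hu : MemL μ Y u) (hv : MemL μ Y v) :
    MemL μ Y (fun x => u x + v x) := by
  obtain ⟨h1, l, hl, h2⟩ := hY.memL_iff.1 hu
  obtain ⟨h3, m, hm, h4⟩ := hY.memL_iff.1 hv
  refine hY.memL_iff.2 ⟨h1.add h3, min l m / 2, by positivity, ?_⟩
  have hmin : 0 < min l m := lt_min hl hm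
  simp only [smul_add]
  refine hY.integrable_add (h1.1.const_smul _) (h3.1.const_smul _) ?_ ?_
  · simp only [smul_smul]
    refine hY.integrable_smul_mono h1.1 ?_ h2
    rw [mul_div_cancel₀ _ two_ne_zero, abs_of_pos hl, abs_of_pos hmin]
    exact min_le_left _ _
  · simp only [smul_smul]
    refine hY.integrable_smul_mono h3.1 ?_ h4
    rw [mul_div_cancel₀ _ two_ne_zero, abs_of_pos hm, abs_of_pos hmin]
    exact min_le_right _ _

lemma memL_sub (hY : IsYoungFn μ Y) (hu : MemL μ Y u) (hv : MemL μ Y v) :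
    MemL μ Y (fun x => u x - v x) := by
  simpa [sub_eq_add_neg] using hY.memL_add hu (hY.memL_smul hv (-1))

variable [FiniteDimensional ℝ W] [IsFiniteMeasure μ]

lemma memE_smul (hY : IsYoungFn μ Y) (hv : MemE μ Y v) (c : ℝ) :
    MemE μ Y (fun x => c • v x) := by
  obtain ⟨h1, h2⟩ := hY.memE_iff.1 hv
  refine hY.memE_iff.2 ⟨h1.smul c, fun l => ?_⟩
  simpa [smul_smul] using h2 (l * c)

lemma memE_add (hY : IsYoungFn μ Y) (hu : MemE μ Y u) (hv : MemE μ Y v) :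
    MemE μ Y (fun x => u x + v x) := by
  obtain ⟨h1, h2⟩ := hY.memE_iff.1 hu
  obtain ⟨h3, h4⟩ := hY.memE_iff.1 hv
  refine hY.memE_iff.2 ⟨h1.add h3, fun l => ?_⟩
  simp only [smul_add]
  refine hY.integrable_add (h1.1.const_smul _) (h3.1.const_smul _) ?_ ?_
  · simpa [smul_smul] using h2 (2 * l)
  · simpa [smul_smul] using h4 (2 * l)

lemma memE_sub (hY : IsYoungFn μ Y) (hu : MemE μ Y u) (hv : MemE μ Y v) :
    MemE μ Y (fun x => u x - v x) := by
  simpa [sub_eq_add_neg] using hY.memE_add hu (hY.memE_smul hv (-1))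

lemma memE_of_bounded (hY : IsYoungFn μ Y) (hu : AEStronglyMeasurable u μ) {R : ℝ}
    (hR : ∀ᵐ x ∂μ, ‖u x‖ ≤ R) : MemE μ Y u := by
  refine hY.memE_iff.2 ⟨(memLp_top_of_bound hu R hR).integrable le_top, fun l => ?_⟩
  obtain ⟨b, hb, hbY⟩ := hY.exists_bound (|l| * R)
  refine hY.integrable_of_le (hu.const_smul l) hb ?_
  filter_upwards [hR, hbY] with x h1 h2
  refine h2 _ ?_
  rw [norm_smul, Real.norm_eq_abs]
  gcongr

lemma memE_zero (hY : IsYoungFn μ Y) : MemE μ Y (fun _ => 0) :=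
  hY.memE_of_bounded aestronglyMeasurable_const (R := 0) (by simp)

lemma memE_sum (hY : IsYoungFn μ Y) {ι : Type*} (s : Finset ι) {w : ι → α → W}
    (hw : ∀ k ∈ s, MemE μ Y (w k)) :
    MemE μ Y (fun x => ∑ k ∈ s, w k x) := by
  classical
  induction s using Finset.induction_on with
  | empty => simpa using hY.memE_zero
  | insert a s ha ih =>
    simp only [Finset.sum_insert ha]
    exact hY.memE_add (hw a (Finset.mem_insert_self a s))
      (ih fun k hk => hw k (Finset.mem_insert_of_mem hk))

/-- Under the `Δ₂` condition every function in `L^Y` belongs to `E^Y`. -/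
lemma memE_of_deltaTwo (hY : IsYoungFn μ Y) (hΔ : DeltaTwo μ Y) (hv : MemL μ Y v) :
    MemE μ Y v := by
  obtain ⟨c, K, hc, hK, h⟩ := hΔ
  obtain ⟨h1, l, hl, h2⟩ := hY.memL_iff.1 hv
  obtain ⟨b, hb, hbY⟩ := hY.exists_bound (2 * K)
  -- doubling `v` multiplies `Y` by at most `c`, up to the values of `Y` on the ball of radius `2 K`
  have key : ∀ n : ℕ, Integrable (fun x => Y x (((2 : ℝ) ^ n * l) • v x)) μ := by
    intro n
    induction n with
    | zero => simpa using h2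
    | succ n ih =>
      refine hY.integrable_of_le (h1.1.const_smul _) ((ih.const_mul c).add hb.norm) ?_
      filter_upwards [h, hbY, hY.nonneg] with x h3 h4 h5
      have h6 : ((2 : ℝ) ^ (n + 1) * l) • v x = (2 : ℝ) • ((2 : ℝ) ^ n * l) • v x := by
        rw [smul_smul]; ring_nf
      rw [h6]
      set z := ((2 : ℝ) ^ n * l) • v x
      simp only [Pi.add_apply]
      rcases lt_or_ge K ‖z‖ with hz | hz
      · have := h3 z hz
        have := norm_nonneg (b x)
        linarith
      · have : Y x ((2 : ℝ) • z) ≤ b x := by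
          refine h4 _ ?_
          rw [norm_smul, Real.norm_eq_abs, abs_two]
          gcongr
        have := Real.le_norm_self (b x)
        have := mul_nonneg hc.le (h5 z)
        linarith
  refine hY.memE_iff.2 ⟨h1, fun m => ?_⟩
  obtain ⟨n, hn⟩ := pow_unbounded_of_one_lt (|m| / l) (one_lt_two (α := ℝ))
  refine hY.integrable_smul_mono h1.1 ?_ (key n)
  rw [div_lt_iff₀ hl] at hn
  rw [abs_of_pos (by positivity : 0 < (2 : ℝ) ^ n * l)]
  exact hn.le

end Closure

end IsYoungFn

end Orlicz

/-! ### Complementary functions -/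

section Dual

variable {α : Type*} [MeasurableSpace α] {W : Type*}
  [NormedAddCommGroup W] [InnerProductSpace ℝ W] {μ : Measure α}

/-- `Y` and `Z` are complementary to each other. -/
structure DualPair (μ : Measure α) (Y Z : α → W → ℝ) : Prop where
  left : IsYoungFn μ Y
  right : IsYoungFn μ Z
  isLUB_right : ∀ᵐ x ∂μ, ∀ z, IsLUB (range fun y => ⟪z, y⟫ - Y x y) (Z x z)
  isLUB_left : ∀ᵐ x ∂μ, ∀ y, IsLUB (range fun z => ⟪y, z⟫ - Z x z) (Y x y)

variable {Y Z : α → W → ℝ}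

/-- A maximizing sequence, by measurable bounded functions, for the supremum defining the
complementary function at `v(x)`. -/
lemma exists_maximizing_seq [FiniteDimensional ℝ W] (hc : IsCaratheodory μ Y) {v : α → W}
    (hv : AEStronglyMeasurable v μ) :
    ∃ u : ℕ → α → W, (∀ n, AEStronglyMeasurable (u n) μ) ∧ (∀ n, ∃ R : ℝ, ∀ x, ‖u n x‖ ≤ R) ∧
      (u 0 = fun _ => 0) ∧
      (∀ x, Monotone fun n => ⟪v x, u n x⟫ - Y x (u n x)) ∧
      ∀ᵐ x ∂μ, ∀ s, IsLUB (range fun y => ⟪v x, y⟫ - Y x y) s →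
        Tendsto (fun n => ⟪v x, u n x⟫ - Y x (u n x)) atTop (𝓝 s) := by
  classical
  -- `u n x` is the best among `0` and the first `n` points of a dense sequence
  let y : ℕ → W := TopologicalSpace.denseSeq W
  let u : ℕ → α → W := fun n => Nat.rec (fun _ => 0)
    (fun n w x => if ⟪v x, w x⟫ - Y x (w x) < ⟪v x, y n⟫ - Y x (y n) then y n else w x) n
  have hu : ∀ n x, u (n + 1) x =
      if ⟪v x, u n x⟫ - Y x (u n x) < ⟪v x, y n⟫ - Y x (y n) then y n else u n x :=
    fun n x => rfl
  have hmeas : ∀ {w : α → W}, AEStronglyMeasurable w μ →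
      AEMeasurable (fun x => ⟪v x, w x⟫ - Y x (w x)) μ := fun hw =>
    ((hv.inner hw).sub (hc.comp hw)).aemeasurable
  have hum : ∀ n, AEStronglyMeasurable (u n) μ := by
    intro n
    induction n with
    | zero => exact aestronglyMeasurable_const
    | succ n ih =>
      have hs : NullMeasurableSet
          {x | ⟪v x, u n x⟫ - Y x (u n x) < ⟪v x, y n⟫ - Y x (y n)} μ :=
        nullMeasurableSet_lt (hmeas ih) (hmeas aestronglyMeasurable_const)
      have : u (n + 1) =
          fun x => {x | ⟪v x, u n x⟫ - Y x (u n x) < ⟪v x, y n⟫ - Y x (y n)}.indicator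
            (fun _ => y n) x +
          {x | ⟪v x, u n x⟫ - Y x (u n x) < ⟪v x, y n⟫ - Y x (y n)}ᶜ.indicator (u n) x := by
        funext x
        rw [hu]
        by_cases h : ⟪v x, u n x⟫ - Y x (u n x) < ⟪v x, y n⟫ - Y x (y n) <;>
          simp [indicator, h]
      rw [this]
      exact (aestronglyMeasurable_const.indicator₀ hs).add (ih.indicator₀ hs.compl)
  have hstep : ∀ n x, ⟪v x, u (n + 1) x⟫ - Y x (u (n + 1) x) =
      max (⟪v x, u n x⟫ - Y x (u n x)) (⟪v x, y n⟫ - Y x (y n)) := by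
    intro n x
    rw [hu]
    split_ifs with h
    · exact (max_eq_right h.le).symm
    · exact (max_eq_left (not_lt.1 h)).symm
  have hmono : ∀ x, Monotone fun n => ⟪v x, u n x⟫ - Y x (u n x) := fun x =>
    monotone_nat_of_le_succ fun n => by rw [hstep]; exact le_max_left _ _
  refine ⟨u, hum, ?_, rfl, hmono, ?_⟩
  · intro n
    induction n with
    | zero => exact ⟨0, fun x => by simp [u]⟩
    | succ n ih =>
      obtain ⟨R, hR⟩ := ih
      refine ⟨max R ‖y n‖, fun x => ?_⟩
      rw [hu]
      split_ifs
      · exact le_max_right _ _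
      · exact (hR x).trans (le_max_left _ _)
  · filter_upwards [hc.continuous] with x hx s hs
    refine tendsto_order.2 ⟨fun a ha => ?_, fun a ha => ?_⟩
    · obtain ⟨_, ⟨z, rfl⟩, hz⟩ := (lt_isLUB_iff hs).1 ha
      have hcont : Continuous fun y => ⟪v x, y⟫ - Y x y := by fun_prop
      obtain ⟨n, hn⟩ := (TopologicalSpace.denseRange_denseSeq W).exists_mem_open
        (isOpen_lt continuous_const hcont) ⟨z, hz⟩
      filter_upwards [eventually_ge_atTop (n + 1)] with m hm
      refine lt_of_lt_of_le ?_ (hmono x hm)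
      simp only [hstep]
      exact lt_of_lt_of_le hn (le_max_right _ _)
    · exact Eventually.of_forall fun n => (hs.1 ⟨u n x, rfl⟩).trans_lt ha

/-- The supremum defining the complementary function of a function with superlinear growth is
finite. -/
lemma bddAbove_conj {φ : W → ℝ} (hn : ∀ z, 0 ≤ φ z)
    (hinf : Tendsto (fun z => φ z / ‖z‖) (Bornology.cobounded W) atTop) (z : W) :
    BddAbove (range fun y => ⟪z, y⟫ - φ y) := by
  have h1 := hinf.eventually_ge_atTop ‖z‖
  rw [← comap_norm_atTop, eventually_comap] at h1
  obtain ⟨R, hR⟩ := eventually_atTop.1 h1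
  refine ⟨‖z‖ * max R 1, ?_⟩
  rintro _ ⟨y, rfl⟩
  have h2 := real_inner_le_norm z y
  rcases le_total ‖y‖ (max R 1) with hy | hy
  · have := mul_le_mul_of_nonneg_left hy (norm_nonneg z)
    have := hn y
    simp only
    linarith
  · have hy0 : 0 < ‖y‖ := lt_of_lt_of_le (by positivity) hy
    have := hR ‖y‖ ((le_max_left _ _).trans hy) y rfl
    rw [le_div_iff₀ hy0] at this
    have : 0 ≤ ‖z‖ * max R 1 := by positivity
    simp only
    linarith

/-- The Fenchel-Moreau theorem for real convex functions. -/
lemma isLUB_biconj [CompleteSpace W] {φ ψ : W → ℝ} (hc : Continuous φ) (hconv : ConvexOn ℝ univ φ)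
    (hψ : ∀ z, IsLUB (range fun y => ⟪z, y⟫ - φ y) (ψ z)) (y : W) :
    IsLUB (range fun z => ⟪y, z⟫ - ψ z) (φ y) := by
  constructor
  · rintro _ ⟨z, rfl⟩
    have := (hψ z).1 ⟨y, rfl⟩
    simp only [real_inner_comm y z] at this ⊢
    linarith
  · intro B hB
    by_contra! h
    obtain ⟨a, ha1, ha2⟩ := exists_between h
    obtain ⟨l, c, hl, hla⟩ := hconv.exists_affine_le_of_lt (𝕜 := ℝ) (mem_univ y) ha2 isClosed_univ
      (hc.lowerSemicontinuous.lowerSemicontinuousOn _)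
    obtain ⟨p, rfl⟩ := (InnerProductSpace.toDual ℝ W).surjective l
    have h1 : ψ p ≤ -c := by
      refine (hψ p).2 ?_
      rintro _ ⟨w, rfl⟩
      have := hl ⟨w, mem_univ w⟩
      simp at this ⊢
      linarith
    have h2 := hB ⟨p, rfl⟩
    simp only [InnerProductSpace.toDual_apply_apply, RCLike.re_to_real, real_inner_comm y p]
      at h2 hla
    linarith

/-- An `N`-function and its complementary function are complementary to each other. Measurability of
the complementary function, a supremum over an uncountable set, comes from the measurable maximizing
sequences of `exists_maximizing_seq`. -/
lemma IsNFunction.dualPair [FiniteDimensional ℝ W] [Nontrivial W] (hY : IsNFunction μ Y)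
    (hfin : FiniteOnConstants μ Y) (hfin' : FiniteOnConstants μ (conj Y)) :
    DualPair μ Y (conj Y) := by
  have hzero : ∀ᵐ x ∂μ, Y x 0 = 0 := by
    filter_upwards [hY.limit_zero, hY.caratheodory.continuous] with x h1 h2
    have h3 : Tendsto (fun z => Y x z / ‖z‖ * ‖z‖) (𝓝[≠] (0 : W)) (𝓝 (0 * ‖(0 : W)‖)) :=
      h1.mul (continuous_norm.continuousAt.tendsto.mono_left nhdsWithin_le_nhds)
    rw [zero_mul] at h3
    have h4 : Tendsto (Y x) (𝓝[≠] (0 : W)) (𝓝 0) := by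
      refine h3.congr' ?_
      filter_upwards [self_mem_nhdsWithin] with z hz
      exact div_mul_cancel₀ _ (norm_ne_zero_iff.2 hz)
    exact tendsto_nhds_unique (h2.continuousAt.tendsto.mono_left nhdsWithin_le_nhds) h4
  have hlub : ∀ᵐ x ∂μ, ∀ z, IsLUB (range fun y => ⟪z, y⟫ - Y x y) (conj Y x z) := by
    filter_upwards [hY.nonneg, hY.limit_infty] with x h1 h2 z
    exact isLUB_ciSup (bddAbove_conj h1 h2 z)
  have hconv : ∀ᵐ x ∂μ, ConvexOn ℝ univ (conj Y x) := by
    filter_upwards [hlub] with x h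
    refine ⟨convex_univ, fun a _ b _ s t hs ht hst => (h _).2 ?_⟩
    rintro _ ⟨y, rfl⟩
    have h1 := (h a).1 ⟨y, rfl⟩
    have h2 := (h b).1 ⟨y, rfl⟩
    simp only [inner_add_left, inner_smul_left, smul_eq_mul, RCLike.conj_to_real] at h1 h2 ⊢
    have : Y x y = s * Y x y + t * Y x y := by rw [← add_mul, hst, one_mul]
    nlinarith [mul_le_mul_of_nonneg_left h1 hs, mul_le_mul_of_nonneg_left h2 ht]
  refine ⟨⟨hY.caratheodory, hY.nonneg, hzero, hY.even, hY.convex, hfin⟩,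
    ⟨⟨?_, fun z => ?_⟩, ?_, ?_, ?_, hconv, hfin'⟩, hlub, ?_⟩
  · filter_upwards [hconv] with x hx
    exact hx.locallyLipschitz.continuous
  · obtain ⟨u, hu, -, -, -, hlim⟩ := exists_maximizing_seq hY.caratheodory (v := fun _ => z)
      aestronglyMeasurable_const
    refine aestronglyMeasurable_of_tendsto_ae atTop
      (f := fun n x => ⟪z, u n x⟫ - Y x (u n x)) (fun n => (AEStronglyMeasurable.inner
        (aestronglyMeasurable_const (b := z)) (hu n)).sub (hY.caratheodory.comp (hu n))) ?_
    filter_upwards [hlim, hlub] with x h1 h2 using h1 _ (h2 z)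
  · filter_upwards [hlub, hzero] with x h1 h2 z
    simpa [h2] using (h1 z).1 ⟨0, rfl⟩
  · filter_upwards [hlub, hzero, hY.nonneg] with x h1 h2 h3
    refine le_antisymm ((h1 0).2 ?_) (by simpa [h2] using (h1 0).1 ⟨0, rfl⟩)
    rintro _ ⟨y, rfl⟩
    simpa using h3 y
  · filter_upwards [hlub, hY.even] with x h1 h2 z
    have key : ∀ z, conj Y x (-z) ≤ conj Y x z := by
      intro z
      refine (h1 (-z)).2 ?_
      rintro _ ⟨y, rfl⟩
      simpa [h2] using (h1 z).1 ⟨-y, rfl⟩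
    exact le_antisymm (key z) (by simpa using key (-z))
  · filter_upwards [hlub, hY.convex, hY.caratheodory.continuous] with x h1 h2 h3 y
    exact isLUB_biconj h3 h2 h1 y

namespace DualPair

lemma symm (P : DualPair μ Y Z) : DualPair μ Z Y :=
  ⟨P.right, P.left, P.isLUB_left, P.isLUB_right⟩

/-- Young's inequality. -/
lemma young (P : DualPair μ Y Z) : ∀ᵐ x ∂μ, ∀ z y, |⟪z, y⟫| ≤ Y x y + Z x z := by
  filter_upwards [P.isLUB_right, P.right.even] with x h1 h2 z y
  have key : ∀ z, ⟪z, y⟫ ≤ Y x y + Z x z := fun z => by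
    have := (h1 z).1 ⟨y, rfl⟩
    simp only at this
    linarith
  rw [abs_le]
  have h3 := key (-z)
  rw [h2, inner_neg_left] at h3
  exact ⟨by linarith, key z⟩

lemma integrable_inner (P : DualPair μ Y Z) {v u : α → W} (hv : AEStronglyMeasurable v μ)
    (hu : AEStronglyMeasurable u μ) (h1 : Integrable (fun x => Z x (v x)) μ)
    (h2 : Integrable (fun x => Y x (u x)) μ) : Integrable (fun x => ⟪v x, u x⟫) μ := by
  refine (h2.add h1).mono' (hv.inner hu) ?_
  filter_upwards [P.young] with x hx using hx _ _

lemma abs_integral_inner_le (P : DualPair μ Y Z) {v u : α → W} 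
    (h1 : Integrable (fun x => Z x (v x)) μ)
    (h2 : Integrable (fun x => Y x (u x)) μ) :
    |∫ x, ⟪v x, u x⟫ ∂μ| ≤ ∫ x, Y x (u x) ∂μ + ∫ x, Z x (v x) ∂μ := by
  rw [← integral_add h2 h1]
  rw [← Real.norm_eq_abs]
  refine norm_integral_le_of_norm_le (h2.add h1) ?_
  filter_upwards [P.young] with x hx using hx _ _

lemma integrable_inner_memL (P : DualPair μ Y Z) {v u : α → W} (hv : MemL μ Z v)
    (hu : MemL μ Y u) : Integrable (fun x => ⟪v x, u x⟫) μ := by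
  obtain ⟨h1, l, hl, h2⟩ := P.right.memL_iff.1 hv
  obtain ⟨h3, m, hm, h4⟩ := P.left.memL_iff.1 hu
  have := (P.integrable_inner (h1.1.const_smul l) (h3.1.const_smul m) h2 h4).const_mul (l * m)⁻¹
  refine this.congr (ae_of_all _ fun x => ?_)
  simp only [Pi.smul_apply, inner_smul_left, inner_smul_right, RCLike.conj_to_real]
  field_simp

variable [FiniteDimensional ℝ W]

lemma integrable_of_modular (P : DualPair μ Y Z) {v : α → W} (hv : AEStronglyMeasurable v μ)
    (h : Integrable (fun x => Z x (v x)) μ) : Integrable v μ := by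
  set b := stdOrthonormalBasis ℝ W
  have h1 : v = fun x => ∑ k, ⟪v x, b k⟫ • b k := by
    funext x
    conv_lhs => rw [← b.sum_repr' (v x)]
    simp only [real_inner_comm]
  rw [h1]
  refine integrable_finsetSum _ fun k _ => Integrable.smul_const ?_ _
  exact P.integrable_inner hv aestronglyMeasurable_const h (P.left.integrable_const _)

end DualPair

end Dual

/-! ### Weak-star compactness along ultrafilters -/

/-- Interchange of a limit with a uniform approximation. -/
lemma tendsto_of_forall_approx {I : Type*} {l : Filter I} {F : I → ℝ} {a : ℝ}
    (h : ∀ ε : ℝ, 0 < ε → ∃ (G : I → ℝ) (b : ℝ), Tendsto G l (𝓝 b) ∧ (∀ i, |F i - G i| ≤ ε) ∧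
      |a - b| ≤ ε) : Tendsto F l (𝓝 a) := by
  refine Metric.tendsto_nhds.2 fun ε hε => ?_
  obtain ⟨G, b, h1, h2, h3⟩ := h (ε / 4) (by positivity)
  filter_upwards [Metric.tendsto_nhds.1 h1 (ε / 4) (by positivity)] with i hi
  rw [Real.dist_eq] at hi ⊢
  have h4 := h2 i
  rw [abs_le] at h4 h3
  rw [abs_lt] at hi ⊢
  constructor <;> linarith [hi.1, hi.2, h4.1, h4.2, h3.1, h3.2]

lemma exists_tendsto_ultrafilter {I : Type*} (U : Ultrafilter I) {F : I → ℝ} {C : ℝ}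
    (h : ∀ i, |F i| ≤ C) : ∃ a, Tendsto F U (𝓝 a) := by
  obtain ⟨a, -, ha⟩ := (isCompact_Icc (a := -C) (b := C)).ultrafilter_le_nhds (U.map F)
    (by
      rw [le_principal_iff]
      exact Eventually.of_forall (f := (U : Filter I)) fun i => abs_le.1 (h i))
  exact ⟨a, ha⟩

section Fatou

variable {α : Type*} [MeasurableSpace α] {μ : Measure α}

/-- Fatou's lemma for real functions with a common integrable minorant. -/
lemma integrable_of_tendsto_of_integral_le {F : ℕ → α → ℝ} {f g : α → ℝ} {M : ℝ}
    (hF : ∀ n, Integrable (F n) μ) (hg : Integrable g μ) (hgF : ∀ n, ∀ᵐ x ∂μ, g x ≤ F n x)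
    (hlim : ∀ᵐ x ∂μ, Tendsto (fun n => F n x) atTop (𝓝 (f x)))
    (hM : ∀ n, ∫ x, F n x ∂μ ≤ M) : Integrable f μ ∧ ∫ x, f x ∂μ ≤ M := by
  have hfm : AEStronglyMeasurable f μ :=
    aestronglyMeasurable_of_tendsto_ae atTop (fun n => (hF n).1) hlim
  have hgf : ∀ᵐ x ∂μ, g x ≤ f x := by
    filter_upwards [hlim, ae_all_iff.2 hgF] with x h1 h2
    exact ge_of_tendsto' h1 h2
  have h0 : 0 ≤ᵐ[μ] fun x => f x - g x := by
    filter_upwards [hgf] with x hx using sub_nonneg.2 hx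
  have hM' : ∀ n, ∫⁻ x, ENNReal.ofReal (F n x - g x) ∂μ ≤ ENNReal.ofReal (M - ∫ x, g x ∂μ) := by
    intro n
    have hi : Integrable (fun x => F n x - g x) μ := (hF n).sub hg
    rw [← ofReal_integral_eq_lintegral_ofReal hi]
    · rw [integral_sub (hF n) hg]
      exact ENNReal.ofReal_le_ofReal (by linarith [hM n])
    · filter_upwards [hgF n] with x hx using sub_nonneg.2 hx
  have hlint : ∫⁻ x, ENNReal.ofReal (f x - g x) ∂μ ≤ ENNReal.ofReal (M - ∫ x, g x ∂μ) := by
    calc ∫⁻ x, ENNReal.ofReal (f x - g x) ∂μ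
        = ∫⁻ x, liminf (fun n => ENNReal.ofReal (F n x - g x)) atTop ∂μ := by
          refine lintegral_congr_ae ?_
          filter_upwards [hlim] with x hx
          refine (Tendsto.liminf_eq ?_).symm
          exact (ENNReal.continuous_ofReal.tendsto _).comp (hx.sub_const _)
      _ ≤ liminf (fun n => ∫⁻ x, ENNReal.ofReal (F n x - g x) ∂μ) atTop :=
          lintegral_liminf_le' fun n => ((hF n).sub hg).1.aemeasurable.ennreal_ofReal
      _ ≤ _ := by
          refine (liminf_le_liminf (Eventually.of_forall hM')).trans ?_
          simp
  have hi : Integrable (fun x => f x - g x) μ :=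
    ⟨hfm.sub hg.1, (hasFiniteIntegral_iff_ofReal h0).2 (hlint.trans_lt ENNReal.ofReal_lt_top)⟩
  have hf : Integrable f μ := by simpa [Pi.add_def] using hi.add hg
  refine ⟨hf, ?_⟩
  have h1 := hM 0
  have h2 : ∫ x, g x ∂μ ≤ ∫ x, F 0 x ∂μ := integral_mono_ae hg (hF 0) (hgF 0)
  rw [← ofReal_integral_eq_lintegral_ofReal hi h0,
    ENNReal.ofReal_le_ofReal_iff (by linarith), integral_sub hf hg] at hlint
  linarith

end Fatou

section DunfordPettis

variable {α : Type*} [MeasurableSpace α] {μ : Measure α} [IsFiniteMeasure μ]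

/-- The Dunford-Pettis theorem along an ultrafilter: uniformly absolutely continuous integrals
have a limit that is given by an integrable density. -/
lemma exists_density_of_uniform {I : Type*} (U : Ultrafilter I) {w : I → α → ℝ}
    (hw : ∀ i, Integrable (w i) μ) {C : ℝ} (hC : ∀ i A, |∫ x in A, w i x ∂μ| ≤ C)
    (hu : ∀ ε : ℝ, 0 < ε → ∃ δ : ℝ≥0∞, 0 < δ ∧
      ∀ A, MeasurableSet A → μ A ≤ δ → ∀ i, |∫ x in A, w i x ∂μ| ≤ ε) :
    ∃ w' : α → ℝ, Integrable w' μ ∧ ∀ A, MeasurableSet A →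
      Tendsto (fun i => ∫ x in A, w i x ∂μ) U (𝓝 (∫ x in A, w' x ∂μ)) := by
  classical
  choose L hL using fun A : Set α => exists_tendsto_ultrafilter U (fun i => hC i A)
  have hLε : ∀ ε : ℝ, 0 < ε → ∃ δ : ℝ≥0∞, 0 < δ ∧
      ∀ A, MeasurableSet A → μ A ≤ δ → |L A| ≤ ε := by
    intro ε hε
    obtain ⟨δ, hδ, h⟩ := hu ε hε
    exact ⟨δ, hδ, fun A hA hAδ => le_of_tendsto (hL A).abs (Eventually.of_forall (h A hA hAδ))⟩
  have hLunion : ∀ A B, MeasurableSet A → MeasurableSet B → Disjoint A B →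
      L (A ∪ B) = L A + L B := by
    intro A B hA hB hAB
    refine tendsto_nhds_unique (hL (A ∪ B)) (((hL A).add (hL B)).congr fun i => ?_)
    rw [setIntegral_union hAB hB (hw i).integrableOn (hw i).integrableOn]
  have hLempty : L ∅ = 0 := tendsto_nhds_unique (hL ∅) (by simp)
  have hLfin : ∀ (f : ℕ → Set α), (∀ i, MeasurableSet (f i)) → Pairwise (Function.onFun Disjoint f) →
      ∀ s : Finset ℕ, L (⋃ i ∈ s, f i) = ∑ i ∈ s, L (f i) := by
    intro f hf hd s
    induction s using Finset.induction_on with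
    | empty => simpa using hLempty
    | insert a s ha ih =>
      rw [Finset.set_biUnion_insert, Finset.sum_insert ha, hLunion _ _ (hf a)
        (Finset.measurableSet_biUnion s fun i _ => hf i), ih]
      refine Set.disjoint_iUnion₂_right.2 fun i hi => hd ?_
      rintro rfl
      exact ha hi
  let ν : SignedMeasure α :=
    { measureOf' := fun A => if MeasurableSet A then L A else 0
      empty' := by simp [hLempty]
      not_measurable' := fun A hA => by simp [hA]
      m_iUnion' := by
        intro f hf hd
        simp only [hf, MeasurableSet.iUnion hf, if_true]
        -- the tails of the union have small measure, hence small limit integrals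
        refine Metric.tendsto_nhds.2 fun ε hε => ?_
        obtain ⟨δ, hδ, h⟩ := hLε (ε / 2) (by positivity)
        have hsum : ∑' i, μ (f i) ≠ ⊤ := by
          rw [← measure_iUnion hd hf]; exact measure_ne_top _ _
        have := (ENNReal.tendsto_tsum_compl_atTop_zero hsum).eventually (ge_mem_nhds hδ)
        filter_upwards [this] with s hs
        have hsm : MeasurableSet (⋃ i ∈ s, f i) := Finset.measurableSet_biUnion s fun i _ => hf i
        have hcm : MeasurableSet (⋃ i : {i // i ∉ s}, f i) := MeasurableSet.iUnion fun i => hf i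
        have hU : (⋃ i, f i) = (⋃ i ∈ s, f i) ∪ ⋃ i : {i // i ∉ s}, f i := by
          ext x
          simp only [mem_iUnion, mem_union, Subtype.exists, exists_prop]
          constructor
          · rintro ⟨i, hi⟩
            by_cases his : i ∈ s
            · exact Or.inl ⟨i, his, hi⟩
            · exact Or.inr ⟨i, his, hi⟩
          · rintro (⟨i, -, hi⟩ | ⟨i, -, hi⟩) <;> exact ⟨i, hi⟩
        have hdis : Disjoint (⋃ i ∈ s, f i) (⋃ i : {i // i ∉ s}, f i) := by
          refine Set.disjoint_iUnion₂_left.2 fun i hi => Set.disjoint_iUnion_right.2 fun j => hd ?_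
          rintro rfl
          exact j.2 hi
        have h1 := h _ hcm ((measure_iUnion_le _).trans hs)
        rw [hU, hLunion _ _ hsm hcm hdis, hLfin f hf hd s, Real.dist_eq]
        calc _ = |L (⋃ i : {i // i ∉ s}, f i)| := by
              rw [← abs_neg]; congr 1; ring
          _ < ε := by linarith }
  have hν : ∀ A, MeasurableSet A → ν A = L A := fun A hA => by
    change (if MeasurableSet A then L A else 0) = L A
    simp [hA]
  have hac : ν ≪ᵥ μ.toENNRealVectorMeasure := by
    refine VectorMeasure.AbsolutelyContinuous.mk fun A hA h0 => ?_
    rw [Measure.toENNRealVectorMeasure_apply_measurable hA] at h0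
    rw [hν A hA]
    by_contra hne
    obtain ⟨δ, hδ, h⟩ := hLε (|L A| / 2) (by positivity)
    have := h A hA (by simp [h0])
    have : 0 < |L A| := abs_pos.2 hne
    linarith
  have hrn := (SignedMeasure.absolutelyContinuous_iff_withDensityᵥ_rnDeriv_eq ν μ).1 hac
  refine ⟨ν.rnDeriv μ, ν.integrable_rnDeriv μ, fun A hA => ?_⟩
  have : ∫ x in A, ν.rnDeriv μ x ∂μ = L A := by
    rw [← withDensityᵥ_apply (ν.integrable_rnDeriv μ) hA, hrn, hν A hA]
  rw [this]
  exact hL A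

end DunfordPettis

section WeakStar

variable {α : Type*} [MeasurableSpace α] {W : Type*}
  [NormedAddCommGroup W] [InnerProductSpace ℝ W] [FiniteDimensional ℝ W]
  {μ : Measure α} {Y Z : α → W → ℝ} {I : Type*}

/-- Weak-star convergence in `L^{Y*}` along an arbitrary filter. -/
def WeakStarLim (μ : Measure α) (Y : α → W → ℝ) (l : Filter I) (v : I → α → W) (v' : α → W) :
    Prop :=
  ∀ u : α → W, MemE μ Y u →
    Tendsto (fun i => ∫ x, ⟪v i x, u x⟫ ∂μ) l (𝓝 (∫ x, ⟪v' x, u x⟫ ∂μ))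

variable [IsFiniteMeasure μ]

namespace IsYoungFn

/-- Bounded pointwise convergence implies modular convergence. -/
lemma tendsto_of_bounded (hY : IsYoungFn μ Y) {s : ℕ → α → W} {u : α → W}
    (hs : ∀ n, AEStronglyMeasurable (s n) μ) (hu : AEStronglyMeasurable u μ) {R : ℝ}
    (hsR : ∀ n, ∀ᵐ x ∂μ, ‖s n x‖ ≤ R) (huR : ∀ᵐ x ∂μ, ‖u x‖ ≤ R)
    (h : ∀ᵐ x ∂μ, Tendsto (fun n => s n x) atTop (𝓝 (u x))) (l : ℝ) :
    (∀ n, Integrable (fun x => Y x (l • (u x - s n x))) μ) ∧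
    Tendsto (fun n => ∫ x, Y x (l • (u x - s n x)) ∂μ) atTop (𝓝 0) := by
  obtain ⟨b, hb, hbY⟩ := hY.exists_bound (|l| * (R + R))
  have hle : ∀ n, ∀ᵐ x ∂μ, Y x (l • (u x - s n x)) ≤ b x := by
    intro n
    filter_upwards [hsR n, huR, hbY] with x h1 h2 h3
    refine h3 _ ?_
    rw [norm_smul, Real.norm_eq_abs]
    gcongr
    exact (norm_sub_le _ _).trans (add_le_add h2 h1)
  have hi : ∀ n, Integrable (fun x => Y x (l • (u x - s n x))) μ := fun n =>
    hY.integrable_of_le ((hu.sub (hs n)).const_smul l) hb (hle n)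
  refine ⟨hi, ?_⟩
  have := tendsto_integral_of_dominated_convergence (μ := μ)
    (F := fun (n : ℕ) x => Y x (l • (u x - s n x))) (f := fun _ => (0 : ℝ))
    b (fun n => (hi n).1) hb ?_ ?_
  · simpa using this
  · intro n
    filter_upwards [hle n, hY.nonneg] with x h1 h2
    rwa [Real.norm_of_nonneg (h2 _)]
  · filter_upwards [h, hY.car.continuous, hY.zero] with x h1 h2 h3
    have h4 : Continuous fun z => Y x (l • (u x - z)) := by fun_prop
    have := (h4.tendsto (u x)).comp h1
    simpa [h3, Function.comp_def] using this

end IsYoungFn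

namespace DualPair

lemma abs_integral_inner_le_div (P : DualPair μ Y Z) {v u : α → W} {l : ℝ} (hl : 0 < l)
    (h1 : Integrable (fun x => Z x (v x)) μ)
    (h2 : Integrable (fun x => Y x (l • u x)) μ) :
    |∫ x, ⟪v x, u x⟫ ∂μ| ≤ (∫ x, Y x (l • u x) ∂μ + ∫ x, Z x (v x) ∂μ) / l := by
  have := P.abs_integral_inner_le h1 h2
  simp only [inner_smul_right, integral_const_mul, abs_mul, abs_of_pos hl] at this
  rw [le_div_iff₀ hl]
  linarith

lemma integrable_inner_bounded {v u : α → W} (hv : Integrable v μ)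
    (hu : AEStronglyMeasurable u μ) {R : ℝ} (hR : ∀ᵐ x ∂μ, ‖u x‖ ≤ R) :
    Integrable (fun x => ⟪v x, u x⟫) μ := by
  refine (hv.norm.mul_const R).mono' (hv.1.inner hu) ?_
  filter_upwards [hR] with x hx
  exact (norm_inner_le_norm _ _).trans (by gcongr)

lemma abs_setIntegral_inner_le (P : DualPair μ Y Z) {v u : α → W}
    (h1 : Integrable (fun x => Z x (v x)) μ) (h2 : Integrable (fun x => Y x (u x)) μ)
    (A : Set α) :
    |∫ x in A, ⟪v x, u x⟫ ∂μ| ≤ ∫ x in A, Y x (u x) ∂μ + ∫ x, Z x (v x) ∂μ := by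
  have h3 : ∫ x in A, Z x (v x) ∂μ ≤ ∫ x, Z x (v x) ∂μ :=
    setIntegral_le_integral h1 (by filter_upwards [P.right.nonneg] with x hx using hx _)
  refine le_trans ?_ (add_le_add_right h3 _)
  rw [← integral_add h2.restrict h1.restrict, ← Real.norm_eq_abs]
  refine norm_integral_le_of_norm_le (h2.restrict.add h1.restrict) ?_
  filter_upwards [ae_restrict_of_ae P.young] with x hx using hx _ _

/-- Functions with bounded modulars have uniformly absolutely continuous integrals. -/
lemma uniform_setIntegral (P : DualPair μ Y Z) {v : I → α → W}
    (hi : ∀ i, Integrable (fun x => Z x (v i x)) μ)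
    {M : ℝ} (hM : ∀ i, ∫ x, Z x (v i x) ∂μ ≤ M) (e : W) {ε : ℝ} (hε : 0 < ε) :
    ∃ δ : ℝ≥0∞, 0 < δ ∧
      ∀ A, MeasurableSet A → μ A ≤ δ → ∀ i, |∫ x in A, ⟪v i x, e⟫ ∂μ| ≤ ε := by
  -- Young's inequality for `l • e`, divided by `l`: the term with `Z` is at most `M / l < ε / 2`
  obtain ⟨l, hl⟩ : ∃ l : ℝ, 2 * M / ε < l ∧ 1 ≤ l := ⟨max (2 * M / ε + 1) 1,
    lt_max_of_lt_left (by linarith), le_max_right _ _⟩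
  have hl0 : 0 < l := by linarith
  obtain ⟨δ, hδ, h⟩ := exists_pos_setLIntegral_lt_of_measure_lt
    (f := fun x => ENNReal.ofReal (Y x (l • e))) (μ := μ) (P.left.fin (l • e)).ne
    (ε := ENNReal.ofReal (ε / 2)) (by simpa using hε)
  obtain ⟨δ', hδ', hlt⟩ := exists_between hδ
  refine ⟨δ', hδ', fun A hA hAδ i => ?_⟩
  have h3 := P.abs_setIntegral_inner_le (hi i) (P.left.integrable_const (l • e)) A
  simp only [inner_smul_right, integral_const_mul, abs_mul, abs_of_pos hl0] at h3
  have h4 : ∫ x in A, Y x (l • e) ∂μ ≤ ε / 2 := by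
    have h5 : 0 ≤ᵐ[μ.restrict A] fun x => Y x (l • e) := by
      filter_upwards [ae_restrict_of_ae P.left.nonneg] with x hx using hx _
    rw [← ENNReal.ofReal_le_ofReal_iff (by positivity),
      ofReal_integral_eq_lintegral_ofReal (P.left.integrable_const _).restrict h5]
    exact (h A (hAδ.trans_lt hlt)).le
  have h6 := hM i
  have h7 : 2 * M < l * ε := (div_lt_iff₀ hε).1 hl.1
  have h8 : ε ≤ l * ε := le_mul_of_one_le_left hε.le hl.2
  rw [← mul_le_mul_iff_of_pos_left hl0]
  linarith

/-- Weak-star compactness in the form of limits along ultrafilters: functions with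
bounded modulars have a weak-star limit, and the modular is weakly-star lower semicontinuous. -/
theorem exists_weakStarLim (P : DualPair μ Y Z) (U : Ultrafilter I) {v : I → α → W}
    (hv : ∀ i, AEStronglyMeasurable (v i) μ) (hi : ∀ i, Integrable (fun x => Z x (v i x)) μ)
    {M : ℝ} (hM : ∀ i, ∫ x, Z x (v i x) ∂μ ≤ M) :
    ∃ v' : α → W, Integrable v' μ ∧ Integrable (fun x => Z x (v' x)) μ ∧
      ∫ x, Z x (v' x) ∂μ ≤ M ∧ WeakStarLim μ Y U v v' := by
  set b := stdOrthonormalBasis ℝ W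
  have hvi : ∀ i, Integrable (v i) μ := fun i => P.integrable_of_modular (hv i) (hi i)
  have hcoord : ∀ k, ∃ w' : α → ℝ, Integrable w' μ ∧ ∀ A, MeasurableSet A →
      Tendsto (fun i => ∫ x in A, ⟪v i x, b k⟫ ∂μ) U (𝓝 (∫ x in A, w' x ∂μ)) := by
    intro k
    refine exists_density_of_uniform U (C := ∫ x, Y x (b k) ∂μ + M)
      (fun i => (hvi i).inner_const _) (fun i A => ?_) fun ε hε => P.uniform_setIntegral hi hM _ hε
    refine (P.abs_setIntegral_inner_le (hi i) (P.left.integrable_const (b k)) A).trans ?_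
    refine add_le_add (setIntegral_le_integral (P.left.integrable_const _) ?_) (hM i)
    filter_upwards [P.left.nonneg] with x hx using hx _
  choose w hw hwlim using hcoord
  set v' : α → W := fun x => ∑ k, w k x • b k
  have hv' : Integrable v' μ := integrable_finsetSum _ fun k _ => (hw k).smul_const _
  have hv'b : ∀ x k, ⟪v' x, b k⟫ = w k x := by
    intro x k
    simp only [v', sum_inner, inner_smul_left, RCLike.conj_to_real]
    simp [orthonormal_iff_ite.1 b.orthonormal]
  -- convergence against simple functions
  have hset : ∀ (A : Set α) (c : W), MeasurableSet A →
      Tendsto (fun i => ∫ x in A, ⟪v i x, c⟫ ∂μ) U (𝓝 (∫ x in A, ⟪v' x, c⟫ ∂μ)) := by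
    intro A c hA
    have key : ∀ {y : α → W}, Integrable y μ →
        ∫ x in A, ⟪y x, c⟫ ∂μ = ∑ k, ⟪b k, c⟫ * ∫ x in A, ⟪y x, b k⟫ ∂μ := by
      intro y hy
      conv_lhs => rw [← b.sum_repr' c]
      simp only [inner_sum, inner_smul_right]
      rw [integral_finsetSum _ fun k _ => ((hy.inner_const _).integrableOn.const_mul _)]
      simp only [integral_const_mul]
    rw [key hv']
    simp only [key (hvi _), hv'b]
    exact tendsto_finsetSum _ fun k _ => (hwlim k A hA).const_mul _
  have hsimple : ∀ s : SimpleFunc α W,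
      Tendsto (fun i => ∫ x, ⟪v i x, s x⟫ ∂μ) U (𝓝 (∫ x, ⟪v' x, s x⟫ ∂μ)) := by
    intro s
    have key : ∀ {y : α → W}, Integrable y μ →
        ∫ x, ⟪y x, s x⟫ ∂μ = ∑ c ∈ s.range, ∫ x in s ⁻¹' {c}, ⟪y x, c⟫ ∂μ := by
      intro y hy
      have h1 : ∀ x, ⟪y x, s x⟫ =
          ∑ c ∈ s.range, (s ⁻¹' {c}).indicator (fun x => ⟪y x, c⟫) x := by
        intro x
        rw [Finset.sum_eq_single (s x)]
        · simp
        · intro c _ hc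
          simp [indicator, hc.symm]
        · intro hx
          exact absurd (s.mem_range_self x) hx
      simp only [h1]
      rw [integral_finsetSum _ fun c _ =>
        (hy.inner_const c).indicator (s.measurableSet_fiber c)]
      simp only [integral_indicator (s.measurableSet_fiber _)]
    rw [key hv']
    simp only [key (hvi _)]
    exact tendsto_finsetSum _ fun c _ => hset _ _ (s.measurableSet_fiber c)
  -- convergence against bounded functions, by modular approximation with simple functions
  have hbdd : ∀ (u : α → W) (R : ℝ), AEStronglyMeasurable u μ → (∀ᵐ x ∂μ, ‖u x‖ ≤ R) →
      Tendsto (fun i => ∫ x, ⟪v i x, u x⟫ ∂μ) U (𝓝 (∫ x, ⟪v' x, u x⟫ ∂μ)) := by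
    intro u R hu hR
    set s := hu.stronglyMeasurable_mk.approxBounded (max R 0)
    have hsR : ∀ n, ∀ᵐ x ∂μ, ‖s n x‖ ≤ max R 0 := fun n => ae_of_all _ fun x =>
      hu.stronglyMeasurable_mk.norm_approxBounded_le (le_max_right _ _) n x
    have hslim : ∀ᵐ x ∂μ, Tendsto (fun n => s n x) atTop (𝓝 (u x)) := by
      filter_upwards [hu.ae_eq_mk, hR] with x h1 h2
      rw [h1] at h2 ⊢
      exact hu.stronglyMeasurable_mk.tendsto_approxBounded_of_norm_le (h2.trans (le_max_left _ _))
    have huR : ∀ᵐ x ∂μ, ‖u x‖ ≤ max R 0 := by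
      filter_upwards [hR] with x hx using hx.trans (le_max_left _ _)
    have hsm : ∀ n, AEStronglyMeasurable (s n) μ := fun n => (s n).aestronglyMeasurable
    refine tendsto_of_forall_approx fun ε hε => ?_
    obtain ⟨l, hl0, hl⟩ : ∃ l : ℝ, 0 < l ∧ (1 + M) / l ≤ ε := by
      refine ⟨max ((1 + M) / ε) 1, by positivity, ?_⟩
      rw [div_le_iff₀ (by positivity), ← div_le_iff₀' hε]
      exact le_max_left _ _
    obtain ⟨hsi, hs0⟩ := P.left.tendsto_of_bounded hsm hu hsR huR hslim l
    have hlim : Tendsto (fun n => ∫ x, ⟪v' x, s n x⟫ ∂μ) atTop (𝓝 (∫ x, ⟪v' x, u x⟫ ∂μ)) := by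
      refine tendsto_integral_of_dominated_convergence (fun x => ‖v' x‖ * max R 0)
        (fun n => hv'.1.inner (hsm n)) (hv'.norm.mul_const _) (fun n => ?_) ?_
      · filter_upwards [hsR n] with x hx
        exact (norm_inner_le_norm _ _).trans (by gcongr)
      · filter_upwards [hslim] with x hx
        exact tendsto_const_nhds.inner hx
    obtain ⟨n, hn1, hn2⟩ := ((hs0.eventually (gt_mem_nhds one_pos)).and
      (Metric.tendsto_nhds.1 hlim ε hε)).exists
    refine ⟨_, _, hsimple (s n), fun i => ?_, ?_⟩
    · have hiu := integrable_inner_bounded (hvi i) hu hR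
      have his := integrable_inner_bounded (hvi i) (hsm n) (hsR n)
      rw [← integral_sub hiu his]
      simp only [← inner_sub_right]
      refine (P.abs_integral_inner_le_div hl0 (hi i) (hsi n)).trans (le_trans ?_ hl)
      have := hM i
      gcongr
    · rw [abs_sub_comm]
      exact hn2.le
  -- lower semicontinuity of the modular, a supremum of affine functionals with bounded coefficients
  have hmod : Integrable (fun x => Z x (v' x)) μ ∧ ∫ x, Z x (v' x) ∂μ ≤ M := by
    obtain ⟨u, hum, huR, hu0, humono, hulim⟩ := exists_maximizing_seq P.left.car hv'.1
    have huY : ∀ n, Integrable (fun x => Y x (u n x)) μ := fun n => by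
      obtain ⟨R, hR⟩ := huR n
      simpa using (P.left.memE_iff.1 (P.left.memE_of_bounded (hum n) (ae_of_all _ hR))).2 1
    have hui : ∀ n, Integrable (fun x => ⟪v' x, u n x⟫ - Y x (u n x)) μ := fun n => by
      obtain ⟨R, hR⟩ := huR n
      exact (integrable_inner_bounded hv' (hum n) (ae_of_all _ hR)).sub (huY n)
    refine integrable_of_tendsto_of_integral_le hui (integrable_zero _ _ _) (fun n => ?_)
      (f := fun x => Z x (v' x)) ?_ fun n => ?_
    · filter_upwards [P.left.zero] with x hx
      have := humono x (Nat.zero_le n)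
      simpa [hu0, hx] using this
    · filter_upwards [hulim, P.isLUB_right] with x h1 h2 using h1 _ (h2 _)
    · obtain ⟨R, hR⟩ := huR n
      have hb := ae_of_all μ hR
      rw [integral_sub (integrable_inner_bounded hv' (hum n) hb) (huY n)]
      refine le_of_tendsto ((hbdd _ R (hum n) hb).sub_const _) (Eventually.of_forall fun i => ?_)
      have := (abs_le.1 (P.abs_integral_inner_le (hi i) (huY n))).2
      linarith [hM i]
  refine ⟨v', hv', hmod.1, hmod.2, fun u hu => ?_⟩
  -- convergence against `E^Y`, by modular approximation with truncations
  obtain ⟨hu1, hu2⟩ := P.left.memE_iff.1 hu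
  refine tendsto_of_forall_approx fun ε hε => ?_
  obtain ⟨l, hl0, hl⟩ : ∃ l : ℝ, 0 < l ∧ (1 + M) / l ≤ ε := by
    refine ⟨max ((1 + M) / ε) 1, by positivity, ?_⟩
    rw [div_le_iff₀ (by positivity), ← div_le_iff₀' hε]
    exact le_max_left _ _
  obtain ⟨k, hk⟩ :=
    ((P.left.tendsto_trunc hu1.1 (hu2 l)).eventually (gt_mem_nhds one_pos)).exists
  have htm := aestronglyMeasurable_trunc hu1.1 k
  have htb := ae_of_all μ (norm_trunc_le k u)
  have hti := P.left.integrable_sub_trunc hu1.1 k (hu2 l)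
  have key : ∀ {y : α → W}, Integrable y μ → Integrable (fun x => Z x (y x)) μ →
      ∫ x, Z x (y x) ∂μ ≤ M → |∫ x, ⟪y x, u x⟫ ∂μ - ∫ x, ⟪y x, trunc k u x⟫ ∂μ| ≤ ε := by
    intro y hy hyi hyM
    rw [← integral_sub (P.integrable_inner hy.1 hu1.1 hyi (by simpa using hu2 1))
      (integrable_inner_bounded hy htm htb)]
    simp only [← inner_sub_right]
    refine (P.abs_integral_inner_le_div hl0 hyi hti).trans (le_trans ?_ hl)
    gcongr
  exact ⟨_, _, hbdd _ k htm htb, fun i => key (hvi i) (hi i) (hM i), key hv' hmod.1 hmod.2⟩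

end DualPair

end WeakStar

/-! ### Extraction of weak-star convergent sequences -/

lemma exists_seq_of_tendsto {I X : Type*} [TopologicalSpace X] [FirstCountableTopology X]
    {l : Filter I} [l.NeBot] {F : I → X} {a : X} (h : Tendsto F l (𝓝 a)) :
    ∃ i : ℕ → I, Tendsto (fun n => F (i n)) atTop (𝓝 a) := by
  obtain ⟨B, hB⟩ := (𝓝 a).exists_antitone_basis
  have : ∀ n, ∃ i, F i ∈ B n := fun n => (h.eventually_mem (hB.1.mem_of_mem trivial)).exists
  choose i hi using this
  exact ⟨i, hB.tendsto hi⟩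

section Extraction

variable {α : Type*} [MeasurableSpace α] {W : Type*}
  [NormedAddCommGroup W] [InnerProductSpace ℝ W] [FiniteDimensional ℝ W]
  {μ : Measure α} [IsFiniteMeasure μ] {Y Z : α → W → ℝ} {I : Type*}

/-- `E^Y` is separable for modular convergence. -/
lemma IsYoungFn.exists_countable_dense [IsSeparable μ] (hY : IsYoungFn μ Y) :
    ∃ w : ℕ → α → W, (∀ n, MemE μ Y (w n)) ∧ ∀ u, MemE μ Y u → ∀ l : ℝ,
      ∃ n, ∫ x, Y x (l • (u x - w n x)) ∂μ ≤ 1 := by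
  -- the truncations of the members of a sequence that is dense in `L¹`
  have : Fact ((1 : ℝ≥0∞) ≠ ⊤) := ⟨ENNReal.one_ne_top⟩
  let e : ℕ → Lp W 1 μ := TopologicalSpace.denseSeq (Lp W 1 μ)
  have hem : ∀ n k, MemE μ Y (trunc k (e n)) := fun n k =>
    hY.memE_of_bounded (aestronglyMeasurable_trunc (Lp.aestronglyMeasurable _) k)
      (ae_of_all _ (norm_trunc_le k _))
  suffices h : ∀ u, MemE μ Y u → ∀ l : ℝ, ∃ n k,
      ∫ x, Y x (l • (u x - trunc k (e n) x)) ∂μ ≤ 1 by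
    refine ⟨fun m => trunc m.unpair.2 (e m.unpair.1), fun m => hem _ _, fun u hu l => ?_⟩
    obtain ⟨n, k, hnk⟩ := h u hu l
    exact ⟨Nat.pair n k, by simpa using hnk⟩
  intro u hu l
  obtain ⟨hu1, hu2⟩ := hY.memE_iff.1 hu
  obtain ⟨K, hK⟩ :=
    ((hY.tendsto_trunc hu1.1 (hu2 (2 * l))).eventually (gt_mem_nhds one_pos)).exists
  -- compare `u` with its truncation `u'`, and `u'` with truncations, one level higher, of functions
  -- that converge to it almost everywhere
  set u' := trunc K u
  have hu'm : AEStronglyMeasurable u' μ := aestronglyMeasurable_trunc hu1.1 K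
  have hu'b : ∀ x, ‖u' x‖ ≤ K := norm_trunc_le K u
  have hu'i : MemLp u' 1 μ := (memLp_top_of_bound hu'm K (ae_of_all _ hu'b)).mono_exponent le_top
  obtain ⟨f, hfe, hf⟩ : ∃ f : ℕ → Lp W 1 μ, (∀ n, f n ∈ range e) ∧
      Tendsto f atTop (𝓝 (hu'i.toLp u')) :=
    mem_closure_iff_seq_limit.1 (TopologicalSpace.denseRange_denseSeq _ _)
  obtain ⟨ns, -, hns⟩ := (tendstoInMeasure_of_tendsto_Lp hf).exists_seq_tendsto_ae
  have hlim : ∀ᵐ x ∂μ, Tendsto (fun n => trunc (K + 1) (f (ns n)) x) atTop (𝓝 (u' x)) := by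
    filter_upwards [hns, hu'i.coeFn_toLp] with x h1 h2
    rw [h2] at h1
    refine h1.congr' ?_
    have h3 : ‖u' x‖ < (K + 1 : ℕ) := (hu'b x).trans_lt (by push_cast; linarith)
    filter_upwards [h1.norm.eventually (gt_mem_nhds h3)] with n hn
    exact (trunc_of_le hn.le).symm
  have hfm : ∀ n, AEStronglyMeasurable (trunc (K + 1) (f (ns n))) μ := fun n =>
    aestronglyMeasurable_trunc (Lp.aestronglyMeasurable _) _
  obtain ⟨hi, h0⟩ := hY.tendsto_of_bounded hfm hu'm (R := (K + 1 : ℕ))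
    (fun n => ae_of_all _ (norm_trunc_le _ _))
    (ae_of_all _ fun x => (hu'b x).trans (by push_cast; linarith)) hlim (2 * l)
  obtain ⟨n, hn⟩ := (h0.eventually (gt_mem_nhds one_pos)).exists
  obtain ⟨m, hm⟩ := hfe (ns n)
  refine ⟨m, K + 1, ?_⟩
  rw [hm]
  have hK' := hY.integrable_sub_trunc hu1.1 K (hu2 (2 * l))
  calc ∫ x, Y x (l • (u x - trunc (K + 1) (f (ns n)) x)) ∂μ
      ≤ ∫ x, ((1 / 2) * Y x ((2 * l) • (u x - u' x)) +
          (1 / 2) * Y x ((2 * l) • (u' x - trunc (K + 1) (f (ns n)) x))) ∂μ := by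
        refine integral_mono_ae ?_ ((hK'.const_mul _).add ((hi n).const_mul _)) ?_
        · exact (hY.memE_iff.1 (hY.memE_sub hu (hY.memE_of_bounded (hfm n)
            (ae_of_all _ (norm_trunc_le _ _))))).2 l
        · filter_upwards [hY.ae_add_le] with x hx
          have := hx (l • (u x - u' x)) (l • (u' x - trunc (K + 1) (f (ns n)) x))
          rwa [← smul_add, sub_add_sub_cancel, smul_smul, smul_smul] at this
    _ = (1 / 2) * ∫ x, Y x ((2 * l) • (u x - u' x)) ∂μ +
          (1 / 2) * ∫ x, Y x ((2 * l) • (u' x - trunc (K + 1) (f (ns n)) x)) ∂μ := by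
        rw [integral_add (hK'.const_mul _) ((hi n).const_mul _), integral_const_mul,
          integral_const_mul]
    _ ≤ 1 := by linarith

namespace DualPair

/-- Functions `w` that are dense in `E^Y` decide weak-star convergence of functions with bounded
modulars. -/
lemma weakStarLim_of_dense (P : DualPair μ Y Z) {w : ℕ → α → W} (hw : ∀ n, MemE μ Y (w n))
    (hd : ∀ u, MemE μ Y u → ∀ l : ℝ, ∃ n, ∫ x, Y x (l • (u x - w n x)) ∂μ ≤ 1)
    {l : Filter I} {v : I → α → W} {v' : α → W}
    (hv : ∀ i, AEStronglyMeasurable (v i) μ) (hi : ∀ i, Integrable (fun x => Z x (v i x)) μ)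
    {M : ℝ} (hM : ∀ i, ∫ x, Z x (v i x) ∂μ ≤ M)
    (hv' : MemL μ Z v')
    (h : ∀ n, Tendsto (fun i => ∫ x, ⟪v i x, w n x⟫ ∂μ) l (𝓝 (∫ x, ⟪v' x, w n x⟫ ∂μ))) :
    WeakStarLim μ Y l v v' := by
  intro u hu
  obtain ⟨hv'1, r, hr, hv'2⟩ := P.right.memL_iff.1 hv'
  refine tendsto_of_forall_approx fun ε hε => ?_
  obtain ⟨m, hm0, hm1, hm2⟩ : ∃ m : ℝ, 0 < m ∧ (1 + M) / m ≤ ε ∧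
      (1 + ∫ x, Z x (r • v' x) ∂μ) / (r * m) ≤ ε := by
    refine ⟨max (max ((1 + M) / ε) ((1 + ∫ x, Z x (r • v' x) ∂μ) / r / ε)) 1,
      by positivity, ?_, ?_⟩
    · rw [div_le_iff₀ (by positivity), ← div_le_iff₀' hε]
      exact (le_max_left _ _).trans (le_max_left _ _)
    · rw [← div_div, div_le_iff₀ (by positivity), ← div_le_iff₀' hε]
      exact (le_max_right _ _).trans (le_max_left _ _)
  obtain ⟨n, hn⟩ := hd u hu m
  have hd := P.left.memE_sub hu (hw n)
  have hdi := (P.left.memE_iff.1 hd).2 m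
  refine ⟨_, _, h n, fun i => ?_, ?_⟩
  · have hvL : MemL μ Z (v i) :=
      P.right.memL_of_integrable (P.integrable_of_modular (hv i) (hi i)) (hi i)
    rw [← integral_sub (P.integrable_inner_memL hvL hu.1) (P.integrable_inner_memL hvL (hw n).1)]
    simp only [← inner_sub_right]
    refine (P.abs_integral_inner_le_div hm0 (hi i) hdi).trans (le_trans ?_ hm1)
    have := hM i
    gcongr
  · rw [← integral_sub (P.integrable_inner_memL hv' hu.1) (P.integrable_inner_memL hv' (hw n).1)]
    simp only [← inner_sub_right]
    have h3 := P.abs_integral_inner_le_div hm0 hv'2 hdi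
    simp only [inner_smul_left, integral_const_mul, abs_mul, RCLike.conj_to_real,
      abs_of_pos hr] at h3
    rw [← le_div_iff₀' hr, div_div, mul_comm m r] at h3
    refine h3.trans (le_trans ?_ hm2)
    gcongr

end DualPair

/-- Two families with bounded modulars that converge weakly-star along some filter contain
sequences, with common indices, that do so. -/
lemma exists_seq_weakStarTendsto {β : Type*} [MeasurableSpace β] {W' : Type*}
    [NormedAddCommGroup W'] [InnerProductSpace ℝ W'] [FiniteDimensional ℝ W']
    {ν : Measure β} [IsFiniteMeasure ν] {Y' Z' : β → W' → ℝ} [IsSeparable μ] [IsSeparable ν]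
    (P : DualPair μ Y Z) (P' : DualPair ν Y' Z') {l : Filter I} [l.NeBot]
    {v : I → α → W} {v' : α → W} {t : I → β → W'} {t' : β → W'}
    (hv : ∀ i, AEStronglyMeasurable (v i) μ) (hvi : ∀ i, Integrable (fun x => Z x (v i x)) μ)
    (ht : ∀ i, AEStronglyMeasurable (t i) ν) (hti : ∀ i, Integrable (fun x => Z' x (t i x)) ν)
    {M M' : ℝ} (hM : ∀ i, ∫ x, Z x (v i x) ∂μ ≤ M) (hM' : ∀ i, ∫ x, Z' x (t i x) ∂ν ≤ M')
    (hv' : MemL μ Z v') (ht' : MemL ν Z' t')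
    (hvlim : WeakStarLim μ Y l v v') (htlim : WeakStarLim ν Y' l t t') :
    ∃ i : ℕ → I, WeakStarTendsto μ Y (fun n => v (i n)) v' ∧
      WeakStarTendsto ν Y' (fun n => t (i n)) t' := by
  obtain ⟨w, hw, hwd⟩ := P.left.exists_countable_dense
  obtain ⟨z, hz, hzd⟩ := P'.left.exists_countable_dense
  have h : Tendsto (fun i => ((fun n => ∫ x, ⟪v i x, w n x⟫ ∂μ : ℕ → ℝ),
      (fun n => ∫ x, ⟪t i x, z n x⟫ ∂ν : ℕ → ℝ))) l
      (𝓝 ((fun n => ∫ x, ⟪v' x, w n x⟫ ∂μ), (fun n => ∫ x, ⟪t' x, z n x⟫ ∂ν))) :=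
    (tendsto_pi_nhds.2 fun n => hvlim _ (hw n)).prodMk_nhds
      (tendsto_pi_nhds.2 fun n => htlim _ (hz n))
  obtain ⟨i, hi⟩ := exists_seq_of_tendsto h
  refine ⟨i, ?_, ?_⟩
  · exact P.weakStarLim_of_dense hw hwd (fun n => hv (i n)) (fun n => hvi (i n))
      (fun n => hM (i n)) hv' fun n => tendsto_pi_nhds.1 ((continuous_fst.tendsto _).comp hi) n
  · exact P'.weakStarLim_of_dense hz hzd (fun n => ht (i n)) (fun n => hti (i n))
      (fun n => hM' (i n)) ht' fun n => tendsto_pi_nhds.1 ((continuous_snd.tendsto _).comp hi) n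

end Extraction

/-! ### Monotone equations in finite dimensions -/

section Minty

/-- A matrix game whose symmetric part is nonnegative has a strategy with nonnegative payoff. -/
lemma exists_stdSimplex_nonneg {ι : Type*} [Fintype ι] [Nonempty ι] (P : ι → ι → ℝ)
    (hP : ∀ i j, 0 ≤ P i j + P j i) :
    ∃ a ∈ stdSimplex ℝ ι, ∀ i, 0 ≤ ∑ j, a j * P i j := by
  classical
  have hne : (stdSimplex ℝ ι).Nonempty := ⟨_, single_mem_stdSimplex ℝ (Classical.arbitrary ι)⟩
  have hcv := convex_stdSimplex ℝ ι
  have hcp := isCompact_stdSimplex ℝ ι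
  -- the payoff `∑ i j, c i * a j * P i j` is bilinear, hence has a saddle point
  let φ : (ι → ℝ) → (ι → ℝ) → ℝ := fun c a => ∑ i, c i * ∑ j, a j * P i j
  have hc1 : ∀ a, Continuous fun c => φ c a := fun a => by fun_prop
  have hc2 : ∀ c, Continuous fun a => φ c a := fun c => by fun_prop
  have hl1 : ∀ a, IsLinearMap ℝ fun c => φ c a := fun a =>
    ⟨fun c c' => by simp [φ, add_mul, Finset.sum_add_distrib],
     fun r c => by simp [φ, mul_assoc, Finset.mul_sum]⟩
  have hl2 : ∀ c, IsLinearMap ℝ fun a => φ c a := fun c =>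
    ⟨fun a a' => by simp [φ, add_mul, mul_add, Finset.sum_add_distrib],
     fun r a => by
      simp only [φ, Pi.smul_apply, smul_eq_mul, Finset.mul_sum]
      refine Finset.sum_congr rfl fun i _ => Finset.sum_congr rfl fun j _ => by ring⟩
  obtain ⟨c, hc, a, ha, hs⟩ := Sion.exists_isSaddlePointOn (f := φ) hne hcv hcp
    (fun a _ => (hc1 a).lowerSemicontinuous.lowerSemicontinuousOn _)
    (fun a _ => ((hl1 a).mk' _).convexOn hcv |>.quasiconvexOn) hcv hne hcp
    (fun c _ => (hc2 c).upperSemicontinuous.upperSemicontinuousOn _)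
    (fun c _ => ((hl2 c).mk' _).concaveOn hcv |>.quasiconcaveOn)
  refine ⟨a, ha, fun i => ?_⟩
  have h1 := hs (Pi.single i 1) (single_mem_stdSimplex ℝ i) c hc
  have h2 : 0 ≤ φ c c := by
    have : φ c c + φ c c = ∑ i, ∑ j, c i * c j * (P i j + P j i) := by
      have h3 : φ c c = ∑ i, ∑ j, c i * c j * P i j := by
        simp only [φ, Finset.mul_sum, mul_assoc]
      have h4 : φ c c = ∑ i, ∑ j, c i * c j * P j i := by
        rw [h3, Finset.sum_comm]
        exact Finset.sum_congr rfl fun i _ => Finset.sum_congr rfl fun j _ => by ring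
      refine (congrArg₂ (· + ·) h3 h4).trans ?_
      simp only [← Finset.sum_add_distrib, mul_add]
    have : 0 ≤ φ c c + φ c c := by
      rw [this]
      exact Finset.sum_nonneg fun i _ => Finset.sum_nonneg fun j _ =>
        mul_nonneg (mul_nonneg (hc.1 i) (hc.1 j)) (hP i j)
    linarith
  have h3 : φ (Pi.single i 1) a = ∑ j, a j * P i j := by
    simp [φ, Pi.single_apply]
  linarith

variable {E : Type*} [NormedAddCommGroup E] [InnerProductSpace ℝ E] [FiniteDimensional ℝ E]

/-- The weak form of the variational inequality for a monotone map on a ball. -/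
lemma exists_weak_variational {B : E → E} (hB : ∀ x y, 0 ≤ ⟪B x - B y, x - y⟫) {R : ℝ}
    (hR : 0 ≤ R) :
    ∃ x, ‖x‖ ≤ R ∧ ∀ y, ‖y‖ ≤ R → 0 ≤ ⟪B y, y - x⟫ := by
  let K : Set E := Metric.closedBall 0 R
  have hK : IsCompact K := isCompact_closedBall 0 R
  let t : K → Set E := fun y => {x | 0 ≤ ⟪B y, y - x⟫}
  have hcl : ∀ y, IsClosed (t y) := fun y =>
    isClosed_le continuous_const (by fun_prop)
  -- by compactness finitely many `y` suffice, and for these a convex combination of them will do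
  obtain ⟨x, hx, hxt⟩ := hK.inter_iInter_nonempty t hcl (fun u => by
    rcases u.eq_empty_or_nonempty with rfl | hu
    · exact ⟨0, by simp [K, hR]⟩
    have : Nonempty u := hu.to_subtype
    obtain ⟨a, ha, hpos⟩ := exists_stdSimplex_nonneg
      (fun i j : u => ⟪B (i : K), ((i : K) : E) - ((j : K) : E)⟫) (fun i j => by
        have := hB (i : K) (j : K)
        rw [inner_sub_left] at this
        rw [← neg_sub ((i : K) : E) ((j : K) : E), inner_neg_right]
        linarith)
    refine ⟨∑ j, a j • ((j : K) : E), ?_, ?_⟩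
    · exact (convex_closedBall (0 : E) R).sum_mem (fun i _ => ha.1 i) ha.2 fun j _ => j.1.2
    · simp only [mem_iInter]
      intro y hy
      have h1 := hpos ⟨y, hy⟩
      have h2 : (y : E) - ∑ j, a j • ((j : K) : E) = ∑ j, a j • ((y : E) - ((j : K) : E)) := by
        simp only [smul_sub, Finset.sum_sub_distrib, ← Finset.sum_smul, ha.2, one_smul]
      change 0 ≤ ⟪B y, (y : E) - ∑ j, a j • ((j : K) : E)⟫
      rw [h2, inner_sum]
      simpa only [inner_smul_right] using h1)
  refine ⟨x, by simpa [K] using hx, fun y hy => ?_⟩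
  exact mem_iInter.1 hxt ⟨y, by simpa [K] using hy⟩

/-- A continuous monotone map of a Euclidean space that points outwards on a sphere has a zero
in the ball. -/
lemma exists_zero_of_monotone {B : E → E} (hB : ∀ x y, 0 ≤ ⟪B x - B y, x - y⟫)
    (hc : Continuous B) {R : ℝ} (hR : 0 < R) (hout : ∀ x, ‖x‖ = R → 0 < ⟪B x, x⟫) :
    ∃ x, B x = 0 := by
  obtain ⟨x, hx, hw⟩ := exists_weak_variational hB hR.le
  -- Minty's device: insert `x + s (y - x)` and let `s` tend to zero
  have hst : ∀ y, ‖y‖ ≤ R → 0 ≤ ⟪B x, y - x⟫ := by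
    intro y hy
    have h1 : Tendsto (fun s : ℝ => ⟪B (x + s • (y - x)), y - x⟫) (𝓝[>] 0)
        (𝓝 ⟪B (x + (0 : ℝ) • (y - x)), y - x⟫) := by
      refine Tendsto.mono_left (Continuous.tendsto ?_ 0) nhdsWithin_le_nhds
      fun_prop
    rw [zero_smul, add_zero] at h1
    refine ge_of_tendsto h1 ?_
    filter_upwards [Ioo_mem_nhdsGT (zero_lt_one (α := ℝ))] with s hs
    have h2 : ‖x + s • (y - x)‖ ≤ R := by
      have : x + s • (y - x) ∈ Metric.closedBall (0 : E) R :=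
        (convex_closedBall (0 : E) R).add_smul_sub_mem (by simpa using hx) (by simpa using hy)
          ⟨hs.1.le, hs.2.le⟩
      simpa using this
    have h3 := hw _ h2
    rw [add_sub_cancel_left, inner_smul_right] at h3
    exact nonneg_of_mul_nonneg_right h3 hs.1
  have hlt : ‖x‖ < R := by
    refine lt_of_le_of_ne hx fun h => ?_
    have h1 := hst 0 (by simpa using hR.le)
    have h2 := hout x h
    rw [zero_sub, inner_neg_right] at h1
    linarith
  refine ⟨x, ?_⟩
  -- `x` is an interior point, so that `y = x - s • B x` is admissible for small `s`
  obtain ⟨s, hs, hsR⟩ : ∃ s : ℝ, 0 < s ∧ ‖x‖ + s * ‖B x‖ ≤ R := by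
    refine ⟨(R - ‖x‖) / (‖B x‖ + 1), by
      have := sub_pos.2 hlt
      positivity, ?_⟩
    have h1 : (R - ‖x‖) / (‖B x‖ + 1) * ‖B x‖ ≤ R - ‖x‖ := by
      rw [div_mul_eq_mul_div, div_le_iff₀ (by positivity)]
      nlinarith [norm_nonneg (B x)]
    linarith
  have h1 := hst (x - s • B x) (by
    refine (norm_sub_le _ _).trans ?_
    rwa [norm_smul, Real.norm_of_nonneg hs.le])
  rw [sub_sub_cancel_left, inner_neg_right, inner_smul_right, real_inner_self_eq_norm_sq] at h1
  have : s * ‖B x‖ ^ 2 = 0 := le_antisymm (by linarith) (by positivity)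
  simpa [hs.ne'] using this

end Minty

/-! ### Monotone coercive superposition operators -/

section Operator

variable {α : Type*} [MeasurableSpace α] {W : Type*}
  [NormedAddCommGroup W] [InnerProductSpace ℝ W]
  {μ : Measure α} {Y Z : α → W → ℝ} {f : α → W → W} {a C : ℝ}

/-- The assumptions on a nonlinearity, `Z` standing for the complementary function of `Y`. -/
structure IsFlux (μ : Measure α) (Y Z : α → W → ℝ) (f : α → W → W) (a C : ℝ) : Prop where
  car : IsCaratheodory μ f
  mono : ∀ᵐ x ∂μ, ∀ v₁ v₂ : W, 0 ≤ ⟪f x v₁ - f x v₂, v₁ - v₂⟫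
  zero : ∀ᵐ x ∂μ, f x 0 = 0
  pos : 0 < a
  coer : ∀ᵐ x ∂μ, ∀ v : W, a * (Z x v + Y x (f x v)) - C ≤ ⟪f x v, v⟫

/-- A truncation of `v` that bounds both `v` and `f(v)`; it is again of the form
`v` on some set and zero elsewhere. -/
def goodTrunc (f : α → W → W) (k : ℕ) (v : α → W) : α → W :=
  {x | ‖v x‖ ≤ k ∧ ‖f x (v x)‖ ≤ k}.indicator v

lemma goodTrunc_of_le {k : ℕ} {v : α → W} {x : α} (h : ‖v x‖ ≤ k ∧ ‖f x (v x)‖ ≤ k) :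
    goodTrunc f k v x = v x := by simp [goodTrunc, h]

lemma goodTrunc_of_not_le {k : ℕ} {v : α → W} {x : α} (h : ¬(‖v x‖ ≤ k ∧ ‖f x (v x)‖ ≤ k)) :
    goodTrunc f k v x = 0 :=
  indicator_of_notMem (s := {x | ‖v x‖ ≤ k ∧ ‖f x (v x)‖ ≤ k}) h v

lemma norm_goodTrunc_le (k : ℕ) (v : α → W) (x : α) : ‖goodTrunc f k v x‖ ≤ k := by
  by_cases h : ‖v x‖ ≤ k ∧ ‖f x (v x)‖ ≤ k
  · rw [goodTrunc_of_le h]; exact h.1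
  · simp [goodTrunc_of_not_le h]

lemma eventually_good (f : α → W → W) (v : α → W) (x : α) :
    ∀ᶠ k : ℕ in atTop, ‖v x‖ ≤ k ∧ ‖f x (v x)‖ ≤ k := by
  obtain ⟨K, hK⟩ := exists_nat_ge (max ‖v x‖ ‖f x (v x)‖)
  filter_upwards [eventually_ge_atTop K] with k hk
  have h : (K : ℝ) ≤ k := by exact_mod_cast hk
  exact ⟨((le_max_left _ _).trans hK).trans h, ((le_max_right _ _).trans hK).trans h⟩

/-- Minty's lemma at a point. -/
lemma eq_of_forall_inner_nonneg {φ : W → W} (hφ : Continuous φ) {χ j : W}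
    (h : ∀ z, 0 ≤ ⟪χ - φ z, j - z⟫) : χ = φ j := by
  have key : ∀ w, 0 ≤ ⟪χ - φ j, w⟫ := by
    intro w
    have h1 : Tendsto (fun s : ℝ => ⟪χ - φ (j - s • w), w⟫) (𝓝[>] 0)
        (𝓝 ⟪χ - φ (j - (0 : ℝ) • w), w⟫) := by
      refine Tendsto.mono_left (Continuous.tendsto ?_ 0) nhdsWithin_le_nhds
      fun_prop
    rw [zero_smul, sub_zero] at h1
    refine ge_of_tendsto h1 ?_
    filter_upwards [self_mem_nhdsWithin] with s hs
    have h3 := h (j - s • w)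
    rw [sub_sub_cancel, inner_smul_right] at h3
    exact nonneg_of_mul_nonneg_right h3 hs
  have h2 := key (-(χ - φ j))
  rw [inner_neg_right, real_inner_self_eq_norm_sq] at h2
  have : ‖χ - φ j‖ ^ 2 = 0 := le_antisymm (by linarith) (by positivity)
  simpa [sub_eq_zero] using this

namespace IsFlux

lemma aestronglyMeasurable_goodTrunc (F : IsFlux μ Y Z f a C) {v : α → W}
    (hv : AEStronglyMeasurable v μ) (k : ℕ) : AEStronglyMeasurable (goodTrunc f k v) μ :=
  hv.indicator₀ ((nullMeasurableSet_le hv.norm.aemeasurable aemeasurable_const).inter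
    (nullMeasurableSet_le (F.car.comp hv).norm.aemeasurable aemeasurable_const))

lemma norm_comp_goodTrunc_le (F : IsFlux μ Y Z f a C) (v : α → W) :
    ∀ᵐ x ∂μ, ∀ k : ℕ, ‖f x (goodTrunc f k v x)‖ ≤ k := by
  filter_upwards [F.zero] with x hx k
  by_cases h : ‖v x‖ ≤ k ∧ ‖f x (v x)‖ ≤ k
  · rw [goodTrunc_of_le h]; exact h.2
  · simp [goodTrunc_of_not_le h, hx]

/-- The growth of the nonlinearity. -/
lemma ae_comp_le (P : DualPair μ Y Z) (F : IsFlux μ Y Z f a C) :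
    ∀ᵐ x ∂μ, ∀ v, Y x (f x v) ≤ Z x ((2 / a) • v) + 2 * C / a := by
  have ha := F.pos
  filter_upwards [F.coer, P.young, P.right.nonneg] with x h1 h2 h3 v
  have h4 := (le_abs_self _).trans (h2 ((2 / a) • v) (f x v))
  rw [inner_smul_left, RCLike.conj_to_real, real_inner_comm, div_mul_eq_mul_div,
    div_le_iff₀ ha] at h4
  have h5 := h1 v
  have h6 := mul_nonneg ha.le (h3 v)
  have h7 : a * Y x (f x v) ≤ a * (Z x ((2 / a) • v) + 2 * C / a) := by
    rw [mul_add, mul_div_cancel₀ _ ha.ne']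
    nlinarith
  exact le_of_mul_le_mul_left h7 ha

variable [FiniteDimensional ℝ W] [IsFiniteMeasure μ]

lemma integrable_comp (P : DualPair μ Y Z) (F : IsFlux μ Y Z f a C) {v : α → W}
    (hv : MemE μ Z v) : Integrable (fun x => Y x (f x (v x))) μ := by
  obtain ⟨h1, h2⟩ := P.right.memE_iff.1 hv
  refine P.left.integrable_of_le (F.car.comp h1.1) ((h2 (2 / a)).add (integrable_const (2 * C / a)))
    ?_
  filter_upwards [F.ae_comp_le P] with x hx using hx _

lemma memL_comp (P : DualPair μ Y Z) (F : IsFlux μ Y Z f a C) {v : α → W}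
    (hv : MemE μ Z v) : MemL μ Y (fun x => f x (v x)) :=
  P.left.memL_of_integrable (P.symm.integrable_of_modular
    (F.car.comp (P.right.memE_iff.1 hv).1.1) (F.integrable_comp P hv)) (F.integrable_comp P hv)

lemma norm_inner_goodTrunc_le (F : IsFlux μ Y Z f a C) (χ j : α → W) :
    ∀ᵐ x ∂μ, ∀ k : ℕ, ‖⟪χ x - f x (goodTrunc f k j x), j x - goodTrunc f k j x⟫‖ ≤
      ‖⟪χ x, j x⟫‖ := by
  filter_upwards [F.zero] with x hx k
  by_cases h : ‖j x‖ ≤ k ∧ ‖f x (j x)‖ ≤ k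
  · simp [goodTrunc_of_le h]
  · simp [goodTrunc_of_not_le h, hx]

lemma integrable_inner_goodTrunc (F : IsFlux μ Y Z f a C) {χ j : α → W}
    (hj : AEStronglyMeasurable j μ) (hi : Integrable (fun x => ⟪χ x, j x⟫) μ)
    (hχ : AEStronglyMeasurable χ μ) (k : ℕ) :
    Integrable (fun x => ⟪χ x - f x (goodTrunc f k j x), j x - goodTrunc f k j x⟫) μ := by
  have hm := F.aestronglyMeasurable_goodTrunc hj k
  refine hi.norm.mono' ((hχ.sub (F.car.comp hm)).inner (hj.sub hm)) ?_
  filter_upwards [F.norm_inner_goodTrunc_le χ j] with x hx using hx k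

lemma tendsto_goodTrunc (F : IsFlux μ Y Z f a C) {χ j : α → W}
    (hj : AEStronglyMeasurable j μ) (hi : Integrable (fun x => ⟪χ x, j x⟫) μ)
    (hχ : AEStronglyMeasurable χ μ) :
    Tendsto (fun k => ∫ x, ⟪χ x - f x (goodTrunc f k j x), j x - goodTrunc f k j x⟫ ∂μ) atTop
      (𝓝 0) := by
  have := tendsto_integral_of_dominated_convergence (μ := μ)
    (F := fun (k : ℕ) x => ⟪χ x - f x (goodTrunc f k j x), j x - goodTrunc f k j x⟫)
    (f := fun _ => (0 : ℝ)) (fun x => ‖⟪χ x, j x⟫‖)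
    (fun k => (F.integrable_inner_goodTrunc hj hi hχ k).1) hi.norm (fun k => ?_) ?_
  · simpa using this
  · filter_upwards [F.norm_inner_goodTrunc_le χ j] with x hx using hx k
  · refine ae_of_all _ fun x => Tendsto.congr' ?_ tendsto_const_nhds
    filter_upwards [eventually_good f j x] with k hk
    simp [goodTrunc_of_le hk]

/-- Minty's lemma: testing with bounded functions `v` for which `f(v)` is bounded too
suffices to identify `χ` with `f(j)`. -/
theorem eq_comp_of_minty (F : IsFlux μ Y Z f a C) {χ j : α → W} (hχ : Integrable χ μ)
    (hj : Integrable j μ) (hi : Integrable (fun x => ⟪χ x, j x⟫) μ)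
    (h : ∀ (v : α → W) (R : ℝ), AEStronglyMeasurable v μ → (∀ᵐ x ∂μ, ‖v x‖ ≤ R) →
      (∀ᵐ x ∂μ, ‖f x (v x)‖ ≤ R) → 0 ≤ ∫ x, ⟪χ x - f x (v x), j x - v x⟫ ∂μ) :
    ∀ᵐ x ∂μ, χ x = f x (j x) := by
  have hfj := F.car.comp hj.1
  have key : ∀ (z : W) (m : ℕ), ∀ᵐ x ∂μ,
      ‖j x‖ ≤ m ∧ ‖f x (j x)‖ ≤ m ∧ ‖f x z‖ ≤ m → 0 ≤ ⟪χ x - f x z, j x - z⟫ := by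
    intro z m
    set G : Set α := {x | ‖j x‖ ≤ m ∧ ‖f x (j x)‖ ≤ m ∧ ‖f x z‖ ≤ m}
    have hG : NullMeasurableSet G μ :=
      (nullMeasurableSet_le hj.1.norm.aemeasurable aemeasurable_const).inter
        ((nullMeasurableSet_le hfj.norm.aemeasurable aemeasurable_const).inter
        (nullMeasurableSet_le (F.car.measurable z).norm.aemeasurable aemeasurable_const))
    -- `q` is integrable: `⟪χ, j⟫` is, and in the other terms one factor is bounded on `G`
    set q : α → ℝ := G.indicator fun x => ⟪χ x - f x z, j x - z⟫
    have hq : Integrable q μ := by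
      have h1 : q = fun x => G.indicator (fun x => ⟪χ x, j x⟫) x - ⟪χ x, G.indicator (fun _ => z) x⟫ -
          ⟪j x, G.indicator (fun x => f x z) x⟫ + ⟪G.indicator (fun x => f x z) x, z⟫ := by
        funext x
        by_cases hx : x ∈ G
        · simp only [q, indicator_of_mem hx, inner_sub_left, inner_sub_right,
            real_inner_comm (j x)]
          ring
        · simp [q, indicator_of_notMem hx]
      have h2 : AEStronglyMeasurable (G.indicator fun x => f x z) μ :=
        (F.car.measurable z).indicator₀ hG
      have h3 : ∀ᵐ x ∂μ, ‖G.indicator (fun x => f x z) x‖ ≤ m := ae_of_all _ fun x => by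
        by_cases hx : x ∈ G
        · rw [indicator_of_mem hx]; exact hx.2.2
        · simp [indicator_of_notMem hx]
      rw [h1]
      refine (((hi.indicator₀ hG).sub (DualPair.integrable_inner_bounded hχ
        (aestronglyMeasurable_const.indicator₀ hG) (R := ‖z‖) ?_)).sub
        (DualPair.integrable_inner_bounded hj h2 h3)).add
        (((memLp_top_of_bound h2 m h3).integrable le_top).inner_const z)
      exact ae_of_all _ fun x => norm_indicator_le_norm_self _ _
    have hq0 : 0 ≤ᵐ[μ] q := by
      refine ae_nonneg_of_forall_setIntegral_nonneg hq fun B hB _ => ?_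
      -- test with `z` on `B ∩ G` and with a truncation of `j` elsewhere
      let v : ℕ → α → W := fun k x =>
        (B ∩ G).indicator (fun _ => z) x + (B ∩ G)ᶜ.indicator (goodTrunc f k j) x
      have hBG : NullMeasurableSet (B ∩ G) μ := hB.nullMeasurableSet.inter hG
      have hvin : ∀ k x, x ∈ B ∩ G → v k x = z := fun k x hx => by simp [v, hx]
      have hvout : ∀ k x, x ∉ B ∩ G → v k x = goodTrunc f k j x := fun k x hx => by simp [v, hx]
      have hvm : ∀ k, AEStronglyMeasurable (v k) μ := fun k =>
        (aestronglyMeasurable_const.indicator₀ hBG).add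
          ((F.aestronglyMeasurable_goodTrunc hj.1 k).indicator₀ hBG.compl)
      have hnn : ∀ k, 0 ≤ ∫ x, ⟪χ x - f x (v k x), j x - v k x⟫ ∂μ := by
        intro k
        refine h (v k) (max (max k m) ‖z‖) (hvm k) (ae_of_all _ fun x => ?_) ?_
        · by_cases hx : x ∈ B ∩ G
          · rw [hvin k x hx]; exact le_max_right _ _
          · rw [hvout k x hx]
            exact (norm_goodTrunc_le k j x).trans ((le_max_left _ _).trans (le_max_left _ _))
        · filter_upwards [F.norm_comp_goodTrunc_le j] with x h1
          by_cases hx : x ∈ B ∩ G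
          · rw [hvin k x hx]
            exact hx.2.2.2.trans ((le_max_right _ _).trans (le_max_left _ _))
          · rw [hvout k x hx]
            exact (h1 k).trans ((le_max_left _ _).trans (le_max_left _ _))
      have heq : ∀ k ≥ m, ∀ x, ⟪χ x - f x (v k x), j x - v k x⟫ = B.indicator q x +
          ⟪χ x - f x (goodTrunc f k j x), j x - goodTrunc f k j x⟫ := by
        intro k hk x
        by_cases hx : x ∈ B ∩ G
        · have hkm : (m : ℝ) ≤ k := by exact_mod_cast hk
          have h1 : goodTrunc f k j x = j x :=
            goodTrunc_of_le ⟨hx.2.1.trans hkm, hx.2.2.1.trans hkm⟩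
          rw [hvin k x hx, indicator_of_mem hx.1, h1]
          simp [q, indicator_of_mem hx.2]
        · rw [hvout k x hx]
          have : B.indicator q x = 0 := by
            by_cases hxB : x ∈ B
            · have hxG : x ∉ G := fun hxG => hx ⟨hxB, hxG⟩
              simp [q, indicator_of_mem hxB, indicator_of_notMem hxG]
            · exact indicator_of_notMem hxB _
          rw [this, zero_add]
      have hlim := (F.tendsto_goodTrunc hj.1 hi hχ.1).const_add (∫ x in B, q x ∂μ)
      rw [add_zero] at hlim
      refine ge_of_tendsto hlim ?_
      filter_upwards [eventually_ge_atTop m] with k hk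
      have h1 := hnn k
      simp only [heq k hk] at h1
      rw [integral_add (hq.indicator hB), integral_indicator hB] at h1
      · exact h1
      · exact F.integrable_inner_goodTrunc hj.1 hi hχ.1 k
    filter_upwards [hq0] with x hx hxG
    simpa [q, indicator_of_mem (show x ∈ G from hxG)] using hx
  have hall : ∀ᵐ x ∂μ, ∀ n m : ℕ, ‖j x‖ ≤ m ∧ ‖f x (j x)‖ ≤ m ∧
      ‖f x (TopologicalSpace.denseSeq W n)‖ ≤ m →
        0 ≤ ⟪χ x - f x (TopologicalSpace.denseSeq W n), j x - TopologicalSpace.denseSeq W n⟫ :=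
    ae_all_iff.2 fun n => ae_all_iff.2 fun m => key _ m
  filter_upwards [hall, F.car.continuous] with x hx hc
  refine eq_of_forall_inner_nonneg hc fun z => ?_
  have hcl : IsClosed {z | 0 ≤ ⟪χ x - f x z, j x - z⟫} :=
    isClosed_le continuous_const (by fun_prop)
  refine hcl.closure_subset_iff.2 ?_ (TopologicalSpace.denseRange_denseSeq W z)
  rintro _ ⟨n, rfl⟩
  obtain ⟨m, hm⟩ := exists_nat_ge
    (max (max ‖j x‖ ‖f x (j x)‖) ‖f x (TopologicalSpace.denseSeq W n)‖)
  exact hx n m ⟨((le_max_left _ _).trans (le_max_left _ _)).trans hm,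
    ((le_max_right _ _).trans (le_max_left _ _)).trans hm, (le_max_right _ _).trans hm⟩

end IsFlux

end Operator

/-! ### Galerkin approximation -/

/-- Approximate zeros of a monotone map `A` from a vector space to its algebraic dual. A multiple of
the identity on coefficient vectors is added to `A`, so that no linear independence of the test
vectors is needed. -/
lemma exists_approx_zero {V : Type*} [AddCommGroup V] [Module ℝ V] (A : V → V →ₗ[ℝ] ℝ)
    (hmono : ∀ p q, 0 ≤ A p (p - q) - A q (p - q))
    (hcont : ∀ (s : Finset V) (q : V),
      Continuous fun c : EuclideanSpace ℝ s => A (∑ k, c k • (k : V)) q)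
    {M : ℝ} (hM : ∀ p, -M ≤ A p p) (s : Finset V) {ε : ℝ} (hε : 0 < ε) :
    ∃ p, A p p ≤ 0 ∧ ∀ k ∈ s, |A p k| ≤ ε := by
  classical
  have hM0 : 0 ≤ M := by simpa using hM 0
  -- a zero `c` of `A + δ` satisfies `δ ‖c‖² ≤ M`, so that `|A p k| ≤ δ ‖c‖ ≤ √(δ M) ≤ ε`
  set δ : ℝ := ε ^ 2 / (M + 1)
  have hδ : 0 < δ := by positivity
  let L : EuclideanSpace ℝ s → V := fun c => ∑ k, c k • (k : V)
  have hLsub : ∀ c d, L (c - d) = L c - L d := fun c d => by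
    simp [L, sub_smul, Finset.sum_sub_distrib]
  let B : EuclideanSpace ℝ s → EuclideanSpace ℝ s := fun c =>
    (WithLp.toLp 2 (fun k : s => A (L c) (k : V)) : EuclideanSpace ℝ s) + δ • c
  have hinner : ∀ c d, ⟪B c, d⟫ = A (L c) (L d) + δ * ⟪c, d⟫ := by
    intro c d
    simp only [B, inner_add_left, inner_smul_left, RCLike.conj_to_real]
    congr 1
    simp [L, PiLp.inner_apply]
  have hBmono : ∀ c d, 0 ≤ ⟪B c - B d, c - d⟫ := by
    intro c d
    have h1 := hmono (L c) (L d)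
    have h2 : 0 ≤ δ * ⟪c - d, c - d⟫ := mul_nonneg hδ.le real_inner_self_nonneg
    rw [inner_sub_left] at h2
    rw [inner_sub_left, hinner, hinner, hLsub]
    linarith
  have hBcont : Continuous B := by
    refine Continuous.add (f := fun c => (WithLp.toLp 2 (fun k : s => A (L c) (k : V)) :
      EuclideanSpace ℝ s)) ?_ (continuous_const_smul δ)
    exact (PiLp.continuous_toLp 2 _).comp (continuous_pi fun k => hcont s k)
  obtain ⟨R, hR, hRM⟩ : ∃ R : ℝ, 0 < R ∧ M < δ * R ^ 2 := by
    refine ⟨(M + 1) / δ + 1, by positivity, ?_⟩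
    have h1 : M + 1 < δ * ((M + 1) / δ + 1) := by
      rw [mul_add, mul_div_cancel₀ _ hδ.ne']; linarith
    have h2 : 1 ≤ (M + 1) / δ + 1 := by
      have : 0 < (M + 1) / δ := by positivity
      linarith
    nlinarith
  obtain ⟨c, hc⟩ := exists_zero_of_monotone hBmono hBcont hR fun c hcR => by
    rw [hinner, real_inner_self_eq_norm_sq, hcR]
    linarith [hM (L c)]
  have h1 := hinner c c
  rw [hc, inner_zero_left, real_inner_self_eq_norm_sq] at h1
  have h2 : 0 ≤ δ * ‖c‖ ^ 2 := by positivity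
  refine ⟨L c, by linarith, fun k hk => ?_⟩
  have h3 : A (L c) k = -(δ * c ⟨k, hk⟩) := by
    have := congrArg (fun d : EuclideanSpace ℝ s => d ⟨k, hk⟩) hc
    simp [B] at this
    linarith
  have h4 : |c ⟨k, hk⟩| ≤ ‖c‖ := PiLp.norm_apply_le c ⟨k, hk⟩
  rw [h3, abs_neg, abs_mul, abs_of_pos hδ]
  refine le_trans (mul_le_mul_of_nonneg_left h4 hδ.le) ?_
  refine le_of_sq_le_sq ?_ hε.le
  have h5 : δ * ‖c‖ ^ 2 ≤ M := by linarith [hM (L c)]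
  have h6 : δ * (M + 1) = ε ^ 2 := div_mul_cancel₀ _ (by positivity)
  calc (δ * ‖c‖) ^ 2 = δ * (δ * ‖c‖ ^ 2) := by ring
    _ ≤ δ * M := by gcongr
    _ ≤ ε ^ 2 := by linarith

section Single

variable {α : Type*} [MeasurableSpace α] {W : Type*}
  [NormedAddCommGroup W] [InnerProductSpace ℝ W] [FiniteDimensional ℝ W]
  {μ : Measure α} [IsFiniteMeasure μ] {Y Z : α → W → ℝ} {f : α → W → W} {a C : ℝ}

lemma WeakStarLim.flip {I : Type*} {l : Filter I} {v : I → α → W} {v' : α → W}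
    (h : WeakStarLim μ Y l v v') {u : α → W} (hu : MemE μ Y u) :
    Tendsto (fun i => ∫ x, ⟪u x, v i x⟫ ∂μ) l (𝓝 (∫ x, ⟪u x, v' x⟫ ∂μ)) := by
  have h1 := h u hu
  simp_rw [real_inner_comm (u _)] at h1
  exact h1

lemma DualPair.integral_inner_sub_sub (P : DualPair μ Y Z) {b₁ b₂ c₁ c₂ : α → W}
    (h1 : MemL μ Y b₁) (h2 : MemL μ Y b₂) (h3 : MemL μ Z c₁) (h4 : MemL μ Z c₂) :
    ∫ x, ⟪b₁ x - b₂ x, c₁ x - c₂ x⟫ ∂μ = ∫ x, ⟪b₁ x, c₁ x⟫ ∂μ - ∫ x, ⟪b₁ x, c₂ x⟫ ∂μ -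
      (∫ x, ⟪b₂ x, c₁ x⟫ ∂μ - ∫ x, ⟪b₂ x, c₂ x⟫ ∂μ) := by
  have Q := P.symm
  have h5 : Integrable (fun x => ⟪b₁ x, c₁ x⟫ - ⟪b₂ x, c₁ x⟫) μ :=
    (Q.integrable_inner_memL h1 h3).sub (Q.integrable_inner_memL h2 h3)
  have h6 : Integrable (fun x => ⟪b₁ x, c₂ x⟫ - ⟪b₂ x, c₂ x⟫) μ :=
    (Q.integrable_inner_memL h1 h4).sub (Q.integrable_inner_memL h2 h4)
  simp only [inner_sub_left, inner_sub_right]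
  rw [integral_sub h5 h6,
    integral_sub (Q.integrable_inner_memL h1 h3) (Q.integrable_inner_memL h2 h3),
    integral_sub (Q.integrable_inner_memL h1 h4) (Q.integrable_inner_memL h2 h4)]
  ring

namespace IsFlux

/-- The energy estimate: the operator, tested with `j - j₀`, controls the modulars of `j` and of
`f(j)`. -/
lemma exists_energy_bound (P : DualPair μ Y Z) (F : IsFlux μ Y Z f a C) {j₀ G₀ : α → W}
    (hj₀ : MemE μ Z j₀) (hG₀ : MemE μ Y G₀) :
    ∃ M : ℝ, ∀ j, MemE μ Z j → (a / 2) * (∫ x, Z x (j x) ∂μ + ∫ x, Y x (f x (j x)) ∂μ) ≤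
      ∫ x, ⟪f x (j x) - G₀ x, j x - j₀ x⟫ ∂μ + M := by
  have ha := F.pos
  have h1 := (P.right.memE_iff.1 hj₀).2 (2 / a)
  have h2 := (P.left.memE_iff.1 hG₀).2 (2 / a)
  have h3 := P.symm.integrable_inner_memL hG₀.1 hj₀.1
  set r : α → ℝ := fun x => C + (a / 2) * Z x ((2 / a) • j₀ x) + (a / 2) * Y x ((2 / a) • G₀ x) -
    ⟪G₀ x, j₀ x⟫
  have hr : Integrable r μ :=
    (((integrable_const C).add (h1.const_mul _)).add (h2.const_mul _)).sub h3
  refine ⟨∫ x, r x ∂μ, fun j hj => ?_⟩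
  have h4 : Integrable (fun x => Z x (j x)) μ := by simpa using (P.right.memE_iff.1 hj).2 1
  have h5 := F.integrable_comp P hj
  have h6 : Integrable (fun x => ⟪f x (j x) - G₀ x, j x - j₀ x⟫) μ :=
    P.symm.integrable_inner_memL (P.left.memL_sub (F.memL_comp P hj) hG₀.1)
      (P.right.memL_sub hj.1 hj₀.1)
  rw [← integral_add h4 h5, ← integral_const_mul, ← integral_add h6 hr]
  refine integral_mono_ae ((h4.add h5).const_mul _) (h6.add hr) ?_
  filter_upwards [F.coer, P.young] with x hc hy
  have h7 := (le_abs_self _).trans (hy ((2 / a) • j₀ x) (f x (j x)))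
  have h8 := (le_abs_self _).trans (hy (j x) ((2 / a) • G₀ x))
  have h9 := hc (j x)
  rw [inner_smul_left, RCLike.conj_to_real, real_inner_comm, div_mul_eq_mul_div,
    div_le_iff₀ ha] at h7
  rw [inner_smul_right, real_inner_comm, div_mul_eq_mul_div, div_le_iff₀ ha] at h8
  simp only [r, inner_sub_left, inner_sub_right]
  linarith

/-- Continuity of the operator on finite-dimensional subspaces. -/
lemma continuous_integral_comp (P : DualPair μ Y Z) (F : IsFlux μ Y Z f a C) {ι : Type*}
    [Fintype ι] {j₀ G₀ σ : α → W} {τ : ι → α → W} (hj₀ : MemE μ Z j₀) (hG₀ : MemE μ Y G₀)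
    (hτ : ∀ k, MemE μ Z (τ k)) (hσ : MemE μ Z σ) :
    Continuous fun c : EuclideanSpace ℝ ι =>
      ∫ x, ⟪f x (j₀ x + ∑ k, c k • τ k x) - G₀ x, σ x⟫ ∂μ := by
  have ha := F.pos
  have hZ := P.right
  have hsum : ∀ c : EuclideanSpace ℝ ι, MemE μ Z (fun x => j₀ x + ∑ k, c k • τ k x) := fun c =>
    hZ.memE_add hj₀ (hZ.memE_sum _ fun k _ => hZ.memE_smul (hτ k) (c k))
  have hint := fun c => P.symm.integrable_inner_memL (P.left.memL_sub (F.memL_comp P (hsum c)) hG₀.1)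
      hσ.1
  refine continuous_iff_continuousAt.2 fun c₀ => ?_
  -- for `c` in the unit ball around `c₀` the growth of `f` gives an integrable majorant
  set R := ‖c₀‖ + 1
  set n : ℝ := ((Finset.univ : Finset ι).card : ℝ)
  have hbi : Integrable (fun x => (Z x ((4 / a) • j₀ x) + ∑ k, Z x ((n * (4 / a) * R) • τ k x) +
      2 * C / a) + Z x (σ x) + ‖⟪G₀ x, σ x⟫‖) μ := by
    refine ((((hZ.memE_iff.1 hj₀).2 _).add (integrable_finsetSum _ fun k _ =>
      (hZ.memE_iff.1 (hτ k)).2 _)).add (integrable_const _)).add ?_ |>.add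
      (P.symm.integrable_inner_memL hG₀.1 hσ.1).norm
    simpa using (hZ.memE_iff.1 hσ).2 1
  refine continuousAt_of_dominated (Eventually.of_forall fun c => (hint c).1) ?_ hbi ?_
  · filter_upwards [Metric.ball_mem_nhds c₀ one_pos] with c hc
    have hcR : ‖c‖ ≤ R := by
      have := norm_sub_norm_le c c₀
      rw [Metric.mem_ball, dist_eq_norm] at hc
      simp only [R]
      linarith
    filter_upwards [F.ae_comp_le P, P.young, hZ.ae_add_le, hZ.convex, hZ.nonneg, hZ.ae_smul_mono,
      hZ.zero] with x h1 h2 h3 h4 h5 h6 h7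
    set v := j₀ x + ∑ k, c k • τ k x
    have h8 : Z x ((2 : ℝ) • (2 / a) • ∑ k, c k • τ k x) ≤
        ∑ k, Z x ((n * (4 / a) * R) • τ k x) := by
      rcases (Finset.univ : Finset ι).eq_empty_or_nonempty with he | he
      · simp [he, h7]
      · have h9 := convex_sum_le h4 h5 Finset.univ (fun k => ((2 * (2 / a)) * c k) • τ k x) he
        have h10 : (2 : ℝ) • (2 / a) • ∑ k, c k • τ k x =
            ∑ k, ((2 * (2 / a)) * c k) • τ k x := by
          rw [smul_smul, Finset.smul_sum]
          simp only [smul_smul]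
        rw [h10]
        refine h9.trans (Finset.sum_le_sum fun k _ => ?_)
        rw [smul_smul]
        refine h6 _ _ ?_ _
        have h11 : |c k| ≤ |R| := ((PiLp.norm_apply_le c k).trans hcR).trans (le_abs_self R)
        have h12 : 2 * (2 / a) = 4 / a := by ring
        rw [h12, ← mul_assoc, abs_mul, abs_mul (n * (4 / a))]
        gcongr
    have h13 := h3 ((2 / a) • j₀ x) ((2 / a) • ∑ k, c k • τ k x)
    rw [← smul_add] at h13
    have h14 : (2 : ℝ) • (2 / a) • j₀ x = (4 / a) • j₀ x := by
      rw [smul_smul]; congr 1; ring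
    rw [h14] at h13
    have h15 := h1 v
    have h16 := h2 (σ x) (f x v)
    rw [real_inner_comm] at h16
    have h17 := h5 ((4 / a) • j₀ x)
    have h18 : 0 ≤ ∑ k, Z x ((n * (4 / a) * R) • τ k x) := Finset.sum_nonneg fun k _ => h5 _
    rw [inner_sub_left]
    refine (norm_sub_le _ _).trans (add_le_add_left ?_ _)
    rw [Real.norm_eq_abs]
    linarith
  · filter_upwards [F.car.continuous] with x hx
    refine Continuous.continuousAt ?_
    have : Continuous fun c : EuclideanSpace ℝ ι => j₀ x + ∑ k, c k • τ k x := by fun_prop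
    fun_prop

end IsFlux

end Single

section Pair

universe u v u' v'

variable {α : Type u} [MeasurableSpace α] {W : Type v}
  [NormedAddCommGroup W] [InnerProductSpace ℝ W] [FiniteDimensional ℝ W]
  {μ : Measure α} [IsFiniteMeasure μ] {Y Z : α → W → ℝ} {f : α → W → W} {a C : ℝ}
  {β : Type u'} [MeasurableSpace β] {W' : Type v'}
  [NormedAddCommGroup W'] [InnerProductSpace ℝ W'] [FiniteDimensional ℝ W']
  {ν : Measure β} [IsFiniteMeasure ν] {Y' Z' : β → W' → ℝ} {g : β → W' → W'} {a' C' : ℝ}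

/-- The functional `(τ, t) ↦ ∫ χ · τ + ∫ γ · t` on a space of pairs of functions. -/
lemma exists_pairing (P : DualPair μ Y Z) (P' : DualPair ν Y' Z')
    (S : Submodule ℝ ((α → W) × (β → W'))) (hS : ∀ p ∈ S, MemE μ Z p.1 ∧ MemE ν Z' p.2)
    {χ : α → W} {γ : β → W'} (hχ : MemL μ Y χ) (hγ : MemL ν Y' γ) :
    ∃ ℓ : S →ₗ[ℝ] ℝ, ∀ q : S, ℓ q = ∫ x, ⟪χ x, q.1.1 x⟫ ∂μ + ∫ x, ⟪γ x, q.1.2 x⟫ ∂ν := by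
  have h1 : ∀ q : S, Integrable (fun x => ⟪χ x, q.1.1 x⟫) μ := fun q =>
    P.symm.integrable_inner_memL hχ (hS q q.2).1.1
  have h2 : ∀ q : S, Integrable (fun x => ⟪γ x, q.1.2 x⟫) ν := fun q =>
    P'.symm.integrable_inner_memL hγ (hS q q.2).2.1
  refine ⟨{ toFun := fun q => ∫ x, ⟪χ x, q.1.1 x⟫ ∂μ + ∫ x, ⟪γ x, q.1.2 x⟫ ∂ν
            map_add' := fun p q => ?_
            map_smul' := fun r q => ?_ }, fun q => rfl⟩
  · simp only [Submodule.coe_add, Prod.fst_add, Prod.snd_add, Pi.add_apply, inner_add_right]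
    rw [integral_add (h1 p) (h1 q), integral_add (h2 p) (h2 q)]
    ring
  · simp only [Submodule.coe_smul, Prod.smul_fst, Prod.smul_snd, Pi.smul_apply, inner_smul_right,
      integral_const_mul, RingHom.id_apply, smul_eq_mul]
    ring

/-- Solutions of the Galerkin equations on a space `S` of test pairs converge, along a sequence
in `S`, to a pair `(j - j₀, t)`; the nonlinear terms converge to `(χ, γ)`. The pair `(χ, γ)` solves
the limit equation for test pairs in `S`, and equals `(f(j), g(t))` as soon as `(j - j₀, t)` is
admissible in the limit equation. -/
theorem exists_monotone_limit [IsSeparable μ] [IsSeparable ν]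
    (P : DualPair μ Y Z) (P' : DualPair ν Y' Z')
    (F : IsFlux μ Y Z f a C) (F' : IsFlux ν Y' Z' g a' C')
    (S : Submodule ℝ ((α → W) × (β → W'))) (hS : ∀ p ∈ S, MemE μ Z p.1 ∧ MemE ν Z' p.2)
    {j₀ G₀ : α → W} (hj₀ : MemE μ Z j₀) (hG₀ : MemE μ Y G₀) :
    ∃ (j χ : α → W) (t γ : β → W'), MemL μ Z j ∧ MemL ν Z' t ∧ MemL μ Y χ ∧ MemL ν Y' γ ∧
      (∃ q : ℕ → S, WeakStarTendsto μ Y (fun n => (q n).1.1) (fun x => j x - j₀ x) ∧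
        WeakStarTendsto ν Y' (fun n => (q n).1.2) t) ∧
      (∀ q ∈ S, ∫ x, ⟪χ x - G₀ x, q.1 x⟫ ∂μ + ∫ x, ⟪γ x, q.2 x⟫ ∂ν = 0) ∧
      (∫ x, ⟪χ x - G₀ x, j x - j₀ x⟫ ∂μ + ∫ x, ⟪γ x, t x⟫ ∂ν = 0 →
        (∀ᵐ x ∂μ, χ x = f x (j x)) ∧ ∀ᵐ x ∂ν, γ x = g x (t x)) := by
  classical
  have ha := F.pos
  have ha' := F'.pos
  have hjE : ∀ p : S, MemE μ Z (fun x => j₀ x + p.1.1 x) := fun p =>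
    P.right.memE_add hj₀ (hS p p.2).1
  have htE : ∀ p : S, MemE ν Z' p.1.2 := fun p => (hS p p.2).2
  have hfL : ∀ p : S, MemL μ Y (fun x => f x (j₀ x + p.1.1 x)) := fun p => F.memL_comp P (hjE p)
  have hgL : ∀ p : S, MemL ν Y' (fun x => g x (p.1.2 x)) := fun p => F'.memL_comp P' (htE p)
  choose A hA using fun p : S => exists_pairing P P' S hS (P.left.memL_sub (hfL p) hG₀.1) (hgL p)
  -- the Galerkin solutions
  obtain ⟨M₁, hM₁⟩ := F.exists_energy_bound P hj₀ hG₀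
  obtain ⟨M₂, hM₂⟩ := F'.exists_energy_bound P' P'.right.memE_zero P'.left.memE_zero
  have henergy : ∀ p : S, (a / 2) * (∫ x, Z x (j₀ x + p.1.1 x) ∂μ +
      ∫ x, Y x (f x (j₀ x + p.1.1 x)) ∂μ) + (a' / 2) * (∫ x, Z' x (p.1.2 x) ∂ν +
      ∫ x, Y' x (g x (p.1.2 x)) ∂ν) ≤ A p p + (M₁ + M₂) := by
    intro p
    have h1 := hM₁ _ (hjE p)
    have h2 := hM₂ _ (htE p)
    simp only [add_sub_cancel_left, sub_zero] at h1 h2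
    rw [hA]
    linarith
  have hZ0 : ∀ p : S, 0 ≤ ∫ x, Z x (j₀ x + p.1.1 x) ∂μ := fun p => P.right.integral_nonneg _
  have hY0 : ∀ p : S, 0 ≤ ∫ x, Y x (f x (j₀ x + p.1.1 x)) ∂μ := fun p => P.left.integral_nonneg _
  have hZ0' : ∀ p : S, 0 ≤ ∫ x, Z' x (p.1.2 x) ∂ν := fun p => P'.right.integral_nonneg _
  have hY0' : ∀ p : S, 0 ≤ ∫ x, Y' x (g x (p.1.2 x)) ∂ν := fun p => P'.left.integral_nonneg _
  have hsolve : ∀ i : Finset S × ℕ, ∃ p : S, A p p ≤ 0 ∧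
      ∀ k ∈ i.1, |A p k| ≤ 1 / ((i.2 : ℝ) + 1) := by
    intro i
    refine exists_approx_zero A (fun p q => ?_) (fun s q => ?_) (M := M₁ + M₂) (fun p => ?_) i.1
      (by positivity)
    · rw [hA, hA, add_sub_add_comm]
      have hp := (hS _ (p - q).2).1.1
      have hq := (hS _ (p - q).2).2.1
      rw [← integral_sub (P.symm.integrable_inner_memL (P.left.memL_sub (hfL p) hG₀.1) hp)
        (P.symm.integrable_inner_memL (P.left.memL_sub (hfL q) hG₀.1) hp),
        ← integral_sub (P'.symm.integrable_inner_memL (hgL p) hq)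
        (P'.symm.integrable_inner_memL (hgL q) hq)]
      refine add_nonneg (integral_nonneg_of_ae ?_) (integral_nonneg_of_ae ?_)
      · filter_upwards [F.mono] with x hx
        have := hx (j₀ x + p.1.1 x) (j₀ x + q.1.1 x)
        simp only [← inner_sub_left]
        simpa using this
      · filter_upwards [F'.mono] with x hx
        have := hx (p.1.2 x) (q.1.2 x)
        simp only [← inner_sub_left]
        simpa using this
    · simp only [hA]
      have h1 := F.continuous_integral_comp P (ι := s) (τ := fun k => (k : S).1.1) hj₀ hG₀
        (fun k => (hS _ (k : S).2).1) (hS q q.2).1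
      have h2 := F'.continuous_integral_comp P' (ι := s) (τ := fun k => (k : S).1.2)
        P'.right.memE_zero P'.left.memE_zero (fun k => (hS _ (k : S).2).2) (hS q q.2).2
      refine (h1.add h2).congr fun c => ?_
      simp [Finset.sum_apply, Prod.fst_sum, Prod.snd_sum]
    · have h1 := henergy p
      have h2 := mul_nonneg (half_pos ha).le (add_nonneg (hZ0 p) (hY0 p))
      have h3 := mul_nonneg (half_pos ha').le (add_nonneg (hZ0' p) (hY0' p))
      linarith
  choose p hp0 hpk using hsolve
  -- weak-star limits
  have hb : ∀ i, ∫ x, Z x (j₀ x + (p i).1.1 x) ∂μ ≤ (M₁ + M₂) / (a / 2) ∧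
      ∫ x, Y x (f x (j₀ x + (p i).1.1 x)) ∂μ ≤ (M₁ + M₂) / (a / 2) ∧
      ∫ x, Z' x ((p i).1.2 x) ∂ν ≤ (M₁ + M₂) / (a' / 2) ∧
      ∫ x, Y' x (g x ((p i).1.2 x)) ∂ν ≤ (M₁ + M₂) / (a' / 2) := by
    intro i
    have h1 := henergy (p i)
    have h2 := hp0 i
    have h3 := mul_nonneg (half_pos ha).le (hZ0 (p i))
    have h4 := mul_nonneg (half_pos ha).le (hY0 (p i))
    have h5 := mul_nonneg (half_pos ha').le (hZ0' (p i))
    have h6 := mul_nonneg (half_pos ha').le (hY0' (p i))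
    rw [mul_add, mul_add] at h1
    refine ⟨?_, ?_, ?_, ?_⟩ <;> rw [le_div_iff₀' (by positivity)] <;> linarith
  have hjm := fun i => (P.right.memE_iff.1 (hjE (p i))).1.1
  have htm := fun i => (P'.right.memE_iff.1 (htE (p i))).1.1
  have hjZ : ∀ i, Integrable (fun x => Z x (j₀ x + (p i).1.1 x)) μ := fun i => by
    simpa using (P.right.memE_iff.1 (hjE (p i))).2 1
  have htZ : ∀ i, Integrable (fun x => Z' x ((p i).1.2 x)) ν := fun i => by
    simpa using (P'.right.memE_iff.1 (htE (p i))).2 1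
  let U : Ultrafilter (Finset S × ℕ) := Ultrafilter.of atTop
  have hU : (U : Filter (Finset S × ℕ)) ≤ atTop := Ultrafilter.of_le _
  obtain ⟨j, hj1, hj2, -, hjlim⟩ := P.exists_weakStarLim U hjm hjZ fun i => (hb i).1
  obtain ⟨χ, hχ1, hχ2, -, hχlim⟩ := P.symm.exists_weakStarLim U (fun i => F.car.comp (hjm i))
    (fun i => F.integrable_comp P (hjE (p i))) fun i => (hb i).2.1
  obtain ⟨t, ht1, ht2, -, htlim⟩ := P'.exists_weakStarLim U htm htZ fun i => (hb i).2.2.1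
  obtain ⟨γ, hγ1, hγ2, -, hγlim⟩ := P'.symm.exists_weakStarLim U (fun i => F'.car.comp (htm i))
    (fun i => F'.integrable_comp P' (htE (p i))) fun i => (hb i).2.2.2
  have hjL := P.right.memL_of_integrable hj1 hj2
  have hχL := P.left.memL_of_integrable hχ1 hχ2
  have htL := P'.right.memL_of_integrable ht1 ht2
  have hγL := P'.left.memL_of_integrable hγ1 hγ2
  refine ⟨j, χ, t, γ, hjL, htL, hχL, hγL, ?_, ?_, ?_⟩
  · obtain ⟨i, hi1, hi2⟩ := exists_seq_weakStarTendsto P P' hjm hjZ htm htZ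
      (fun i => (hb i).1) (fun i => (hb i).2.2.1) hjL htL hjlim htlim
    refine ⟨fun n => p (i n), fun u hu => ?_, hi2⟩
    have h1 := P.integrable_inner_memL hj₀.1 hu.1
    have h2 := (hi1 u hu).sub_const (∫ x, ⟪j₀ x, u x⟫ ∂μ)
    rw [← integral_sub (P.integrable_inner_memL hjL hu.1) h1] at h2
    simp only [← inner_sub_left] at h2
    refine h2.congr fun n => ?_
    rw [← integral_sub (P.integrable_inner_memL (hjE _).1 hu.1) h1]
    simp only [← inner_sub_left, add_sub_cancel_left]
  · intro q hq
    have h1 : Tendsto (fun i => A (p i) ⟨q, hq⟩) U (𝓝 0) := by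
      refine squeeze_zero_norm' (a := fun i : Finset S × ℕ => 1 / ((i.2 : ℝ) + 1)) ?_ ?_
      · refine hU ?_
        filter_upwards [eventually_ge_atTop (({⟨q, hq⟩} : Finset S), 0)] with i hi
        exact hpk i _ (hi.1 (Finset.mem_singleton_self _))
      · refine Tendsto.mono_left ?_ hU
        rw [← prod_atTop_atTop_eq]
        exact tendsto_one_div_add_atTop_nhds_zero_nat.comp tendsto_snd
    have hqE := hS q hq
    have hG := P.symm.integrable_inner_memL hG₀.1 hqE.1.1
    have h2 := ((hχlim _ hqE.1).sub_const (∫ x, ⟪G₀ x, q.1 x⟫ ∂μ)).add (hγlim _ hqE.2)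
    rw [← integral_sub (P.symm.integrable_inner_memL hχL hqE.1.1) hG] at h2
    simp only [← inner_sub_left] at h2
    refine tendsto_nhds_unique h2 (h1.congr fun i => ?_)
    rw [hA, ← integral_sub (P.symm.integrable_inner_memL (hfL _) hqE.1.1) hG]
    simp only [← inner_sub_left]
  · intro hid
    have hττ : MemL μ Z (fun x => j x - j₀ x) := P.right.memL_sub hjL hj₀.1
    have hχj := P.symm.integrable_inner_memL hχL hjL
    have hγt := P'.symm.integrable_inner_memL hγL htL
    -- the monotonicity inequality for bounded test functions with bounded images
    have hminty : ∀ (v : α → W) (s : β → W') (R : ℝ), AEStronglyMeasurable v μ →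
        AEStronglyMeasurable s ν → (∀ᵐ x ∂μ, ‖v x‖ ≤ R) → (∀ᵐ x ∂μ, ‖f x (v x)‖ ≤ R) →
        (∀ᵐ x ∂ν, ‖s x‖ ≤ R) → (∀ᵐ x ∂ν, ‖g x (s x)‖ ≤ R) →
        0 ≤ ∫ x, ⟪χ x - f x (v x), j x - v x⟫ ∂μ + ∫ x, ⟪γ x - g x (s x), t x - s x⟫ ∂ν := by
      intro v s R hv hs hvR hfR hsR hgR
      have hvE : MemE μ Z v := P.right.memE_of_bounded hv hvR
      have hsE : MemE ν Z' s := P'.right.memE_of_bounded hs hsR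
      have hfE : MemE μ Y (fun x => f x (v x)) := P.left.memE_of_bounded (F.car.comp hv) hfR
      have hgE : MemE ν Y' (fun x => g x (s x)) := P'.left.memE_of_bounded (F'.car.comp hs) hgR
      have hlim := (((((hχlim _ (P.right.memE_sub hj₀ hvE)).add (hjlim.flip hG₀)).sub
        (hjlim.flip hfE)).sub (hγlim _ hsE)).sub (htlim.flip hgE)).add_const
        (∫ x, ⟪f x (v x), v x⟫ ∂μ + ∫ x, ⟪g x (s x), s x⟫ ∂ν - ∫ x, ⟪G₀ x, j₀ x⟫ ∂μ)
      have h0 := ge_of_tendsto' hlim (b := 0) fun i => ?_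
      · rw [P.integral_inner_sub_sub hχL hG₀.1 hjL hj₀.1] at hid
        have h1 := P.integral_inner_sub_sub hχL P.left.memE_zero.1 hj₀.1 hvE.1
        rw [P.integral_inner_sub_sub hχL hfE.1 hjL hvE.1,
          P'.integral_inner_sub_sub hγL hgE.1 htL hsE.1]
        simp only [sub_zero, inner_zero_left, integral_zero] at h1
        linarith
      · have h1 : 0 ≤ ∫ x, ⟪f x (j₀ x + (p i).1.1 x) - f x (v x), j₀ x + (p i).1.1 x - v x⟫ ∂μ :=
          integral_nonneg_of_ae (by filter_upwards [F.mono] with x hx using hx _ _)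
        have h2 : 0 ≤ ∫ x, ⟪g x ((p i).1.2 x) - g x (s x), (p i).1.2 x - s x⟫ ∂ν :=
          integral_nonneg_of_ae (by filter_upwards [F'.mono] with x hx using hx _ _)
        have h3 := hp0 i
        rw [hA] at h3
        have h4 := P.integral_inner_sub_sub (hfL (p i)) hG₀.1 (hjE (p i)).1 hj₀.1
        have h5 := P.integral_inner_sub_sub (hfL (p i)) P.left.memE_zero.1 hj₀.1 hvE.1
        simp only [add_sub_cancel_left] at h4
        simp only [sub_zero, inner_zero_left, integral_zero] at h5
        rw [P.integral_inner_sub_sub (hfL (p i)) hfE.1 (hjE (p i)).1 hvE.1] at h1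
        rw [P'.integral_inner_sub_sub (hgL (p i)) hgE.1 (htE (p i)).1 hsE.1] at h2
        linarith
    have hRk : ∀ (R : ℝ), ∃ K : ℕ, ∀ k ≥ K, R ≤ k := fun R => by
      obtain ⟨K, hK⟩ := exists_nat_ge R
      exact ⟨K, fun k hk => hK.trans (by exact_mod_cast hk)⟩
    constructor
    -- one component is tested at a time, the other test function being a truncation of the limit
    · refine F.eq_comp_of_minty hχ1 hj1 hχj fun v R hv hvR hfR => ?_
      have hlim := (F'.tendsto_goodTrunc ht1.1 hγt hγ1.1).const_add
        (∫ x, ⟪χ x - f x (v x), j x - v x⟫ ∂μ)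
      rw [add_zero] at hlim
      refine ge_of_tendsto hlim ?_
      obtain ⟨K, hK⟩ := hRk R
      filter_upwards [eventually_ge_atTop K] with k hk
      refine hminty v _ k hv (F'.aestronglyMeasurable_goodTrunc ht1.1 k) ?_ ?_
        (ae_of_all _ (norm_goodTrunc_le k t)) ?_
      · filter_upwards [hvR] with x hx using hx.trans (hK k hk)
      · filter_upwards [hfR] with x hx using hx.trans (hK k hk)
      · filter_upwards [F'.norm_comp_goodTrunc_le t] with x hx using hx k
    · refine F'.eq_comp_of_minty hγ1 ht1 hγt fun s R hs hsR hgR => ?_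
      have hlim := (F.tendsto_goodTrunc hj1.1 hχj hχ1.1).add_const
        (∫ x, ⟪γ x - g x (s x), t x - s x⟫ ∂ν)
      rw [zero_add] at hlim
      refine ge_of_tendsto hlim ?_
      obtain ⟨K, hK⟩ := hRk R
      filter_upwards [eventually_ge_atTop K] with k hk
      refine hminty _ s k (F.aestronglyMeasurable_goodTrunc hj1.1 k) hs
        (ae_of_all _ (norm_goodTrunc_le k j)) ?_ ?_ ?_
      · filter_upwards [F.norm_comp_goodTrunc_le j] with x hx using hx k
      · filter_upwards [hsR] with x hx using hx.trans (hK k hk)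
      · filter_upwards [hgR] with x hx using hx.trans (hK k hk)

end Pair

/-! ### Potentials -/

section Potential

variable {α : Type*} [MeasurableSpace α] {W : Type*}
  [NormedAddCommGroup W] [InnerProductSpace ℝ W] [FiniteDimensional ℝ W]
  {μ : Measure α} {Y Z : α → W → ℝ} {f : α → W → W} {a C : ℝ}

/-- A potential, normalized to vanish at zero, of a monotone nonlinearity that is zero at zero. -/
structure IsPotential (μ : Measure α) (f : α → W → W) (H : α → W → ℝ) : Prop where
  car : IsCaratheodory μ H
  zero : ∀ᵐ x ∂μ, H x 0 = 0
  nonneg : ∀ᵐ x ∂μ, ∀ v, 0 ≤ H x v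
  grad : ∀ᵐ x ∂μ, ∀ v, HasGradientAt (H x) (f x v) v
  sub : ∀ᵐ x ∂μ, ∀ v w, H x w + ⟪f x w, v - w⟫ ≤ H x v

/-- The gradient inequality for a function with monotone gradient. -/
lemma add_inner_le_of_monotone_gradient {H : W → ℝ} {φ : W → W}
    (hφ : ∀ v, HasGradientAt H (φ v) v) (hm : ∀ v w, 0 ≤ ⟪φ v - φ w, v - w⟫) (v w : W) :
    H w + ⟪φ w, v - w⟫ ≤ H v := by
  have hd : ∀ s : ℝ, HasDerivAt (fun s : ℝ => H (w + s • (v - w)))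
      ⟪φ (w + s • (v - w)), v - w⟫ s := by
    intro s
    have h1 : HasDerivAt (fun s : ℝ => w + s • (v - w)) (v - w) s := by
      simpa using ((hasDerivAt_id s).smul_const (v - w)).const_add w
    have h2 := (hφ (w + s • (v - w))).hasFDerivAt.comp_hasDerivAt s h1
    simpa [Function.comp_def] using h2
  obtain ⟨s, hs, heq⟩ := exists_hasDerivAt_eq_slope (fun s : ℝ => H (w + s • (v - w)))
    (fun s => ⟪φ (w + s • (v - w)), v - w⟫) (zero_lt_one' ℝ)
    (fun s _ => (hd s).continuousAt.continuousWithinAt) (fun s _ => hd s)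
  have h3 := hm (w + s • (v - w)) w
  rw [add_sub_cancel_left, inner_smul_right] at h3
  have h4 := nonneg_of_mul_nonneg_right h3 hs.1
  simp only [one_smul, add_sub_cancel, zero_smul, add_zero, sub_zero, div_one] at heq
  rw [inner_sub_left] at h4
  linarith

/-- Riemann sums of a monotone gradient along a segment converge to the potential. -/
lemma tendsto_riemann_potential {H : W → ℝ} {φ : W → W}
    (hs : ∀ v w, H w + ⟪φ w, v - w⟫ ≤ H v) (h0 : H 0 = 0) (v : W) :
    Tendsto (fun n : ℕ => ∑ k ∈ Finset.range (n + 1),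
      (1 / ((n : ℝ) + 1)) * ⟪φ (((k : ℝ) * (1 / ((n : ℝ) + 1))) • v), v⟫) atTop (𝓝 (H v)) := by
  have hstep : ∀ (n k : ℕ), (1 / ((n : ℝ) + 1)) * ⟪φ (((k : ℝ) * (1 / ((n : ℝ) + 1))) • v), v⟫ ≤
        H (((k + 1 : ℕ) * (1 / ((n : ℝ) + 1))) • v) - H (((k : ℝ) * (1 / ((n : ℝ) + 1))) • v) ∧
      H (((k + 1 : ℕ) * (1 / ((n : ℝ) + 1))) • v) - H (((k : ℝ) * (1 / ((n : ℝ) + 1))) • v) ≤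
        (1 / ((n : ℝ) + 1)) * ⟪φ (((k + 1 : ℕ) * (1 / ((n : ℝ) + 1))) • v), v⟫ := by
    intro n k
    set r : ℝ := 1 / ((n : ℝ) + 1)
    have h1 := hs (((k + 1 : ℕ) * r) • v) (((k : ℝ) * r) • v)
    have h2 := hs (((k : ℝ) * r) • v) (((k + 1 : ℕ) * r) • v)
    rw [← sub_smul, inner_smul_right] at h1 h2
    have h3 : ((k + 1 : ℕ) : ℝ) * r - k * r = r := by push_cast; ring
    have h4 : (k : ℝ) * r - ((k + 1 : ℕ) : ℝ) * r = -r := by push_cast; ring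
    rw [h3] at h1
    rw [h4] at h2
    constructor <;> linarith
  have htel : ∀ n : ℕ, ∑ k ∈ Finset.range (n + 1),
      (H (((k + 1 : ℕ) * (1 / ((n : ℝ) + 1))) • v) - H (((k : ℝ) * (1 / ((n : ℝ) + 1))) • v)) =
        H v := by
    intro n
    rw [Finset.sum_range_sub (fun k : ℕ => H (((k : ℝ) * (1 / ((n : ℝ) + 1))) • v))]
    have : ((n + 1 : ℕ) : ℝ) * (1 / ((n : ℝ) + 1)) = 1 := by
      push_cast
      field_simp
    simp only [this, one_smul, Nat.cast_zero, zero_mul, zero_smul, h0, sub_zero]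
  have hlow : ∀ n : ℕ, H v - (1 / ((n : ℝ) + 1)) * (⟪φ v, v⟫ - ⟪φ 0, v⟫) ≤
      ∑ k ∈ Finset.range (n + 1),
        (1 / ((n : ℝ) + 1)) * ⟪φ (((k : ℝ) * (1 / ((n : ℝ) + 1))) • v), v⟫ := by
    intro n
    have h1 := Finset.sum_le_sum fun k (_ : k ∈ Finset.range (n + 1)) => (hstep n k).2
    rw [htel] at h1
    have h2 := Finset.sum_range_sub (fun k : ℕ =>
      (1 / ((n : ℝ) + 1)) * ⟪φ (((k : ℝ) * (1 / ((n : ℝ) + 1))) • v), v⟫) (n + 1)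
    have : ((n + 1 : ℕ) : ℝ) * (1 / ((n : ℝ) + 1)) = 1 := by
      push_cast
      field_simp
    rw [Finset.sum_sub_distrib, this] at h2
    simp only [one_smul, Nat.cast_zero, zero_mul, zero_smul] at h2
    linarith
  have hup : ∀ n : ℕ, ∑ k ∈ Finset.range (n + 1),
      (1 / ((n : ℝ) + 1)) * ⟪φ (((k : ℝ) * (1 / ((n : ℝ) + 1))) • v), v⟫ ≤ H v := by
    intro n
    rw [← htel n]
    exact Finset.sum_le_sum fun k _ => (hstep n k).1
  refine tendsto_of_tendsto_of_tendsto_of_le_of_le ?_ tendsto_const_nhds hlow hup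
  have := (tendsto_one_div_add_atTop_nhds_zero_nat (𝕜 := ℝ)).mul_const (⟪φ v, v⟫ - ⟪φ 0, v⟫)
  simpa using this.const_sub (H v)

/-- Measurability in `x` of the normalized potential follows from its being a limit of Riemann sums
of `f`. -/
lemma HasPotential.exists_isPotential (h : HasPotential μ f) (F : IsFlux μ Y Z f a C) :
    ∃ H, IsPotential μ f H := by
  obtain ⟨H, hH⟩ := h
  have hgrad : ∀ᵐ x ∂μ, ∀ v, HasGradientAt (fun v => H x v - H x 0) (f x v) v := by
    filter_upwards [hH] with x hx v
    rw [hasGradientAt_iff_hasFDerivAt]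
    exact (hx v).hasFDerivAt.sub_const _
  have hsub : ∀ᵐ x ∂μ, ∀ v w, (H x w - H x 0) + ⟪f x w, v - w⟫ ≤ H x v - H x 0 := by
    filter_upwards [hgrad, F.mono] with x h1 h2 v w
    exact add_inner_le_of_monotone_gradient h1 h2 v w
  refine ⟨fun x v => H x v - H x 0, ⟨?_, fun v => ?_⟩, by simp, ?_, hgrad, hsub⟩
  · filter_upwards [hgrad] with x hx
    exact continuous_iff_continuousAt.2 fun v => (hx v).hasFDerivAt.continuousAt
  · refine aestronglyMeasurable_of_tendsto_ae atTop (f := fun (n : ℕ) x =>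
      ∑ k ∈ Finset.range (n + 1),
        (1 / ((n : ℝ) + 1)) * ⟪f x (((k : ℝ) * (1 / ((n : ℝ) + 1))) • v), v⟫) (fun n => ?_) ?_
    · refine Finset.aestronglyMeasurable_fun_sum _ fun k _ => AEStronglyMeasurable.const_mul ?_ _
      exact (F.car.measurable _).inner (aestronglyMeasurable_const (b := v))
    · filter_upwards [hsub] with x hx
      exact tendsto_riemann_potential (H := fun v => H x v - H x 0) hx (by simp) v
  · filter_upwards [hsub, F.zero] with x h1 h2 v
    simpa [h2] using h1 v 0

namespace IsPotential

variable {H : α → W → ℝ}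

lemma integrable_of_le (hH : IsPotential μ f H) {v : α → W} (hv : AEStronglyMeasurable v μ)
    {b : α → ℝ} (hb : Integrable b μ) (h : ∀ᵐ x ∂μ, H x (v x) ≤ b x) :
    Integrable (fun x => H x (v x)) μ := by
  refine hb.mono' (hH.car.comp hv) ?_
  filter_upwards [h, hH.nonneg] with x hx h0
  rwa [Real.norm_of_nonneg (h0 _)]

lemma le_inner (hH : IsPotential μ f H) : ∀ᵐ x ∂μ, ∀ v, H x v ≤ ⟪f x v, v⟫ := by
  filter_upwards [hH.sub, hH.zero] with x h1 h2 v
  have := h1 0 v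
  rw [h2, zero_sub, inner_neg_right] at this
  linarith

lemma convex_le (hH : IsPotential μ f H) : ∀ᵐ x ∂μ, ∀ v w (s : ℝ), 0 ≤ s → s ≤ 1 →
    H x (v + s • (w - v)) ≤ (1 - s) * H x v + s * H x w := by
  filter_upwards [hH.sub] with x h1 v w s hs hs1
  have h2 := h1 v (v + s • (w - v))
  have h3 := h1 w (v + s • (w - v))
  have h4 : v - (v + s • (w - v)) = -(s • (w - v)) := by abel
  have h5 : w - (v + s • (w - v)) = (1 - s) • (w - v) := by
    rw [sub_smul, one_smul]; abel
  rw [h4, inner_neg_right, inner_smul_right] at h2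
  rw [h5, inner_smul_right] at h3
  nlinarith [mul_le_mul_of_nonneg_left h2 (sub_nonneg.2 hs1), mul_le_mul_of_nonneg_left h3 hs]

lemma integrable_of_memE [IsFiniteMeasure μ] (hH : IsPotential μ f H) (P : DualPair μ Y Z)
    (F : IsFlux μ Y Z f a C) {v : α → W} (hv : MemE μ Z v) :
    Integrable (fun x => H x (v x)) μ := by
  refine hH.integrable_of_le (P.right.memE_iff.1 hv).1.1
    (P.symm.integrable_inner_memL (F.memL_comp P hv) hv.1) ?_
  filter_upwards [hH.le_inner] with x hx using hx _

/-- Coercivity of the potential, from the gradient inequality at `v / 2`. -/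
lemma ae_coercive (hH : IsPotential μ f H) (F : IsFlux μ Y Z f a C) (P : DualPair μ Y Z) :
    ∀ᵐ x ∂μ, ∀ v, a * Z x ((1 / 2 : ℝ) • v) - C ≤ H x v := by
  filter_upwards [hH.sub, hH.nonneg, F.coer, P.left.nonneg] with x h1 h2 h3 h4 v
  have h5 := h1 v ((1 / 2 : ℝ) • v)
  have h6 : v - (1 / 2 : ℝ) • v = (1 / 2 : ℝ) • v := by
    nth_rewrite 1 [← one_smul ℝ v]
    rw [← sub_smul]; norm_num
  rw [h6] at h5
  have h7 := h3 ((1 / 2 : ℝ) • v)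
  have h8 := h2 ((1 / 2 : ℝ) • v)
  have h9 := mul_nonneg F.pos.le (h4 (f x ((1 / 2 : ℝ) • v)))
  linarith

variable [IsFiniteMeasure μ]

lemma integrable_half (hH : IsPotential μ f H) (F : IsFlux μ Y Z f a C) (P : DualPair μ Y Z)
    {j : α → W} (hj : AEStronglyMeasurable j μ) (hi : Integrable (fun x => H x (j x)) μ) :
    Integrable (fun x => Z x ((1 / 2 : ℝ) • j x)) μ := by
  have ha := F.pos
  refine P.right.integrable_of_le (hj.const_smul _)
    ((hi.add (integrable_const C)).const_mul a⁻¹) ?_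
  filter_upwards [hH.ae_coercive F P] with x hx
  have := hx (j x)
  rw [← div_eq_inv_mul, le_div_iff₀' ha]
  simp only [Pi.add_apply]
  linarith

/-- The energy estimate for the potential. -/
lemma exists_energy_bound (hH : IsPotential μ f H) (F : IsFlux μ Y Z f a C) (P : DualPair μ Y Z)
    {G₀ j₀ : α → W} (hG₀ : MemE μ Y G₀) (hj₀ : MemE μ Z j₀) :
    ∃ M : ℝ, ∀ j, MemL μ Z j → Integrable (fun x => H x (j x)) μ →
      (a / 2) * ∫ x, Z x ((1 / 2 : ℝ) • j x) ∂μ ≤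
        ∫ x, H x (j x) ∂μ - ∫ x, ⟪G₀ x, j x - j₀ x⟫ ∂μ + M := by
  have ha := F.pos
  have h2 := (P.left.memE_iff.1 hG₀).2 (4 / a)
  have h3 := P.symm.integrable_inner_memL hG₀.1 hj₀.1
  set r : α → ℝ := fun x => C + (a / 2) * Y x ((4 / a) • G₀ x) - ⟪G₀ x, j₀ x⟫
  have hr : Integrable r μ := ((integrable_const C).add (h2.const_mul _)).sub h3
  refine ⟨∫ x, r x ∂μ, fun j hj hi => ?_⟩
  have hjm := (P.right.memL_iff.1 hj).1.1
  have h4 := hH.integrable_half F P hjm hi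
  have h5 := P.symm.integrable_inner_memL hG₀.1 (P.right.memL_sub hj hj₀.1)
  have h6 : Integrable (fun x => H x (j x) - ⟪G₀ x, j x - j₀ x⟫) μ := hi.sub h5
  rw [← integral_const_mul, ← integral_sub hi h5, ← integral_add h6 hr]
  refine integral_mono_ae (h4.const_mul _) (h6.add hr) ?_
  filter_upwards [hH.ae_coercive F P, P.young] with x hc hy
  have h8 := (le_abs_self _).trans (hy ((1 / 2 : ℝ) • j x) ((4 / a) • G₀ x))
  have h9 := hc (j x)
  rw [inner_smul_right, inner_smul_left, RCLike.conj_to_real, real_inner_comm, ← mul_assoc,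
    show 4 / a * (1 / 2) = 2 / a by ring, div_mul_eq_mul_div, div_le_iff₀ ha] at h8
  simp only [r, inner_sub_right]
  linarith

/-- Weak-star lower semicontinuity of the integral of the potential, up to the truncation of the
limit: the gradient inequality at the truncation has an error term that is weakly-star continuous
and vanishes at the limit. -/
lemma integral_goodTrunc_le (hH : IsPotential μ f H) (F : IsFlux μ Y Z f a C)
    (P : DualPair μ Y Z) {I : Type*} {U : Ultrafilter I} {v : I → α → W} {j : α → W}
    (hv : ∀ i, MemL μ Z (v i)) (hvi : ∀ i, Integrable (fun x => H x (v i x)) μ)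
    (hj : MemL μ Z j) (hlim : WeakStarLim μ Y U v j) (k : ℕ) :
    ∃ r : I → ℝ, Tendsto r U (𝓝 0) ∧
      ∀ i, ∫ x, H x (goodTrunc f k j x) ∂μ + r i ≤ ∫ x, H x (v i x) ∂μ := by
  have hjm := (P.right.memL_iff.1 hj).1.1
  set w := goodTrunc f k j
  have hwm : AEStronglyMeasurable w μ := F.aestronglyMeasurable_goodTrunc hjm k
  have hwE : MemE μ Z w := P.right.memE_of_bounded hwm (ae_of_all _ (norm_goodTrunc_le k j))
  have hfwE : MemE μ Y (fun x => f x (w x)) := P.left.memE_of_bounded (F.car.comp hwm) (R := k) (by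
    filter_upwards [F.norm_comp_goodTrunc_le j] with x hx using hx k)
  have hzero : ∫ x, ⟪f x (w x), j x⟫ ∂μ - ∫ x, ⟪f x (w x), w x⟫ ∂μ = 0 := by
    rw [← integral_sub (P.symm.integrable_inner_memL hfwE.1 hj)
      (P.symm.integrable_inner_memL hfwE.1 hwE.1)]
    refine integral_eq_zero_of_ae ?_
    filter_upwards [F.zero] with x hx
    by_cases h : ‖j x‖ ≤ k ∧ ‖f x (j x)‖ ≤ k
    · simp [w, goodTrunc_of_le h]
    · simp [w, goodTrunc_of_not_le h, hx]
  refine ⟨fun i => ∫ x, ⟪f x (w x), v i x⟫ ∂μ - ∫ x, ⟪f x (w x), w x⟫ ∂μ, ?_, fun i => ?_⟩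
  · rw [← hzero]
    exact (hlim.flip hfwE).sub_const _
  · have h1 := hH.integrable_of_memE P F hwE
    have h2 := P.symm.integrable_inner_memL hfwE.1 (hv i)
    have h3 := P.symm.integrable_inner_memL hfwE.1 hwE.1
    have h4 : Integrable (fun x => ⟪f x (w x), v i x⟫ - ⟪f x (w x), w x⟫) μ := h2.sub h3
    dsimp only
    rw [← integral_sub h2 h3, ← integral_add h1 h4]
    refine integral_mono_ae (h1.add h4) (hvi i) ?_
    filter_upwards [hH.sub] with x hx
    have := hx (v i x) (w x)
    rwa [inner_sub_right] at this

lemma goodTrunc_le (hH : IsPotential μ f H) (j : α → W) :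
    ∀ᵐ x ∂μ, ∀ k : ℕ, H x (goodTrunc f k j x) ≤ H x (j x) := by
  filter_upwards [hH.zero, hH.nonneg] with x h1 h2 k
  by_cases h : ‖j x‖ ≤ k ∧ ‖f x (j x)‖ ≤ k
  · rw [goodTrunc_of_le h]
  · rw [goodTrunc_of_not_le h, h1]; exact h2 _

lemma tendsto_goodTrunc (hH : IsPotential μ f H) (F : IsFlux μ Y Z f a C) (P : DualPair μ Y Z)
    {j : α → W} (hj : AEStronglyMeasurable j μ) {M : ℝ}
    (hM : ∀ k, ∫ x, H x (goodTrunc f k j x) ∂μ ≤ M) :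
    Integrable (fun x => H x (j x)) μ ∧
      Tendsto (fun k => ∫ x, H x (goodTrunc f k j x) ∂μ) atTop (𝓝 (∫ x, H x (j x) ∂μ)) := by
  have hlim : ∀ᵐ x ∂μ, Tendsto (fun k => H x (goodTrunc f k j x)) atTop (𝓝 (H x (j x))) := by
    refine ae_of_all _ fun x => Tendsto.congr' ?_ tendsto_const_nhds
    filter_upwards [eventually_good f j x] with k hk
    rw [goodTrunc_of_le hk]
  have hint : ∀ k, Integrable (fun x => H x (goodTrunc f k j x)) μ := fun k =>
    hH.integrable_of_memE P F (P.right.memE_of_bounded (F.aestronglyMeasurable_goodTrunc hj k)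
      (ae_of_all _ (norm_goodTrunc_le k j)))
  have hi := (integrable_of_tendsto_of_integral_le hint (integrable_zero _ _ _) (fun k => by
    filter_upwards [hH.nonneg] with x hx using hx _) hlim hM).1
  refine ⟨hi, tendsto_integral_of_dominated_convergence _ (fun k => (hint k).1) hi (fun k => ?_)
    hlim⟩
  filter_upwards [hH.nonneg, hH.goodTrunc_le j] with x h1 h2
  rw [Real.norm_of_nonneg (h1 _)]
  exact h2 k

end IsPotential

/-- The growth condition bounds the modular of `f(j)` once `f(j) · (b - j)` is integrable. -/
lemma IsFlux.memL_of_integrable_inner [IsFiniteMeasure μ] (F : IsFlux μ Y Z f a C)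
    (P : DualPair μ Y Z) {j b : α → W} (hj : AEStronglyMeasurable j μ) (hb : MemE μ Z b)
    (hi : Integrable (fun x => ⟪f x (j x), b x - j x⟫) μ) : MemL μ Y (fun x => f x (j x)) := by
  have ha := F.pos
  have hfm := F.car.comp hj
  have h1 := (P.right.memE_iff.1 hb).2 (2 / a)
  have h2 : Integrable (fun x => Y x (f x (j x))) μ := by
    refine P.left.integrable_of_le hfm
      (((hi.neg.add (h1.const_mul (a / 2))).add (integrable_const C)).const_mul (2 / a)) ?_
    filter_upwards [F.coer, P.young, P.right.nonneg] with x h3 h4 h5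
    have h7 := (le_abs_self _).trans (h4 ((2 / a) • b x) (f x (j x)))
    rw [inner_smul_left, RCLike.conj_to_real, real_inner_comm, div_mul_eq_mul_div,
      div_le_iff₀ ha] at h7
    have h8 := h3 (j x)
    have h9 := mul_nonneg ha.le (h5 (j x))
    rw [div_mul_eq_mul_div, le_div_iff₀ ha]
    simp only [Pi.add_apply, Pi.neg_apply, inner_sub_right]
    linarith
  exact P.left.memL_of_integrable (P.symm.integrable_of_modular hfm h2) h2

end Potential

/-! ### Minimization of the energy -/

section Quotient

variable {α : Type*} [MeasurableSpace α] {W : Type*}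
  [NormedAddCommGroup W] [InnerProductSpace ℝ W] [FiniteDimensional ℝ W]
  {μ : Measure α} {f : α → W → W}

namespace IsPotential

variable {H : α → W → ℝ}

/-- The difference quotients, with step `1 / (n + 1)`, of a potential at `j` in the direction of
`w - j`. -/
def quotient (H : α → W → ℝ) (j w : α → W) (n : ℕ) (x : α) : ℝ :=
  ((n : ℝ) + 1) * (H x (j x + (1 / ((n : ℝ) + 1)) • (w x - j x)) - H x (j x))

lemma ae_quotient_le (hH : IsPotential μ f H) (j w : α → W) :
    ∀ᵐ x ∂μ, ∀ n, quotient H j w n x ≤ H x (w x) - H x (j x) := by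
  filter_upwards [hH.convex_le] with x hx n
  have hn : (0 : ℝ) < (n : ℝ) + 1 := by positivity
  have h1 := hx (j x) (w x) (1 / ((n : ℝ) + 1)) (by positivity)
    (by rw [div_le_one hn]; linarith [(Nat.cast_nonneg n : (0 : ℝ) ≤ n)])
  have h2 : ((n : ℝ) + 1) * (1 / ((n : ℝ) + 1)) = 1 := by field_simp
  have h3 := mul_le_mul_of_nonneg_left h1 hn.le
  rw [quotient, mul_sub]
  linear_combination h3 + (H x (w x) - H x (j x)) * h2

lemma ae_le_quotient (hH : IsPotential μ f H) (j w : α → W) :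
    ∀ᵐ x ∂μ, ∀ n, ⟪f x (j x), w x - j x⟫ ≤ quotient H j w n x := by
  filter_upwards [hH.sub] with x hx n
  have hn : (0 : ℝ) < (n : ℝ) + 1 := by positivity
  have h1 := hx (j x + (1 / ((n : ℝ) + 1)) • (w x - j x)) (j x)
  rw [add_sub_cancel_left, inner_smul_right] at h1
  have h2 : ((n : ℝ) + 1) * (1 / ((n : ℝ) + 1)) = 1 := by field_simp
  have h3 := mul_le_mul_of_nonneg_left h1 hn.le
  rw [mul_add, ← mul_assoc, h2, one_mul] at h3
  rw [quotient, mul_sub]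
  linarith

lemma ae_tendsto_quotient (hH : IsPotential μ f H) (j w : α → W) :
    ∀ᵐ x ∂μ, Tendsto (fun n => quotient H j w n x) atTop (𝓝 ⟪f x (j x), w x - j x⟫) := by
  filter_upwards [hH.grad] with x hx
  have h1 : HasDerivAt (fun s : ℝ => H x (j x + s • (w x - j x))) ⟪f x (j x), w x - j x⟫ 0 := by
    have h2 : HasDerivAt (fun s : ℝ => j x + s • (w x - j x)) (w x - j x) 0 := by
      simpa using ((hasDerivAt_id (0 : ℝ)).smul_const (w x - j x)).const_add (j x)
    have h3 := hx (j x + (0 : ℝ) • (w x - j x))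
    have h4 := h3.hasFDerivAt.comp_hasDerivAt (0 : ℝ) h2
    simpa [Function.comp_def] using h4
  have h5 := h1.tendsto_slope_zero_right
  have h6 : Tendsto (fun n : ℕ => 1 / ((n : ℝ) + 1)) atTop (𝓝[>] 0) :=
    tendsto_nhdsWithin_iff.2 ⟨tendsto_one_div_add_atTop_nhds_zero_nat,
      Eventually.of_forall fun n => by simp only [mem_Ioi]; positivity⟩
  refine (h5.comp h6).congr fun n => ?_
  simp [quotient]

lemma integrable_segment (hH : IsPotential μ f H) {j w : α → W} (hj : AEStronglyMeasurable j μ)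
    (hw : AEStronglyMeasurable w μ) (hji : Integrable (fun x => H x (j x)) μ)
    (hwi : Integrable (fun x => H x (w x)) μ) (n : ℕ) :
    Integrable (fun x => H x (j x + (1 / ((n : ℝ) + 1)) • (w x - j x))) μ := by
  have hn : (0 : ℝ) < (n : ℝ) + 1 := by positivity
  refine hH.integrable_of_le (hj.add ((hw.sub hj).const_smul _))
    ((hji.const_mul (1 - 1 / ((n : ℝ) + 1))).add (hwi.const_mul (1 / ((n : ℝ) + 1)))) ?_
  filter_upwards [hH.convex_le] with x hx
  exact hx (j x) (w x) (1 / ((n : ℝ) + 1)) (by positivity)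
    (by rw [div_le_one hn]; linarith [(Nat.cast_nonneg n : (0 : ℝ) ≤ n)])

/-- Passage to the limit in the difference quotients. -/
lemma tendsto_integral_quotient (hH : IsPotential μ f H) {j w : α → W}
    (hj : AEStronglyMeasurable j μ) (hw : AEStronglyMeasurable w μ)
    (hji : Integrable (fun x => H x (j x)) μ) (hwi : Integrable (fun x => H x (w x)) μ) {B : ℝ}
    (hB : ∀ n, B ≤ ∫ x, quotient H j w n x ∂μ) :
    Integrable (fun x => ⟪f x (j x), w x - j x⟫) μ ∧
      Tendsto (fun n => ∫ x, quotient H j w n x ∂μ) atTop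
        (𝓝 (∫ x, ⟪f x (j x), w x - j x⟫ ∂μ)) := by
  have hqi : ∀ n, Integrable (quotient H j w n) μ := fun n =>
    ((hH.integrable_segment hj hw hji hwi n).sub hji).const_mul _
  have hlim := hH.ae_tendsto_quotient j w
  have h1 : Integrable (fun x => -⟪f x (j x), w x - j x⟫) μ := by
    refine (integrable_of_tendsto_of_integral_le (F := fun n x => -quotient H j w n x)
      (g := fun x => H x (j x) - H x (w x)) (M := -B) (fun n => (hqi n).neg) (hji.sub hwi)
      (fun n => ?_) ?_ fun n => ?_).1
    · filter_upwards [hH.ae_quotient_le j w] with x hx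
      linarith [hx n]
    · filter_upwards [hlim] with x hx using hx.neg
    · rw [integral_neg]
      linarith [hB n]
  have h2 : Integrable (fun x => ⟪f x (j x), w x - j x⟫) μ := by simpa using h1.neg
  refine ⟨h2, tendsto_integral_of_dominated_convergence
    (fun x => ‖⟪f x (j x), w x - j x⟫‖ + ‖H x (w x) - H x (j x)‖) (fun n => (hqi n).1)
    (h2.norm.add (hwi.sub hji).norm) (fun n => ?_) hlim⟩
  filter_upwards [hH.ae_quotient_le j w, hH.ae_le_quotient j w] with x h3 h4
  have h5 := h3 n
  have h6 := h4 n
  have h7 := neg_abs_le ⟪f x (j x), w x - j x⟫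
  have h8 := le_abs_self (H x (w x) - H x (j x))
  have h9 := abs_nonneg ⟪f x (j x), w x - j x⟫
  have h10 := abs_nonneg (H x (w x) - H x (j x))
  rw [Real.norm_eq_abs, Real.norm_eq_abs, Real.norm_eq_abs, abs_le]
  constructor <;> linarith

end IsPotential

end Quotient

section Minimization

variable {α : Type*} [MeasurableSpace α] {W : Type*}
  [NormedAddCommGroup W] [InnerProductSpace ℝ W] [FiniteDimensional ℝ W]
  {μ : Measure α} [IsFiniteMeasure μ] {Y Z : α → W → ℝ} {f : α → W → W} {a C : ℝ}
  {β : Type*} [MeasurableSpace β] {W' : Type*}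
  [NormedAddCommGroup W'] [InnerProductSpace ℝ W'] [FiniteDimensional ℝ W']
  {ν : Measure β} [IsFiniteMeasure ν] {Y' Z' : β → W' → ℝ} {g : β → W' → W'} {a' C' : ℝ}

/-- The direct method: on a weakly-star closed space `X` the energy
`∫ H(j₀ + τ) + ∫ H'(t) - ∫ G₀ · τ` attains its minimum. -/
theorem exists_minimizer (P : DualPair μ Y Z) (P' : DualPair ν Y' Z')
    (F : IsFlux μ Y Z f a C) (F' : IsFlux ν Y' Z' g a' C') {H : α → W → ℝ} {H' : β → W' → ℝ}
    (hH : IsPotential μ f H) (hH' : IsPotential ν g H')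
    (X : Submodule ℝ ((α → W) × (β → W'))) (hX : ∀ p ∈ X, MemL μ Z p.1 ∧ MemL ν Z' p.2)
    (hclosed : ∀ (U : Ultrafilter ℕ) (p : ℕ → X) (τ : α → W) (t : β → W'),
      MemL μ Z τ → MemL ν Z' t → WeakStarLim μ Y U (fun n => (p n).1.1) τ →
      WeakStarLim ν Y' U (fun n => (p n).1.2) t → (τ, t) ∈ X)
    {j₀ G₀ : α → W} (hj₀ : MemE μ Z j₀) (hG₀ : MemE μ Y G₀) :
    ∃ p ∈ X, Integrable (fun x => H x (j₀ x + p.1 x)) μ ∧ Integrable (fun x => H' x (p.2 x)) ν ∧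
      ∀ q ∈ X, Integrable (fun x => H x (j₀ x + q.1 x)) μ → Integrable (fun x => H' x (q.2 x)) ν →
        ∫ x, H x (j₀ x + p.1 x) ∂μ + ∫ x, H' x (p.2 x) ∂ν - ∫ x, ⟪G₀ x, p.1 x⟫ ∂μ ≤
        ∫ x, H x (j₀ x + q.1 x) ∂μ + ∫ x, H' x (q.2 x) ∂ν - ∫ x, ⟪G₀ x, q.1 x⟫ ∂μ := by
  have ha := F.pos
  have ha' := F'.pos
  let J : X → ℝ := fun p =>
    ∫ x, H x (j₀ x + p.1.1 x) ∂μ + ∫ x, H' x (p.1.2 x) ∂ν - ∫ x, ⟪G₀ x, p.1.1 x⟫ ∂μ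
  let D : Set X := {p | Integrable (fun x => H x (j₀ x + p.1.1 x)) μ ∧
    Integrable (fun x => H' x (p.1.2 x)) ν}
  have hjL : ∀ p : X, MemL μ Z (fun x => j₀ x + p.1.1 x) := fun p =>
    P.right.memL_add hj₀.1 (hX p p.2).1
  have htL : ∀ p : X, MemL ν Z' p.1.2 := fun p => (hX p p.2).2
  have hjm := fun p => (P.right.memL_iff.1 (hjL p)).1.1
  have htm := fun p => (P'.right.memL_iff.1 (htL p)).1.1
  -- coercivity
  obtain ⟨M₁, hM₁⟩ := hH.exists_energy_bound F P hG₀ hj₀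
  obtain ⟨M₂, hM₂⟩ := hH'.exists_energy_bound F' P' P'.left.memE_zero P'.right.memE_zero
  have henergy : ∀ p ∈ D, (a / 2) * ∫ x, Z x ((1 / 2 : ℝ) • (j₀ x + p.1.1 x)) ∂μ +
      (a' / 2) * ∫ x, Z' x ((1 / 2 : ℝ) • p.1.2 x) ∂ν ≤ J p + (M₁ + M₂) := by
    intro p hp
    have h1 := hM₁ _ (hjL p) hp.1
    have h2 := hM₂ _ (htL p) hp.2
    simp only [add_sub_cancel_left, inner_zero_left, integral_zero, sub_zero] at h1 h2
    simp only [J]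
    linarith
  have hZ0 : ∀ p : X, 0 ≤ (a / 2) * ∫ x, Z x ((1 / 2 : ℝ) • (j₀ x + p.1.1 x)) ∂μ := fun p =>
    mul_nonneg (half_pos ha).le (P.right.integral_nonneg _)
  have hZ0' : ∀ p : X, 0 ≤ (a' / 2) * ∫ x, Z' x ((1 / 2 : ℝ) • p.1.2 x) ∂ν := fun p =>
    mul_nonneg (half_pos ha').le (P'.right.integral_nonneg _)
  have hbdd : BddBelow (J '' D) := by
    refine ⟨-(M₁ + M₂), ?_⟩
    rintro _ ⟨p, hp, rfl⟩
    linarith [henergy p hp, hZ0 p, hZ0' p]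
  have hne : (J '' D).Nonempty := by
    refine ⟨_, 0, ⟨?_, ?_⟩, rfl⟩
    · simpa using hH.integrable_of_memE P F hj₀
    · simpa using hH'.integrable_of_memE P' F' P'.right.memE_zero
  -- a minimizing sequence
  obtain ⟨y, -, hytend, hy⟩ := exists_seq_tendsto_sInf hne hbdd
  choose p hpD hpy using hy
  set m := sInf (J '' D)
  obtain ⟨B, hB⟩ := hytend.bddAbove_range
  have hJB : ∀ n, J (p n) ≤ B := fun n => by
    rw [hpy]; exact hB ⟨n, rfl⟩
  let U : Ultrafilter ℕ := Ultrafilter.of atTop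
  have hU : (U : Filter ℕ) ≤ atTop := Ultrafilter.of_le _
  obtain ⟨j', hj'1, hj'2, -, hj'lim⟩ := P.exists_weakStarLim U
    (v := fun n x => (1 / 2 : ℝ) • (j₀ x + (p n).1.1 x)) (fun n => (hjm _).const_smul _)
    (fun n => hH.integrable_half F P (hjm _) (hpD n).1) (M := (B + (M₁ + M₂)) / (a / 2)) fun n => by
      rw [le_div_iff₀' (by positivity)]
      linarith [henergy _ (hpD n), hZ0' (p n), hJB n]
  obtain ⟨t', ht'1, ht'2, -, ht'lim⟩ := P'.exists_weakStarLim U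
    (v := fun n x => (1 / 2 : ℝ) • (p n).1.2 x) (fun n => (htm _).const_smul _)
    (fun n => hH'.integrable_half F' P' (htm _) (hpD n).2) (M := (B + (M₁ + M₂)) / (a' / 2))
    fun n => by
      rw [le_div_iff₀' (by positivity)]
      linarith [henergy _ (hpD n), hZ0 (p n), hJB n]
  set j : α → W := fun x => (2 : ℝ) • j' x
  set t : β → W' := fun x => (2 : ℝ) • t' x
  have hj : MemL μ Z j := P.right.memL_smul (P.right.memL_of_integrable hj'1 hj'2) 2
  have ht : MemL ν Z' t := P'.right.memL_smul (P'.right.memL_of_integrable ht'1 ht'2) 2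
  have hjlim : WeakStarLim μ Y U (fun n x => j₀ x + (p n).1.1 x) j := by
    intro u hu
    have h1 := (hj'lim u hu).const_mul 2
    simp only [inner_smul_left, RCLike.conj_to_real, integral_const_mul] at h1
    simp only [j, inner_smul_left, RCLike.conj_to_real, integral_const_mul]
    refine h1.congr fun n => ?_
    ring
  have htlim : WeakStarLim ν Y' U (fun n => (p n).1.2) t := by
    intro u hu
    have h1 := (ht'lim u hu).const_mul 2
    simp only [inner_smul_left, RCLike.conj_to_real, integral_const_mul] at h1
    simp only [t, inner_smul_left, RCLike.conj_to_real, integral_const_mul]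
    refine h1.congr fun n => ?_
    ring
  have hτlim : WeakStarLim μ Y U (fun n => (p n).1.1) (fun x => j x - j₀ x) := by
    intro u hu
    have h1 := P.integrable_inner_memL hj₀.1 hu.1
    have h2 := (hjlim u hu).sub_const (∫ x, ⟪j₀ x, u x⟫ ∂μ)
    rw [← integral_sub (P.integrable_inner_memL hj hu.1) h1] at h2
    simp only [← inner_sub_left] at h2
    refine h2.congr fun n => ?_
    rw [← integral_sub (P.integrable_inner_memL (hjL _) hu.1) h1]
    simp only [← inner_sub_left, add_sub_cancel_left]
  have hmem : ((fun x => j x - j₀ x), t) ∈ X :=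
    hclosed U p _ _ (P.right.memL_sub hj hj₀.1) ht hτlim htlim
  -- lower semicontinuity
  have hlsc : ∀ k, ∫ x, H x (goodTrunc f k j x) ∂μ + ∫ x, H' x (goodTrunc g k t x) ∂ν ≤
      m + ∫ x, ⟪G₀ x, j x - j₀ x⟫ ∂μ := by
    intro k
    obtain ⟨r, hr0, hr⟩ := hH.integral_goodTrunc_le F P (fun n => hjL (p n)) (fun n => (hpD n).1)
      hj hjlim k
    obtain ⟨r', hr0', hr'⟩ := hH'.integral_goodTrunc_le F' P' (fun n => htL (p n))
      (fun n => (hpD n).2) ht htlim k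
    have hlim := ((hytend.mono_left hU).add (hτlim.flip hG₀)).sub (hr0.add hr0')
    rw [add_zero, sub_zero] at hlim
    refine ge_of_tendsto' hlim fun n => ?_
    have h1 := hr n
    have h2 := hr' n
    have h3 := hpy n
    simp only [J] at h3
    linarith
  have hint0 : ∀ k, 0 ≤ ∫ x, H x (goodTrunc f k j x) ∂μ := fun k =>
    integral_nonneg_of_ae (by filter_upwards [hH.nonneg] with x hx using hx _)
  have hint0' : ∀ k, 0 ≤ ∫ x, H' x (goodTrunc g k t x) ∂ν := fun k =>
    integral_nonneg_of_ae (by filter_upwards [hH'.nonneg] with x hx using hx _)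
  obtain ⟨hHj, hHjlim⟩ := hH.tendsto_goodTrunc F P (P.right.memL_iff.1 hj).1.1
    (M := m + ∫ x, ⟪G₀ x, j x - j₀ x⟫ ∂μ) fun k => by linarith [hlsc k, hint0' k]
  obtain ⟨hHt, hHtlim⟩ := hH'.tendsto_goodTrunc F' P' (P'.right.memL_iff.1 ht).1.1
    (M := m + ∫ x, ⟪G₀ x, j x - j₀ x⟫ ∂μ) fun k => by linarith [hlsc k, hint0 k]
  have hfin := le_of_tendsto' (hHjlim.add hHtlim) hlsc
  refine ⟨_, hmem, by simpa using hHj, hHt, fun q hq hq1 hq2 => ?_⟩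
  have h1 : m ≤ J ⟨q, hq⟩ := csInf_le hbdd ⟨⟨q, hq⟩, ⟨hq1, hq2⟩, rfl⟩
  simp only [J] at h1
  simp only [add_sub_cancel]
  linarith

/-- The variational inequality for the minimizer, with integrability of both terms. -/
theorem exists_variational_solution (P : DualPair μ Y Z) (P' : DualPair ν Y' Z')
    (F : IsFlux μ Y Z f a C) (F' : IsFlux ν Y' Z' g a' C')
    (hf : HasPotential μ f) (hg : HasPotential ν g)
    (X : Submodule ℝ ((α → W) × (β → W'))) (hX : ∀ p ∈ X, MemL μ Z p.1 ∧ MemL ν Z' p.2)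
    (hclosed : ∀ (U : Ultrafilter ℕ) (p : ℕ → X) (τ : α → W) (t : β → W'),
      MemL μ Z τ → MemL ν Z' t → WeakStarLim μ Y U (fun n => (p n).1.1) τ →
      WeakStarLim ν Y' U (fun n => (p n).1.2) t → (τ, t) ∈ X)
    {j₀ G₀ : α → W} (hj₀ : MemE μ Z j₀) (hG₀ : MemE μ Y G₀) :
    ∃ (j : α → W) (t : β → W'), ((fun x => j x - j₀ x), t) ∈ X ∧ MemL μ Y (fun x => f x (j x)) ∧
      MemL ν Y' (fun x => g x (t x)) ∧
      ∀ q ∈ X, MemE μ Z q.1 → MemE ν Z' q.2 →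
        Integrable (fun x => ⟪f x (j x), j₀ x + q.1 x - j x⟫) μ ∧
        Integrable (fun x => ⟪g x (t x), q.2 x - t x⟫) ν ∧
        ∫ x, ⟪G₀ x, j₀ x + q.1 x - j x⟫ ∂μ ≤ ∫ x, ⟪f x (j x), j₀ x + q.1 x - j x⟫ ∂μ +
          ∫ x, ⟪g x (t x), q.2 x - t x⟫ ∂ν := by
  obtain ⟨H, hH⟩ := hf.exists_isPotential F
  obtain ⟨H', hH'⟩ := hg.exists_isPotential F'
  obtain ⟨p, hp, hpi, hpi', hmin⟩ :=
    exists_minimizer P P' F F' hH hH' X hX hclosed hj₀ hG₀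
  set j : α → W := fun x => j₀ x + p.1 x with hjdef
  set t : β → W' := p.2
  have hpL := hX p hp
  have hjL : MemL μ Z j := P.right.memL_add hj₀.1 hpL.1
  have hjm := (P.right.memL_iff.1 hjL).1.1
  have htm := (P'.right.memL_iff.1 hpL.2).1.1
  have key : ∀ q ∈ X, MemE μ Z q.1 → MemE ν Z' q.2 →
        Integrable (fun x => ⟪f x (j x), j₀ x + q.1 x - j x⟫) μ ∧
        Integrable (fun x => ⟪g x (t x), q.2 x - t x⟫) ν ∧
        ∫ x, ⟪G₀ x, j₀ x + q.1 x - j x⟫ ∂μ ≤ ∫ x, ⟪f x (j x), j₀ x + q.1 x - j x⟫ ∂μ +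
          ∫ x, ⟪g x (t x), q.2 x - t x⟫ ∂ν := by
    intro q hq hq1 hq2
    set w : α → W := fun x => j₀ x + q.1 x
    have hwE : MemE μ Z w := P.right.memE_add hj₀ hq1
    have hwm := (P.right.memE_iff.1 hwE).1.1
    have hqm := (P'.right.memE_iff.1 hq2).1.1
    have hwi := hH.integrable_of_memE P F hwE
    have hqi := hH'.integrable_of_memE P' F' hq2
    -- minimality along the segment from `(j, t)` to `(w, q.2)`
    have hstep : ∀ n : ℕ, ∫ x, ⟪G₀ x, w x - j x⟫ ∂μ ≤
        ∫ x, IsPotential.quotient H j w n x ∂μ + ∫ x, IsPotential.quotient H' t q.2 n x ∂ν := by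
      intro n
      have hn : (0 : ℝ) < (n : ℝ) + 1 := by positivity
      set s : ℝ := 1 / ((n : ℝ) + 1)
      have hs : ((n : ℝ) + 1) * s = 1 := by simp only [s]; field_simp
      have h1 := hH.integrable_segment hjm hwm hpi hwi n
      have h2 := hH'.integrable_segment htm hqm hpi' hqi n
      have h3 : ∀ x, j₀ x + (p + s • (q - p)).1 x = j x + s • (w x - j x) := fun x => by
        simp only [hjdef, w, Prod.fst_add, Prod.smul_fst, Prod.fst_sub, Pi.add_apply,
          Pi.smul_apply, Pi.sub_apply, add_sub_add_left_eq_sub]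
        abel
      have h4 := hmin (p + s • (q - p)) (X.add_mem hp (X.smul_mem s (X.sub_mem hq hp)))
        (by simpa only [h3] using h1) h2
      simp only [h3] at h4
      have h5 : ∫ x, ⟪G₀ x, (p + s • (q - p)).1 x⟫ ∂μ =
          ∫ x, ⟪G₀ x, p.1 x⟫ ∂μ + s * ∫ x, ⟪G₀ x, w x - j x⟫ ∂μ := by
        have hG1 := P.symm.integrable_inner_memL hG₀.1 hpL.1
        have hG2 := P.symm.integrable_inner_memL hG₀.1 (P.right.memL_sub hwE.1 hjL)
        rw [← integral_const_mul, ← integral_add hG1 (hG2.const_mul s)]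
        refine integral_congr_ae (ae_of_all _ fun x => ?_)
        simp only [← inner_smul_right, ← inner_add_right]
        congr 1
        have h6 : (p + s • (q - p)).1 x = (j₀ x + (p + s • (q - p)).1 x) - j₀ x := by abel
        rw [h6, h3]
        simp only [hjdef]
        abel
      have h7 : ∫ x, IsPotential.quotient H j w n x ∂μ =
          ((n : ℝ) + 1) * (∫ x, H x (j x + s • (w x - j x)) ∂μ - ∫ x, H x (j x) ∂μ) := by
        rw [← integral_sub h1 hpi, ← integral_const_mul]
        rfl
      have h8 : ∫ x, IsPotential.quotient H' t q.2 n x ∂ν =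
          ((n : ℝ) + 1) * (∫ x, H' x (t x + s • (q.2 x - t x)) ∂ν - ∫ x, H' x (t x) ∂ν) := by
        rw [← integral_sub h2 hpi', ← integral_const_mul]
        rfl
      have h9 : ∫ x, H' x ((p + s • (q - p)).2 x) ∂ν = ∫ x, H' x (t x + s • (q.2 x - t x)) ∂ν := rfl
      rw [h5, h9] at h4
      rw [h7, h8, ← mul_add]
      have h10 := mul_le_mul_of_nonneg_left h4 hn.le
      have h11 : ((n : ℝ) + 1) * (s * ∫ x, ⟪G₀ x, w x - j x⟫ ∂μ) = ∫ x, ⟪G₀ x, w x - j x⟫ ∂μ := by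
        rw [← mul_assoc, hs, one_mul]
      linarith
    -- each quotient is bounded above, hence by `hstep` the other one is bounded below
    have hub : ∀ n, ∫ x, IsPotential.quotient H j w n x ∂μ ≤
        ∫ x, H x (w x) ∂μ - ∫ x, H x (j x) ∂μ := fun n => by
      rw [← integral_sub hwi hpi]
      refine integral_mono_ae
        (((hH.integrable_segment hjm hwm hpi hwi n).sub hpi).const_mul _) (hwi.sub hpi) ?_
      filter_upwards [hH.ae_quotient_le j w] with x hx using hx n
    have hub' : ∀ n, ∫ x, IsPotential.quotient H' t q.2 n x ∂ν ≤
        ∫ x, H' x (q.2 x) ∂ν - ∫ x, H' x (t x) ∂ν := fun n => by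
      rw [← integral_sub hqi hpi']
      refine integral_mono_ae
        (((hH'.integrable_segment htm hqm hpi' hqi n).sub hpi').const_mul _) (hqi.sub hpi') ?_
      filter_upwards [hH'.ae_quotient_le t q.2] with x hx using hx n
    obtain ⟨hi, hlim⟩ := hH.tendsto_integral_quotient hjm hwm hpi hwi
      (B := ∫ x, ⟪G₀ x, w x - j x⟫ ∂μ - (∫ x, H' x (q.2 x) ∂ν - ∫ x, H' x (t x) ∂ν))
      fun n => by linarith [hstep n, hub' n]
    obtain ⟨hi', hlim'⟩ := hH'.tendsto_integral_quotient htm hqm hpi' hqi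
      (B := ∫ x, ⟪G₀ x, w x - j x⟫ ∂μ - (∫ x, H x (w x) ∂μ - ∫ x, H x (j x) ∂μ))
      fun n => by linarith [hstep n, hub n]
    exact ⟨hi, hi', ge_of_tendsto' (hlim.add hlim') hstep⟩
  -- the test pair `0` gives integrability of `f(j) · (j₀ - j)` and `g(t) · t`
  have h0 := key 0 X.zero_mem P.right.memE_zero P'.right.memE_zero
  refine ⟨j, t, ?_, ?_, ?_, key⟩
  · simpa [hjdef] using hp
  · refine F.memL_of_integrable_inner P hjm hj₀ ?_
    simpa using h0.1
  · refine F'.memL_of_integrable_inner P' htm P'.right.memE_zero ?_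
    simpa using h0.2.1

end Minimization

/-! ### Finiteness of the surface measure of the interface -/

/-- Lipschitz maps send sets of finite Hausdorff measure to sets of finite Hausdorff measure. -/
lemma _root_.LipschitzWith.euclideanHausdorffMeasure_image_lt_top {E F : Type*} [EMetricSpace E]
    [MeasurableSpace E] [BorelSpace E] [EMetricSpace F] [MeasurableSpace F] [BorelSpace F]
    {K : ℝ≥0} {h : E → F} (hh : LipschitzWith K h) {k : ℕ} {s : Set E}
    (hs : Measure.euclideanHausdorffMeasure k s < ⊤) :
    Measure.euclideanHausdorffMeasure k (h '' s) < ⊤ := by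
  have hc : Measure.addHaarScalarFactor (volume : Measure (EuclideanSpace ℝ (Fin k))) μH[k] ≠ 0 :=
    Measure.addHaarScalarFactor_volume_hausdorffMeasure_ne_zero k
  rw [Measure.euclideanHausdorffMeasure_def, Measure.smul_apply, ENNReal.smul_def, smul_eq_mul]
    at hs ⊢
  have hs' : μH[(k : ℝ)] s < ⊤ := by
    rcases ENNReal.mul_lt_top_iff.1 hs with h | h | h
    · exact h.2
    · simp [hc] at h
    · simp [h]
  refine ENNReal.mul_lt_top ENNReal.coe_lt_top ((hh.hausdorffMeasure_image_le (by simp) s).trans_lt ?_)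
  exact ENNReal.mul_lt_top (by simp) hs'

/-- A boundary point close to `x` lies on the graph that describes the set near `x`. -/
lemma eq_of_mem_frontier {d : ℕ} {U V : Set (Pt d)} {y ν : Pt d} {γ : Pt d → ℝ}
    (hγ : Continuous γ) (hV : V ∈ 𝓝 y) (h : ∀ z ∈ V, (z ∈ U ↔ γ (z - ⟪ν, z⟫ • ν) < ⟪ν, z⟫))
    (hy : y ∈ frontier U) : γ (y - ⟪ν, y⟫ • ν) = ⟪ν, y⟫ := by
  have hc1 : Continuous fun z : Pt d => γ (z - ⟪ν, z⟫ • ν) := by fun_prop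
  have hc2 : Continuous fun z : Pt d => ⟪ν, z⟫ := by fun_prop
  rcases lt_trichotomy (γ (y - ⟪ν, y⟫ • ν)) ⟪ν, y⟫ with hlt | heq | hgt
  · exfalso
    refine hy.2 (mem_interior_iff_mem_nhds.2 ?_)
    filter_upwards [hV, hc1.continuousAt.eventually_lt hc2.continuousAt hlt] with z h1 h2
    exact (h z h1).2 h2
  · exact heq
  · exfalso
    have h3 : ∀ᶠ z in 𝓝 y, z ∉ U := by
      filter_upwards [hV, hc2.continuousAt.eventually_lt hc1.continuousAt hgt] with z h1 h2
      rw [h z h1]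
      exact not_lt.2 h2.le
    exact (mem_closure_iff_frequently.1 hy.1) h3

/-- A bounded set with Lipschitz boundary has boundary of finite surface measure. -/
lemma HasLipschitzBoundary.surf_frontier_lt_top {d : ℕ} {U : Set (Pt d)} (hd : 1 ≤ d)
    (hU : HasLipschitzBoundary U) (hb : Bornology.IsBounded U) : surf d (frontier U) < ⊤ := by
  have hfb : Bornology.IsBounded (frontier U) := hb.closure.subset frontier_subset_closure
  have hcomp : IsCompact (frontier U) := Metric.isCompact_of_isClosed_isBounded isClosed_frontier hfb
  obtain ⟨R, hR⟩ := hfb.exists_norm_le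
  refine hcomp.measure_lt_top_of_nhdsWithin fun x hx => ?_
  obtain ⟨ν, hν, K, γ, hγ, V, hV, h⟩ := hU x hx
  -- near `x` the boundary is the image of a bounded subset of the hyperplane `E` under the Lipschitz
  -- map `z ↦ z + γ(z) ν`
  let E : Submodule ℝ (Pt d) := (ℝ ∙ ν)ᗮ
  have hν0 : ν ≠ 0 := by
    rintro rfl
    simp at hν
  have hdim : Module.finrank ℝ E = d - 1 := by
    have : Fact (Module.finrank ℝ (Pt d) = (d - 1) + 1) := ⟨by simp; omega⟩
    exact Submodule.finrank_orthogonal_span_singleton hν0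
  let G : E → Pt d := fun z => (z : Pt d) + γ z • ν
  have hG : LipschitzWith (1 + K) G := by
    refine LipschitzWith.of_dist_le_mul fun z z' => ?_
    have h1 : dist (γ z • ν) (γ z' • ν) ≤ K * dist z z' := by
      rw [dist_eq_norm, ← sub_smul, norm_smul, hν, mul_one, ← dist_eq_norm]
      exact hγ.dist_le_mul _ _
    calc dist (G z) (G z') ≤ dist (z : Pt d) z' + dist (γ z • ν) (γ z' • ν) := dist_add_add_le _ _ _ _
      _ ≤ dist z z' + K * dist z z' := add_le_add le_rfl h1
      _ = _ := by push_cast; ring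
  have hball : Measure.euclideanHausdorffMeasure (d - 1) (Metric.closedBall (0 : E) (2 * R)) < ⊤ := by
    rw [← hdim]
    exact (isCompact_closedBall _ _).measure_lt_top
  refine ⟨frontier U ∩ interior V,
    inter_mem self_mem_nhdsWithin (mem_nhdsWithin_of_mem_nhds (interior_mem_nhds.2 hV)),
    (measure_mono ?_).trans_lt (hG.euclideanHausdorffMeasure_image_lt_top hball)⟩
  rintro y ⟨hyU, hyV⟩
  have h1 := eq_of_mem_frontier hγ.continuous (mem_interior_iff_mem_nhds.1 hyV) h hyU
  refine ⟨⟨y - ⟪ν, y⟫ • ν, ?_⟩, ?_, ?_⟩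
  · rw [Submodule.mem_orthogonal_singleton_iff_inner_right, inner_sub_right, inner_smul_right,
      real_inner_self_eq_norm_sq, hν]
    ring
  · rw [mem_closedBall_zero_iff, Submodule.coe_norm]
    have h2 : |⟪ν, y⟫| ≤ ‖y‖ := by simpa [hν] using abs_real_inner_le_norm ν y
    calc ‖y - ⟪ν, y⟫ • ν‖ ≤ ‖y‖ + ‖⟪ν, y⟫ • ν‖ := norm_sub_le _ _
      _ ≤ ‖y‖ + ‖y‖ := by rw [norm_smul, hν, mul_one, Real.norm_eq_abs]; gcongr
      _ ≤ 2 * R := by linarith [hR y hyU]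
  · simp only [G, h1]
    abel

namespace Geometry.Admissible

variable {d : ℕ} {D : Geometry d}

lemma subset₁ (hD : D.Admissible) : D.Om₁ ⊆ D.Om := fun x hx =>
  (hD.bisected.symm ▸ Or.inl hx : x ∈ D.Om \ D.Gam).1

lemma isFiniteMeasure_vol (hD : D.Admissible) : IsFiniteMeasure D.vol :=
  ⟨by rw [Geometry.vol, Measure.restrict_apply_univ]; exact hD.bounded.measure_lt_top⟩

lemma isFiniteMeasure_sur (hd : 1 ≤ d) (hD : D.Admissible) : IsFiniteMeasure D.sur := by
  refine ⟨?_⟩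
  rw [Geometry.sur, Measure.restrict_apply_univ]
  refine (measure_mono ?_).trans_lt
    (hD.lipschitz₁.surf_frontier_lt_top hd (hD.bounded.subset hD.subset₁))
  rw [hD.interface₁]
  exact inter_subset_right

lemma integral_indicator (hD : D.Admissible) {N : ℕ} (G τ : Pt d → Mt d N) :
    ∫ x, ⟪τ x, D.Om₁.indicator G x⟫ ∂D.vol = ∫ x in D.Om₁, ⟪G x, τ x⟫ := by
  have h1 : (fun x => ⟪τ x, D.Om₁.indicator G x⟫) = D.Om₁.indicator fun x => ⟪G x, τ x⟫ := by
    ext x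
    by_cases hx : x ∈ D.Om₁ <;> simp [hx, real_inner_comm]
  rw [h1, MeasureTheory.integral_indicator hD.isOpen₁.measurableSet, Geometry.vol,
    Measure.restrict_restrict hD.isOpen₁.measurableSet, inter_eq_left.2 hD.subset₁]

end Geometry.Admissible

/-! ### The spaces of fluxes as annihilators -/

lemma measurable_grad {d N : ℕ} (φ : Pt d → Vc N) : Measurable (grad φ) := by
  refine (WithLp.measurable_toLp 2 _).comp (measurable_pi_lambda _ fun p => ?_)
  have h1 : Measurable fun x => fderiv ℝ φ x (EuclideanSpace.single p.1 1) :=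
    measurable_fderiv_apply_const ℝ φ _
  exact (EuclideanSpace.proj p.2 : Vc N →L[ℝ] ℝ).continuous.measurable.comp h1

lemma exists_norm_grad_le {d N : ℕ} {φ : Pt d → Vc N} {K : ℝ≥0} (hφ : LipschitzWith K φ) :
    ∃ R : ℝ, ∀ x, ‖grad φ x‖ ≤ R := by
  refine ⟨Real.sqrt (∑ _p : Fin d × Fin N, (K : ℝ) ^ 2), fun x => ?_⟩
  rw [EuclideanSpace.norm_eq]
  refine Real.sqrt_le_sqrt (Finset.sum_le_sum fun p _ => ?_)
  refine pow_le_pow_left₀ (norm_nonneg _) ?_ 2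
  calc ‖fderiv ℝ φ x (EuclideanSpace.single p.1 1) p.2‖
      ≤ ‖fderiv ℝ φ x (EuclideanSpace.single p.1 1)‖ := PiLp.norm_apply_le _ _
    _ ≤ ‖fderiv ℝ φ x‖ * ‖(EuclideanSpace.single p.1 1 : Pt d)‖ := ContinuousLinearMap.le_opNorm _ _
    _ ≤ K := by simpa using norm_fderiv_le_of_lipschitz ℝ hφ

section Annihilator

variable {α : Type*} [MeasurableSpace α] {W : Type*}
  [NormedAddCommGroup W] [InnerProductSpace ℝ W] [FiniteDimensional ℝ W]
  {μ : Measure α} [IsFiniteMeasure μ] {Y Z : α → W → ℝ}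
  {β : Type*} [MeasurableSpace β] {W' : Type*}
  [NormedAddCommGroup W'] [InnerProductSpace ℝ W'] [FiniteDimensional ℝ W']
  {ν : Measure β} [IsFiniteMeasure ν] {Y' Z' : β → W' → ℝ}

/-- The pairs of functions in `L^Z × L^Z'` that annihilate a set `T ⊆ E^Y × E^Y'`. -/
def annihilator (P : DualPair μ Y Z) (P' : DualPair ν Y' Z') (T : Set ((α → W) × (β → W')))
    (hT : ∀ p ∈ T, MemE μ Y p.1 ∧ MemE ν Y' p.2) : Submodule ℝ ((α → W) × (β → W')) where
  carrier := {q | MemL μ Z q.1 ∧ MemL ν Z' q.2 ∧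
    ∀ p ∈ T, ∫ x, ⟪q.1 x, p.1 x⟫ ∂μ + ∫ x, ⟪q.2 x, p.2 x⟫ ∂ν = 0}
  zero_mem' := ⟨P.right.memE_zero.1, P'.right.memE_zero.1, fun p _ => by simp⟩
  add_mem' := by
    rintro q r ⟨h1, h2, h3⟩ ⟨h4, h5, h6⟩
    refine ⟨P.right.memL_add h1 h4, P'.right.memL_add h2 h5, fun p hp => ?_⟩
    obtain ⟨h7, h8⟩ := hT p hp
    have h9 := h3 p hp
    have h10 := h6 p hp
    simp only [Prod.fst_add, Prod.snd_add, Pi.add_apply, inner_add_left]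
    rw [integral_add (P.integrable_inner_memL h1 h7.1) (P.integrable_inner_memL h4 h7.1),
      integral_add (P'.integrable_inner_memL h2 h8.1) (P'.integrable_inner_memL h5 h8.1)]
    linarith
  smul_mem' := by
    rintro c q ⟨h1, h2, h3⟩
    refine ⟨P.right.memL_smul h1 c, P'.right.memL_smul h2 c, fun p hp => ?_⟩
    have h9 := h3 p hp
    simp only [Prod.smul_fst, Prod.smul_snd, Pi.smul_apply, inner_smul_left, RCLike.conj_to_real,
      integral_const_mul]
    rw [← mul_add, h9, mul_zero]

variable {P : DualPair μ Y Z} {P' : DualPair ν Y' Z'} {T : Set ((α → W) × (β → W'))}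
    {hT : ∀ p ∈ T, MemE μ Y p.1 ∧ MemE ν Y' p.2}

lemma annihilator_closed {I : Type*} {l : Filter I} [l.NeBot]
    (q : I → annihilator P P' T hT) {τ : α → W} {t : β → W'} (hτ : MemL μ Z τ) (ht : MemL ν Z' t)
    (h : WeakStarLim μ Y l (fun n => (q n).1.1) τ)
    (h' : WeakStarLim ν Y' l (fun n => (q n).1.2) t) : (τ, t) ∈ annihilator P P' T hT := by
  refine ⟨hτ, ht, fun p hp => ?_⟩
  have h1 := (h p.1 (hT p hp).1).add (h' p.2 (hT p hp).2)
  refine tendsto_nhds_unique h1 (tendsto_const_nhds.congr fun n => ?_)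
  exact ((q n).2.2.2 p hp).symm

/-- The elements of `annihilator P P' T hT` that belong to `E^Z × E^Z'`. -/
def annihilatorE (P : DualPair μ Y Z) (P' : DualPair ν Y' Z') (T : Set ((α → W) × (β → W')))
    (hT : ∀ p ∈ T, MemE μ Y p.1 ∧ MemE ν Y' p.2) : Submodule ℝ ((α → W) × (β → W')) where
  carrier := {q | q ∈ annihilator P P' T hT ∧ MemE μ Z q.1 ∧ MemE ν Z' q.2}
  zero_mem' := ⟨Submodule.zero_mem _, P.right.memE_zero, P'.right.memE_zero⟩
  add_mem' := by
    rintro q r ⟨h1, h2, h3⟩ ⟨h4, h5, h6⟩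
    exact ⟨Submodule.add_mem _ h1 h4, P.right.memE_add h2 h5, P'.right.memE_add h3 h6⟩
  smul_mem' := by
    rintro c q ⟨h1, h2, h3⟩
    exact ⟨Submodule.smul_mem _ c h1, P.right.memE_smul h2 c, P'.right.memE_smul h3 c⟩

end Annihilator

section Fluxes

variable {d N : ℕ} {D : Geometry d} {Φ : Pt d → Mt d N → ℝ} {Ψ : Pt d → Vc N → ℝ}

/-- The pairs against which the fluxes in `X` and their normal traces are tested: gradients and
jumps of functions in `EP`, and the pairs that define the normal trace. -/
def fluxTests (D : Geometry d) (Φ : Pt d → Mt d N → ℝ) (Ψ : Pt d → Vc N → ℝ) :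
    Set ((Pt d → Mt d N) × (Pt d → Vc N)) :=
  {p | (∃ q, MemEP D Φ Ψ q p.1 p.2) ∨ ∃ φ : Pt d → Vc N, (∃ K : ℝ≥0, LipschitzWith K φ) ∧
    HasCompactSupport φ ∧ tsupport φ ⊆ D.Om ∧ p = (D.Om₁.indicator (grad φ), fun x => -φ x)}

lemma memE_indicator_grad [IsFiniteMeasure D.vol] (hD : D.Admissible) (hΦ : IsYoungFn D.vol Φ)
    {φ : Pt d → Vc N} {K : ℝ≥0} (hφ : LipschitzWith K φ) :
    MemE D.vol Φ (D.Om₁.indicator (grad φ)) := by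
  obtain ⟨R, hR⟩ := exists_norm_grad_le hφ
  refine hΦ.memE_of_bounded (R := R)
    ((measurable_grad φ).indicator hD.isOpen₁.measurableSet).aestronglyMeasurable
    (ae_of_all _ fun x => (norm_indicator_le_norm_self _ _).trans (hR x))

lemma memE_of_lipschitz [IsFiniteMeasure D.sur] (hΨ : IsYoungFn D.sur Ψ)
    {φ : Pt d → Vc N} {K : ℝ≥0} (hφ : LipschitzWith K φ) (hs : HasCompactSupport φ) :
    MemE D.sur Ψ φ := by
  obtain ⟨R, hR⟩ := hφ.continuous.bounded_above_of_compact_support hs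
  exact hΨ.memE_of_bounded (R := R) hφ.continuous.aestronglyMeasurable (ae_of_all _ hR)

variable [IsFiniteMeasure D.vol] [IsFiniteMeasure D.sur]

lemma memE_of_mem_fluxTests (hD : D.Admissible) (hΦ : IsYoungFn D.vol Φ) (hΨ : IsYoungFn D.sur Ψ) :
    ∀ p ∈ fluxTests D Φ Ψ, MemE D.vol Φ p.1 ∧ MemE D.sur Ψ p.2 := by
  rintro p (⟨q, hq⟩ | ⟨φ, ⟨K, hK⟩, hs, -, rfl⟩)
  · exact ⟨hq.memE, hq.memE_jump⟩
  · exact ⟨memE_indicator_grad hD hΦ hK, by simpa using hΨ.memE_smul (memE_of_lipschitz hΨ hK hs) (-1)⟩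

variable (P : DualPair D.vol Φ (conj Φ)) (P' : DualPair D.sur Ψ (conj Ψ))

/-- The space `X` as a vector space of pairs of a flux and its normal trace. -/
def fluxSpace (hD : D.Admissible) : Submodule ℝ ((Pt d → Mt d N) × (Pt d → Vc N)) :=
  annihilator P P' (fluxTests D Φ Ψ) (memE_of_mem_fluxTests hD P.left P'.left)

/-- The space `EX` as a vector space of pairs of a flux and its normal trace. -/
def fluxSpaceE (hD : D.Admissible) : Submodule ℝ ((Pt d → Mt d N) × (Pt d → Vc N)) :=
  annihilatorE P P' (fluxTests D Φ Ψ) (memE_of_mem_fluxTests hD P.left P'.left)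

lemma mem_fluxSpace (hD : D.Admissible) {τ : Pt d → Mt d N} {t : Pt d → Vc N} :
    (τ, t) ∈ fluxSpace P P' hD ↔ MemX D Φ Ψ τ t := by
  constructor
  · rintro ⟨h1, h2, h3⟩
    refine ⟨h1, ⟨(P'.right.memL_iff.1 h2).1, fun φ hK hs hsub => ?_⟩, h2, fun q G J hq => ?_⟩
    · have h4 := h3 _ (Or.inr ⟨φ, hK, hs, hsub, rfl⟩)
      simp only [inner_neg_right, integral_neg] at h4
      rw [← hD.integral_indicator]
      linarith
    · have h4 := h3 (G, J) (Or.inl ⟨q, hq⟩)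
      simp only [real_inner_comm] at h4 ⊢
      linarith
  · intro h
    refine ⟨h.memL, h.memL_trace, ?_⟩
    rintro p (⟨q, hq⟩ | ⟨φ, hK, hs, hsub, rfl⟩)
    · have h4 := h.orthogonal q _ _ hq
      simp only [real_inner_comm] at h4 ⊢
      linarith
    · have h4 := h.normalTrace.2 φ hK hs hsub
      rw [← hD.integral_indicator] at h4
      simp only [inner_neg_right, integral_neg]
      linarith

lemma mem_fluxSpaceE (hD : D.Admissible) {τ : Pt d → Mt d N} {t : Pt d → Vc N} :
    (τ, t) ∈ fluxSpaceE P P' hD ↔ MemEX D Φ Ψ τ t :=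
  ⟨fun h => ⟨(mem_fluxSpace P P' hD).1 h.1, h.2.1, h.2.2⟩,
    fun h => ⟨(mem_fluxSpace P P' hD).2 h.memX, h.memE, h.memE_trace⟩⟩

lemma IsNormalTrace.add (hD : D.Admissible) {τ τ' : Pt d → Mt d N} {t t' : Pt d → Vc N}
    (hτ : Integrable τ D.vol) (hτ' : Integrable τ' D.vol) (h : IsNormalTrace D τ t)
    (h' : IsNormalTrace D τ' t') :
    IsNormalTrace D (fun x => τ x + τ' x) (fun x => t x + t' x) := by
  refine ⟨h.1.add h'.1, fun φ hK hs hsub => ?_⟩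
  obtain ⟨K, hφ⟩ := hK
  have h1 := h.2 φ ⟨K, hφ⟩ hs hsub
  have h2 := h'.2 φ ⟨K, hφ⟩ hs hsub
  obtain ⟨R, hR⟩ := exists_norm_grad_le hφ
  obtain ⟨M, hM⟩ := hφ.continuous.bounded_above_of_compact_support hs
  have h3 : ∀ {t : Pt d → Vc N}, Integrable t D.sur → Integrable (fun x => ⟪t x, φ x⟫) D.sur := by
    intro t ht
    refine (ht.norm.mul_const M).mono' (ht.1.inner hφ.continuous.aestronglyMeasurable)
      (ae_of_all _ fun x => (norm_inner_le_norm _ _).trans ?_)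
    gcongr
    exact hM x
  have h4 : ∀ {τ : Pt d → Mt d N}, Integrable τ D.vol →
      Integrable (fun x => ⟪grad φ x, τ x⟫) (volume.restrict D.Om₁) := by
    intro τ hτ
    have hτ1 : Integrable τ (volume.restrict D.Om₁) :=
      hτ.mono_measure (Measure.restrict_mono hD.subset₁ le_rfl)
    refine (hτ1.norm.const_mul R).mono' ((measurable_grad φ).aestronglyMeasurable.inner hτ1.1)
      (ae_of_all _ fun x => (norm_inner_le_norm _ _).trans ?_)
    gcongr
    exact hR x
  simp only [inner_add_left, inner_add_right]
  rw [integral_add (h3 h.1) (h3 h'.1), integral_add (h4 hτ) (h4 hτ'), h1, h2]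

end Fluxes

/-! ### Existence and uniqueness -/

lemma MemL.congr {α : Type*} [MeasurableSpace α] {W : Type*} [NormedAddCommGroup W]
    [InnerProductSpace ℝ W] {μ : Measure α} {Y : α → W → ℝ} {v w : α → W} (hv : MemL μ Y v)
    (h : ∀ᵐ x ∂μ, v x = w x) : MemL μ Y w := by
  obtain ⟨l, hl, hi, hm⟩ := hv
  refine ⟨l, hl, hi.congr ?_, ?_⟩
  · filter_upwards [h] with x hx
    rw [hx]
  · rw [modular, lintegral_congr_ae (g := fun x => ENNReal.ofReal (Y x (l⁻¹ • v x)))]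
    · exact hm
    · filter_upwards [h] with x hx
      rw [hx]

section Solutions

variable {d N : ℕ} {D : Geometry d} {Φ : Pt d → Mt d N → ℝ} {Ψ : Pt d → Vc N → ℝ}
  [IsFiniteMeasure D.vol] [IsFiniteMeasure D.sur]

/-- The `Δ₂` condition for both primal functions, or for both complementary functions. -/
def DeltaCondition (D : Geometry d) (Φ : Pt d → Mt d N → ℝ) (Ψ : Pt d → Vc N → ℝ) : Prop :=
  DeltaTwo D.vol Φ ∧ DeltaTwo D.sur Ψ ∨ DeltaTwo D.vol (conj Φ) ∧ DeltaTwo D.sur (conj Ψ)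

/-- Under the `Δ₂` assumption a linear identity valid on `EX` extends to `BX`: either the coefficients are
admissible test functions for weak-star convergence, or `EX = X`. -/
lemma MemBX.identity (P : DualPair D.vol Φ (conj Φ)) (P' : DualPair D.sur Ψ (conj Ψ))
    (hΔ : DeltaCondition D Φ Ψ) {χ : Pt d → Mt d N} {γ : Pt d → Vc N}
    (hχ : MemL D.vol Φ χ) (hγ : MemL D.sur Ψ γ)
    (h : ∀ τ t, MemEX D Φ Ψ τ t → ∫ x, ⟪χ x, τ x⟫ ∂D.vol + ∫ x, ⟪γ x, t x⟫ ∂D.sur = 0)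
    {τ : Pt d → Mt d N} {t : Pt d → Vc N} (hτ : MemBX D Φ Ψ τ t) :
    ∫ x, ⟪χ x, τ x⟫ ∂D.vol + ∫ x, ⟪γ x, t x⟫ ∂D.sur = 0 := by
  rcases hΔ with ⟨h1, h2⟩ | ⟨h1, h2⟩
  · obtain ⟨τs, ts, hs, hτs, hts⟩ := hτ.approx
    have h3 := hτs χ (P.left.memE_of_deltaTwo h1 hχ)
    have h4 := hts γ (P'.left.memE_of_deltaTwo h2 hγ)
    simp only [real_inner_comm] at h3 h4
    refine tendsto_nhds_unique (h3.add h4) (tendsto_const_nhds.congr fun n => ?_)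
    exact (h _ _ (hs n)).symm
  · exact h _ _ ⟨hτ.memX, P.right.memE_of_deltaTwo h1 hτ.memX.memL,
      P'.right.memE_of_deltaTwo h2 hτ.memX.memL_trace⟩

lemma MemX.sub (hD : D.Admissible) (P : DualPair D.vol Φ (conj Φ)) (P' : DualPair D.sur Ψ (conj Ψ))
    {τ τ' : Pt d → Mt d N} {t t' : Pt d → Vc N} (h : MemX D Φ Ψ τ t) (h' : MemX D Φ Ψ τ' t') :
    MemX D Φ Ψ (fun x => τ x - τ' x) (fun x => t x - t' x) := by
  have h1 := Submodule.sub_mem _ ((mem_fluxSpace P P' hD).2 h) ((mem_fluxSpace P P' hD).2 h')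
  rw [Prod.mk_sub_mk] at h1
  exact (mem_fluxSpace P P' hD).1 h1

lemma MemEX.sub (hD : D.Admissible) (P : DualPair D.vol Φ (conj Φ)) (P' : DualPair D.sur Ψ (conj Ψ))
    {τ τ' : Pt d → Mt d N} {t t' : Pt d → Vc N} (h : MemEX D Φ Ψ τ t) (h' : MemEX D Φ Ψ τ' t') :
    MemEX D Φ Ψ (fun x => τ x - τ' x) (fun x => t x - t' x) :=
  ⟨h.memX.sub hD P P' h'.memX, P.right.memE_sub h.memE h'.memE,
    P'.right.memE_sub h.memE_trace h'.memE_trace⟩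

lemma MemEX.smul (hD : D.Admissible) (P : DualPair D.vol Φ (conj Φ))
    (P' : DualPair D.sur Ψ (conj Ψ)) {τ : Pt d → Mt d N} {t : Pt d → Vc N}
    (h : MemEX D Φ Ψ τ t) (c : ℝ) : MemEX D Φ Ψ (fun x => c • τ x) (fun x => c • t x) :=
  (mem_fluxSpaceE P P' hD).1 (Submodule.smul_mem _ c ((mem_fluxSpaceE P P' hD).2 h))

lemma WeakStarTendsto.sub {α : Type*} [MeasurableSpace α] {W : Type*}
    [NormedAddCommGroup W] [InnerProductSpace ℝ W] [FiniteDimensional ℝ W]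
    {μ : Measure α} [IsFiniteMeasure μ] {Y Z : α → W → ℝ} (P : DualPair μ Y Z)
    {v w : ℕ → α → W} {v' w' : α → W} (hv : ∀ n, MemL μ Z (v n)) (hw : ∀ n, MemL μ Z (w n))
    (hv' : MemL μ Z v') (hw' : MemL μ Z w') (h : WeakStarTendsto μ Y v v')
    (h' : WeakStarTendsto μ Y w w') :
    WeakStarTendsto μ Y (fun n x => v n x - w n x) (fun x => v' x - w' x) := by
  intro u hu
  simp only [inner_sub_left]
  rw [integral_sub (P.integrable_inner_memL hv' hu.1) (P.integrable_inner_memL hw' hu.1)]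
  refine ((h u hu).sub (h' u hu)).congr fun n => ?_
  rw [integral_sub (P.integrable_inner_memL (hv n) hu.1) (P.integrable_inner_memL (hw n) hu.1)]

lemma MemBX.sub (hD : D.Admissible) (P : DualPair D.vol Φ (conj Φ)) (P' : DualPair D.sur Ψ (conj Ψ))
    {τ τ' : Pt d → Mt d N} {t t' : Pt d → Vc N} (h : MemBX D Φ Ψ τ t) (h' : MemBX D Φ Ψ τ' t') :
    MemBX D Φ Ψ (fun x => τ x - τ' x) (fun x => t x - t' x) := by
  refine ⟨h.memX.sub hD P P' h'.memX, ?_⟩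
  obtain ⟨τs, ts, hs, h1, h2⟩ := h.approx
  obtain ⟨τs', ts', hs', h3, h4⟩ := h'.approx
  exact ⟨_, _, fun n => (hs n).sub hD P P' (hs' n),
    h1.sub P (fun n => (hs n).memE.1) (fun n => (hs' n).memE.1) h.memX.memL h'.memX.memL h3,
    h2.sub P' (fun n => (hs n).memE_trace.1) (fun n => (hs' n).memE_trace.1) h.memX.memL_trace
      h'.memX.memL_trace h4⟩

variable {f : Pt d → Mt d N → Mt d N} {g : Pt d → Vc N → Vc N} {G₀ j₀ j : Pt d → Mt d N}
  {w : Pt d → Vc N}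

lemma IsNormalTrace.of_sub (hD : D.Admissible) (P : DualPair D.vol Φ (conj Φ))
    (hj₀ : FluxDatum D Φ j₀) (h : MemX D Φ Ψ (fun x => j x - j₀ x) w) : IsNormalTrace D j w := by
  have := hj₀.normal_zero.add hD (P.right.memL_iff.1 hj₀.memE.1).1 (P.right.memL_iff.1 h.memL).1
    h.normalTrace
  simpa using this

lemma MemL.of_sub (P : DualPair D.vol Φ (conj Φ)) (hj₀ : MemE D.vol (conj Φ) j₀)
    (h : MemX D Φ Ψ (fun x => j x - j₀ x) w) : MemL D.vol (conj Φ) j := by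
  simpa using P.right.memL_add hj₀.1 h.memL

/-- The weak identity in the form of a vanishing linear functional. -/
lemma weakIdentity_iff (P : DualPair D.vol Φ (conj Φ)) (P' : DualPair D.sur Ψ (conj Ψ))
    (hG₀ : MemE D.vol Φ G₀) (hf : MemL D.vol Φ fun x => f x (j x))
    (hg : MemL D.sur Ψ fun x => g x (w x)) {τ : Pt d → Mt d N} {t : Pt d → Vc N}
    (hτ : MemX D Φ Ψ τ t) :
    WeakIdentity D f g G₀ j w τ t ↔
      ∫ x, ⟪f x (j x) - G₀ x, τ x⟫ ∂D.vol + ∫ x, ⟪g x (w x), t x⟫ ∂D.sur = 0 := by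
  have h1 := P.symm.integrable_inner_memL hf hτ.memL
  have h2 := P.symm.integrable_inner_memL hG₀.1 hτ.memL
  have h3 := P'.symm.integrable_inner_memL hg hτ.memL_trace
  simp only [inner_sub_left]
  rw [integral_sub h1 h2]
  constructor
  · rintro ⟨-, -, -, h⟩
    linarith
  · exact fun h => ⟨h1, h3, h2, by linarith⟩

lemma IsWeakSolution.identity_memBX (P : DualPair D.vol Φ (conj Φ))
    (P' : DualPair D.sur Ψ (conj Ψ)) (hΔ : DeltaCondition D Φ Ψ) (hG₀ : MemE D.vol Φ G₀)
    (h : IsWeakSolution D Φ Ψ f g G₀ j₀ j w) {τ : Pt d → Mt d N} {t : Pt d → Vc N}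
    (hτ : MemBX D Φ Ψ τ t) :
    ∫ x, ⟪f x (j x) - G₀ x, τ x⟫ ∂D.vol + ∫ x, ⟪g x (w x), t x⟫ ∂D.sur = 0 :=
  MemBX.identity P P' hΔ (P.left.memL_sub h.memL_f hG₀.1) h.memL_g
    (fun τ t hτ => (weakIdentity_iff P P' hG₀ h.memL_f h.memL_g hτ.memX).1 (h.identity τ t hτ)) hτ

/-- A weak solution in `j₀ + BX` satisfies, under the `Δ₂` assumption, both the weak identity and the variational
inequality for all test functions in `BX`. -/
lemma IsWeakSolution.test_memBX (hD : D.Admissible) (P : DualPair D.vol Φ (conj Φ))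
    (P' : DualPair D.sur Ψ (conj Ψ)) (hΔ : DeltaCondition D Φ Ψ) (hG₀ : MemE D.vol Φ G₀)
    (h : IsWeakSolution D Φ Ψ f g G₀ j₀ j w) (hj : MemBX D Φ Ψ (fun x => j x - j₀ x) w)
    {τ : Pt d → Mt d N} {t : Pt d → Vc N} (hτ : MemBX D Φ Ψ τ t) :
    WeakIdentity D f g G₀ j w τ t ∧ VariationalInequality D f g G₀ j₀ j w τ t := by
  have hsub := hj.sub hD P P' hτ
  exact ⟨(weakIdentity_iff P P' hG₀ h.memL_f h.memL_g hτ.memX).2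
      (h.identity_memBX P P' hΔ hG₀ hτ),
    P.symm.integrable_inner_memL (P.left.memL_sub h.memL_f hG₀.1) hsub.memX.memL,
    P'.symm.integrable_inner_memL h.memL_g hsub.memX.memL_trace,
    (h.identity_memBX P P' hΔ hG₀ hsub).le⟩

variable {αf αg C C' : ℝ}

/-- Existence under the `Δ₂` assumption: the weak-star limit of Galerkin solutions solves the limit equation on
`BX`, in particular with the solution itself as a test function, so that the limits of the
nonlinearities are identified by monotonicity. -/
theorem exists_isWeakSolution_memBX (hD : D.Admissible) (P : DualPair D.vol Φ (conj Φ))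
    (P' : DualPair D.sur Ψ (conj Ψ)) (F : IsFlux D.vol Φ (conj Φ) f αf C)
    (F' : IsFlux D.sur Ψ (conj Ψ) g αg C') (hΔ : DeltaCondition D Φ Ψ)
    (hG₀ : MemE D.vol Φ G₀) (hj₀ : FluxDatum D Φ j₀) :
    ∃ j w, IsWeakSolution D Φ Ψ f g G₀ j₀ j w ∧ MemBX D Φ Ψ (fun x => j x - j₀ x) w := by
  obtain ⟨j, χ, t, γ, hj, ht, hχ, hγ, ⟨q, hq1, hq2⟩, hid, hminty⟩ :=
    exists_monotone_limit P P' F F' (fluxSpaceE P P' hD) (fun p hp => hp.2) hj₀.memE hG₀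
  have hX : MemX D Φ Ψ (fun x => j x - j₀ x) t :=
    (mem_fluxSpace P P' hD).1 (annihilator_closed (fun n => ⟨(q n).1, (q n).2.1⟩)
      (P.right.memL_sub hj hj₀.memE.1) ht hq1 hq2)
  have hBX : MemBX D Φ Ψ (fun x => j x - j₀ x) t :=
    ⟨hX, _, _, fun n => (mem_fluxSpaceE P P' hD).1 (q n).2, hq1, hq2⟩
  have hχG := P.left.memL_sub hχ hG₀.1
  have hid' : ∀ τ t, MemEX D Φ Ψ τ t →
      ∫ x, ⟪χ x - G₀ x, τ x⟫ ∂D.vol + ∫ x, ⟪γ x, t x⟫ ∂D.sur = 0 := fun τ t hτ =>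
    hid (τ, t) ((mem_fluxSpaceE P P' hD).2 hτ)
  obtain ⟨hχf, hγg⟩ := hminty (MemBX.identity P P' hΔ hχG hγ hid' hBX)
  have hfL : MemL D.vol Φ fun x => f x (j x) := MemL.congr hχ hχf
  have hgL : MemL D.sur Ψ fun x => g x (t x) := MemL.congr hγ hγg
  refine ⟨j, t, ⟨IsNormalTrace.of_sub hD P hj₀ hX, hX, hfL, hgL, fun τ s hτ => ?_⟩, hBX⟩
  rw [weakIdentity_iff P P' hG₀ hfL hgL hτ.memX, ← hid' τ s hτ]
  congr 1
  · refine integral_congr_ae ?_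
    filter_upwards [hχf] with x hx
    rw [hx]
  · refine integral_congr_ae ?_
    filter_upwards [hγg] with x hx
    rw [hx]

/-- Existence for potential nonlinearities: the minimizer of the energy satisfies the variational
inequality, which on the linear space `EX` is the weak identity. -/
theorem exists_isVariationalWeakSolution (hD : D.Admissible) (P : DualPair D.vol Φ (conj Φ))
    (P' : DualPair D.sur Ψ (conj Ψ)) (F : IsFlux D.vol Φ (conj Φ) f αf C)
    (F' : IsFlux D.sur Ψ (conj Ψ) g αg C') (hf : HasPotential D.vol f) (hg : HasPotential D.sur g)
    (hG₀ : MemE D.vol Φ G₀) (hj₀ : FluxDatum D Φ j₀) :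
    ∃ j w, IsVariationalWeakSolution D Φ Ψ f g G₀ j₀ j w ∧ IsWeakSolution D Φ Ψ f g G₀ j₀ j w := by
  obtain ⟨j, t, hmem, hfL, hgL, hineq⟩ := exists_variational_solution P P' F F' hf hg
    (fluxSpace P P' hD) (fun p hp => ⟨hp.1, hp.2.1⟩)
    (fun U p τ t hτ ht h h' => annihilator_closed p hτ ht h h') hj₀.memE hG₀
  have hX := (mem_fluxSpace P P' hD).1 hmem
  have hn := IsNormalTrace.of_sub hD P hj₀ hX
  have hjL := MemL.of_sub P hj₀.memE hX
  have hfG := P.left.memL_sub hfL hG₀.1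
  have hvar : ∀ τ s, MemEX D Φ Ψ τ s → VariationalInequality D f g G₀ j₀ j t τ s := by
    intro τ s hτ
    obtain ⟨h1, h2, h3⟩ := hineq (τ, s) ((mem_fluxSpace P P' hD).2 hτ.memX) hτ.memE hτ.memE_trace
    have h4 := P.symm.integrable_inner_memL hG₀.1
      (P.right.memL_sub (P.right.memL_add hj₀.memE.1 hτ.memE.1) hjL)
    have h5 : ∀ x, ⟪f x (j x) - G₀ x, j x - j₀ x - τ x⟫ =
        ⟪G₀ x, j₀ x + τ x - j x⟫ - ⟪f x (j x), j₀ x + τ x - j x⟫ := fun x => by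
      rw [← inner_sub_left, ← neg_sub (f x (j x)) (G₀ x), inner_neg_left, ← inner_neg_right]
      congr 1
      abel
    have h6 : ∀ x, ⟪g x (t x), t x - s x⟫ = -⟪g x (t x), s x - t x⟫ := fun x => by
      rw [← inner_neg_right, neg_sub]
    refine ⟨by simp only [h5]; exact h4.sub h1, by simp only [h6]; exact h2.neg, ?_⟩
    simp only [h5, h6]
    rw [integral_sub h4 h1, integral_neg]
    linarith
  refine ⟨j, t, ⟨hn, hX, hvar⟩, hn, hX, hfL, hgL, fun τ s hτ => ?_⟩
  rw [weakIdentity_iff P P' hG₀ hfL hgL hτ.memX]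
  -- an affine function of `c` that is bounded above is constant
  have hc : ∀ c : ℝ, (∫ x, ⟪f x (j x) - G₀ x, j x - j₀ x⟫ ∂D.vol + ∫ x, ⟪g x (t x), t x⟫ ∂D.sur) ≤
      c * (∫ x, ⟪f x (j x) - G₀ x, τ x⟫ ∂D.vol + ∫ x, ⟪g x (t x), s x⟫ ∂D.sur) := by
    intro c
    obtain ⟨-, -, h3⟩ := hvar _ _ (hτ.smul hD P P' c)
    simp only [inner_sub_right _ (_ - _) (c • _), inner_sub_right _ (t _), inner_smul_right] at h3
    rw [integral_sub (P.symm.integrable_inner_memL hfG hX.memL)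
        ((P.symm.integrable_inner_memL hfG hτ.memE.1).const_mul c),
      integral_sub (P'.symm.integrable_inner_memL hgL hX.memL_trace)
        ((P'.symm.integrable_inner_memL hgL hτ.memE_trace.1).const_mul c),
      integral_const_mul, integral_const_mul] at h3
    linarith
  generalize (∫ x, ⟪f x (j x) - G₀ x, τ x⟫ ∂D.vol + ∫ x, ⟪g x (t x), s x⟫ ∂D.sur) = b at hc ⊢
  generalize (∫ x, ⟪f x (j x) - G₀ x, j x - j₀ x⟫ ∂D.vol + ∫ x, ⟪g x (t x), t x⟫ ∂D.sur) = a at hc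
  by_contra hb
  have h7 := hc ((a - 1) / b)
  rw [div_mul_cancel₀ _ hb] at h7
  linarith

/-- Uniqueness: the difference of two weak solutions is an admissible test function. -/
theorem IsWeakSolution.ae_eq (hD : D.Admissible) (P : DualPair D.vol Φ (conj Φ))
    (P' : DualPair D.sur Ψ (conj Ψ)) (hΔ : DeltaCondition D Φ Ψ) (hf : StrictlyMonotone D.vol f)
    (hg : MonotoneZero D.sur g) (hG₀ : MemE D.vol Φ G₀) {j₁ j₂ : Pt d → Mt d N}
    {w₁ w₂ : Pt d → Vc N} (h₁ : IsWeakSolution D Φ Ψ f g G₀ j₀ j₁ w₁)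
    (hb₁ : MemBX D Φ Ψ (fun x => j₁ x - j₀ x) w₁)
    (h₂ : IsWeakSolution D Φ Ψ f g G₀ j₀ j₂ w₂)
    (hb₂ : MemBX D Φ Ψ (fun x => j₂ x - j₀ x) w₂) : ∀ᵐ x ∂D.vol, j₁ x = j₂ x := by
  have hsub := hb₁.sub hD P P' hb₂
  simp only [sub_sub_sub_cancel_right] at hsub
  have e₁ := h₁.identity_memBX P P' hΔ hG₀ hsub
  have e₂ := h₂.identity_memBX P P' hΔ hG₀ hsub
  have i₁ := P.symm.integrable_inner_memL (P.left.memL_sub h₁.memL_f hG₀.1) hsub.memX.memL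
  have i₂ := P.symm.integrable_inner_memL (P.left.memL_sub h₂.memL_f hG₀.1) hsub.memX.memL
  have k₁ := P'.symm.integrable_inner_memL h₁.memL_g hsub.memX.memL_trace
  have k₂ := P'.symm.integrable_inner_memL h₂.memL_g hsub.memX.memL_trace
  have hfx : ∀ x, ⟪f x (j₁ x) - G₀ x, j₁ x - j₂ x⟫ - ⟪f x (j₂ x) - G₀ x, j₁ x - j₂ x⟫ =
      ⟪f x (j₁ x) - f x (j₂ x), j₁ x - j₂ x⟫ := fun x => by
    rw [← inner_sub_left, sub_sub_sub_cancel_right]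
  have hgx : ∀ x, ⟪g x (w₁ x), w₁ x - w₂ x⟫ - ⟪g x (w₂ x), w₁ x - w₂ x⟫ =
      ⟪g x (w₁ x) - g x (w₂ x), w₁ x - w₂ x⟫ := fun x => by rw [← inner_sub_left]
  have hi : Integrable (fun x => ⟪f x (j₁ x) - f x (j₂ x), j₁ x - j₂ x⟫) D.vol := by
    simp only [← hfx]; exact i₁.sub i₂
  have hsum : ∫ x, ⟪f x (j₁ x) - f x (j₂ x), j₁ x - j₂ x⟫ ∂D.vol +
      ∫ x, ⟪g x (w₁ x) - g x (w₂ x), w₁ x - w₂ x⟫ ∂D.sur = 0 := by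
    simp only [← hfx, ← hgx]
    rw [integral_sub i₁ i₂, integral_sub k₁ k₂]
    linarith
  have hf0 : ∀ᵐ x ∂D.vol, 0 ≤ ⟪f x (j₁ x) - f x (j₂ x), j₁ x - j₂ x⟫ := by
    filter_upwards [hf] with x hx
    by_cases h : j₁ x = j₂ x
    · simp [h]
    · exact (hx _ _ h).le
  have hg0 : 0 ≤ ∫ x, ⟪g x (w₁ x) - g x (w₂ x), w₁ x - w₂ x⟫ ∂D.sur :=
    integral_nonneg_of_ae (by filter_upwards [hg.1] with x hx using hx _ _)
  have hzero : ∫ x, ⟪f x (j₁ x) - f x (j₂ x), j₁ x - j₂ x⟫ ∂D.vol = 0 :=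
    le_antisymm (by linarith) (integral_nonneg_of_ae hf0)
  filter_upwards [(integral_eq_zero_iff_of_nonneg_ae hf0 hi).1 hzero, hf] with x hx1 hx2
  by_contra h
  exact (hx2 _ _ h).ne' hx1

end Solutions

end FluxInterface

end

theorem mainTheorem2 {d N : ℕ} (hd : 2 ≤ d) (hN : 1 ≤ N)
    (D : FluxInterface.Geometry d) (hD : D.Admissible)
    (Φ : FluxInterface.Pt d → FluxInterface.Mt d N → ℝ)
    (Ψ : FluxInterface.Pt d → FluxInterface.Vc N → ℝ)
    (hΦ : FluxInterface.IsNFunction D.vol Φ)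
    (hΨ : FluxInterface.IsNFunction D.sur Ψ)
    (hΦfin : FluxInterface.FiniteOnConstants D.vol Φ)
    (hΦfin' : FluxInterface.FiniteOnConstants D.vol (FluxInterface.conj Φ))
    (hΨfin : FluxInterface.FiniteOnConstants D.sur Ψ)
    (hΨfin' : FluxInterface.FiniteOnConstants D.sur (FluxInterface.conj Ψ))
    (f : FluxInterface.Pt d → FluxInterface.Mt d N → FluxInterface.Mt d N)
    (g : FluxInterface.Pt d → FluxInterface.Vc N → FluxInterface.Vc N)
    (hf : FluxInterface.IsCaratheodory D.vol f)
    (hg : FluxInterface.IsCaratheodory D.sur g)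
    (hf_mono : FluxInterface.MonotoneZero D.vol f)
    (hg_mono : FluxInterface.MonotoneZero D.sur g)
    (C αf αg : ℝ) (hC : 0 ≤ C) (hαf : 0 < αf ∧ αf ≤ 1) (hαg : 0 < αg ∧ αg ≤ 1)
    (hf_coer : FluxInterface.Coercive D.vol Φ αf C f)
    (hg_coer : FluxInterface.Coercive D.sur Ψ αg C g)
    (φ₀ : FluxInterface.Pt d → FluxInterface.Vc N)
    (G₀ : FluxInterface.Pt d → FluxInterface.Mt d N)
    (hφ₀ : FluxInterface.DirichletDatum D Φ φ₀ G₀)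
    (j₀ : FluxInterface.Pt d → FluxInterface.Mt d N)
    (hj₀ : FluxInterface.FluxDatum D Φ j₀) :
    -- existence under the `Δ₂` assumption
    ((FluxInterface.DeltaTwo D.vol Φ ∧ FluxInterface.DeltaTwo D.sur Ψ ∨
        FluxInterface.DeltaTwo D.vol (FluxInterface.conj Φ) ∧
          FluxInterface.DeltaTwo D.sur (FluxInterface.conj Ψ)) →
      ∃ j w, FluxInterface.IsWeakSolution D Φ Ψ f g G₀ j₀ j w ∧
        FluxInterface.MemBX D Φ Ψ (fun x => j x - j₀ x) w ∧
        ∀ τ t, FluxInterface.MemBX D Φ Ψ τ t →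
          FluxInterface.WeakIdentity D f g G₀ j w τ t ∧
          FluxInterface.VariationalInequality D f g G₀ j₀ j w τ t) ∧
    -- existence for potential nonlinearities
    (FluxInterface.HasPotential D.vol f ∧ FluxInterface.HasPotential D.sur g →
      ∃ j w, FluxInterface.IsVariationalWeakSolution D Φ Ψ f g G₀ j₀ j w ∧
        FluxInterface.IsWeakSolution D Φ Ψ f g G₀ j₀ j w) ∧
    -- uniqueness
    ((FluxInterface.DeltaTwo D.vol Φ ∧ FluxInterface.DeltaTwo D.sur Ψ ∨
        FluxInterface.DeltaTwo D.vol (FluxInterface.conj Φ) ∧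
          FluxInterface.DeltaTwo D.sur (FluxInterface.conj Ψ)) →
      FluxInterface.StrictlyMonotone D.vol f →
      ∀ j₁ w₁ j₂ w₂,
        FluxInterface.IsWeakSolution D Φ Ψ f g G₀ j₀ j₁ w₁ →
        FluxInterface.MemBX D Φ Ψ (fun x => j₁ x - j₀ x) w₁ →
        FluxInterface.IsWeakSolution D Φ Ψ f g G₀ j₀ j₂ w₂ →
        FluxInterface.MemBX D Φ Ψ (fun x => j₂ x - j₀ x) w₂ →
        ∀ᵐ x ∂D.vol, j₁ x = j₂ x) := by
  have : NeZero N := ⟨by omega⟩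
  have : NeZero d := ⟨by omega⟩
  have := hD.isFiniteMeasure_vol
  have := hD.isFiniteMeasure_sur (by omega)
  have P := hΦ.dualPair hΦfin hΦfin'
  have P' := hΨ.dualPair hΨfin hΨfin'
  have F : FluxInterface.IsFlux D.vol Φ (FluxInterface.conj Φ) f αf C :=
    ⟨hf, hf_mono.1, hf_mono.2, hαf.1, hf_coer⟩
  have F' : FluxInterface.IsFlux D.sur Ψ (FluxInterface.conj Ψ) g αg C :=
    ⟨hg, hg_mono.1, hg_mono.2, hαg.1, hg_coer⟩
  refine ⟨fun hΔ => ?_, fun hpot => ?_, fun hΔ hstrict j₁ w₁ j₂ w₂ h₁ hb₁ h₂ hb₂ => ?_⟩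
  · obtain ⟨j, w, hj, hb⟩ :=
      FluxInterface.exists_isWeakSolution_memBX hD P P' F F' hΔ hφ₀.memE hj₀
    exact ⟨j, w, hj, hb, fun τ t hτ => hj.test_memBX hD P P' hΔ hφ₀.memE hb hτ⟩
  · exact FluxInterface.exists_isVariationalWeakSolution hD P P' F F' hpot.1 hpot.2 hφ₀.memE hj₀
  · exact h₁.ae_eq hD P P' hΔ hstrict hg_mono hφ₀.memE hb₁ h₂ hb₂
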